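/- **System.** Let $n\ge 1$ quadrotors carry a rigid body (payload), the $i$-th one through a cable of $n_i$ serially connected links, numbered from the quadrotor toward the payload. Masses $m_0,m_i,m_{ij}>0$, link lengths $l_{ij}>0$, gravity $g>0$, symmetric positive definite inertia matrices $J_0,J_i\in\mathbb R^{3\times3}$ and attachment points $\rho_i\in\mathbb R^3$ (from the payload's mass center, in its frame) are given; $e_3$ points downward. The state consists of the payload position $x_0$, velocity $\dot x_0$, attitude $R_0\in SO(3)$ and body angular velocity $\Omega_0$, link directions $q_{ij}\in S^2$ (toward the payload) and angular velocities $\omega_{ij}\perp q_{ij}$, and quadrotor attitudes $R_i\in SO(3)$ and angular velocities $\Omega_i$. Write $\hat x y=x\times y$, let $\vee$ be the inverse of the hat map, and set $M_{iT}=m_i+\sum_j m_{ij}$, $M_T=m_0+\sum_i M_{iT}$, $M_{0ij}=m_i+\sum_{a<j}m_{ia}$, $\bar J_0=J_0-\sum_i M_{iT}\hat\rho_i^2$. With thrusts $f_i$ and moments $M_i$ the full model is $\dot q_{ij}=\omega_{ij}\times q_{ij}$, $\dot R_0=R_0\hat\Omega_0$, $\dot R_i=R_i\hat\Omega_i$ and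 $$M_T\ddot x_0-\sum_{i,j}M_{0ij}l_{ij}\ddot q_{ij}-\sum_iM_{iT}R_0\hat\rho_i\dot\Omega_0=M_Tge_3-\sum_if_iR_ie_3-\sum_iM_{iT}R_0\hat\Omega_0^2\rho_i,$$ $$\bar J_0\dot\Omega_0+\sum_iM_{iT}\hat\rho_iR_0^T\ddot x_0-\sum_{i,j}M_{0ij}l_{ij}\hat\rho_iR_0^T\ddot q_{ij}=\sum_i\hat\rho_iR_0^T(-f_iR_ie_3+M_{iT}ge_3)-\hat\Omega_0\bar J_0\Omega_0,$$ $$\sum_{k=1}^{n_i}M_{0i\min(j,k)}l_{ik}\hat q_{ij}^2\ddot q_{ik}-M_{0ij}\hat q_{ij}^2\ddot x_0+M_{0ij}\hat q_{ij}^2R_0\hat\rho_i\dot\Omega_0=M_{0ij}\hat q_{ij}^2R_0\hat\Omega_0^2\rho_i-\hat q_{ij}^2(M_{0ij}ge_3-f_iR_ie_3),$$ $$J_i\dot\Omega_i+\Omega_i\times J_i\Omega_i=M_i .$$ Assume that $\sum_i\rho_i$ is parallel to $e_3$, so that the hanging configuration $R_0=I$, $q_{ij}=e_3$ is an equilibrium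 for the thrust vectors $u_i^*=-(M_{iT}+\frac{m_0}{n})ge_3$. **Linear design.** Let $C=[e_1,e_2]$. The linearization at the hanging configuration, with thrust vectors $u_i=u_i^*+\delta u_i$ and coordinates $\mathbf x=(\delta x_0,\eta_0,(C^T\xi_{ij})_{ij})$, where $\delta R_0=\hat\eta_0$ and $\delta q_{ij}=\xi_{ij}\times e_3$, is $\mathbf M\ddot{\mathbf x}+\mathbf G\mathbf x=\mathbf B\,\delta u$: $$M_T\delta\ddot x_0-\sum_iM_{iT}\hat\rho_i\ddot\eta_0+\sum_{i,j}M_{0ij}l_{ij}\hat e_3C(C^T\ddot\xi_{ij})=\sum_i\delta u_i,$$ $$\sum_iM_{iT}\hat\rho_i\delta\ddot x_0+\bar J_0\ddot\eta_0+\sum_{i,j}M_{0ij}l_{ij}\hat\rho_i\hat e_3C(C^T\ddot\xi_{ij})+\sum_i\tfrac{m_0}{n}g\hat\rho_i\hat e_3\eta_0=\sum_i\hat\rho_i\delta u_i,$$ $$-M_{0ij}C^T\hat e_3\delta\ddot x_0+M_{0ij}C^T\hat e_3\hat\rho_i\ddot\eta_0+\sum_{k}M_{0i\min(j,k)}l_{ik}C^T\ddot\xi_{ik}+(M_{iT}+\tfrac{m_0}{n}-M_{0ij})g\,C^T\xi_{ij}=-C^T\hat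 e_3\delta u_i .$$ Let $K_{\mathbf x},K_{\dot{\mathbf x}}$ be gain matrices, with block rows $K_{x_i},K_{\dot x_i}$, for which the matrix $$\begin{bmatrix}0&I\\-\mathbf M^{-1}(\mathbf G+\mathbf BK_{\mathbf x})&-\mathbf M^{-1}\mathbf BK_{\dot{\mathbf x}}\end{bmatrix}$$ is Hurwitz (all eigenvalues have negative real part). **Controller.** Let $x_{0_d}\in\mathbb R^3$, $k_R,k_\Omega>0$, and let $b_{1_i}:\mathbb R\to\mathbb R^3$ be smooth with, on $t\ge0$, $\|b_{1_i}\|=1$, $\|\dot b_{1_i}\|$ bounded and $\|e_3\times b_{1_i}\|$ bounded below by a positive constant. Put $e_{R_0}=\frac12(R_0-R_0^T)^\vee$, $\mathbf x=(x_0-x_{0_d},e_{R_0},C^T(e_3\times q_{ij}))$, $\dot{\mathbf x}=(\dot x_0,\Omega_0,C^T\omega_{ij})$, $A_i=-K_{x_i}\mathbf x-K_{\dot x_i}\dot{\mathbf x}+u_i^*$, $b_{3_i}=-A_i/\|A_i\|$, $$R_{i_c}=\Big[-\tfrac{\hat b_{3_i}^2b_{1_i}}{\|\hat b_{3_i}^2b_{1_i}\|},\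 \tfrac{\hat b_{3_i}b_{1_i}}{\|\hat b_{3_i}b_{1_i}\|},\ b_{3_i}\Big],\qquad \Omega_{i_c}=(R_{i_c}^T\dot R_{i_c})^\vee,$$ $e_{R_i}=\frac12(R_{i_c}^TR_i-R_i^TR_{i_c})^\vee$, $e_{\Omega_i}=\Omega_i-R_i^TR_{i_c}\Omega_{i_c}$, and take $$f_i=-A_i\cdot R_ie_3,\qquad M_i=-k_Re_{R_i}-k_\Omega e_{\Omega_i}+(R_i^TR_{i_c}\Omega_{i_c})^\wedge J_iR_i^TR_{i_c}\Omega_{i_c}+J_iR_i^TR_{i_c}\dot\Omega_{i_c}.$$ **Claim.** The equilibrium of zero tracking errors $x_0-x_{0_d},\ \dot x_0,\ e_{R_0},\ \Omega_0,\ q_{ij}-e_3,\ \omega_{ij},\ e_{R_i},\ e_{\Omega_i}$ of the closed loop is exponentially stable. Precisely, let $E$ be the Euclidean norm of the list of these errors, and let $D$ be the set where $\frac12\mathrm{tr}(I-R_0)<1$ and $\frac12\mathrm{tr}(I-R_{i_c}^TR_i)<1$ for all $i$. There are constants $c,\kappa,\gamma>0$ such that for every $t_0\ge0$: for all initial values of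 $(x_0,\dot x_0,R_0,\Omega_0,q_{ij},\omega_{ij},R_i,e_{\Omega_i})$ in $D$ with $E(t_0)<c$ there is a solution of the closed loop on $[t_0,\infty)$ with these values at $t_0$; and every solution on an interval $[t_0,T)$ that starts in $D$ with $E(t_0)<c$ stays in $D$ and satisfies $E(t)\le\kappa e^{-\gamma(t-t_0)}E(t_0)$ for all $t\in[t_0,T)$. -/

import Mathlib

open scoped Matrix

noncomputable section

namespace QuadPayload

/-! ## Vectors and rotations of `ℝ³` -/

/-- Vectors of `ℝ³`, in coordinates. -/
abbrev V3 := Fin 3 → ℝ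

/-- Real `3 × 3` matrices. -/
abbrev Mat3 := Matrix (Fin 3) (Fin 3) ℝ

/-- The Euclidean norm on `ℝ³` (the instance norm on `Fin 3 → ℝ` is the sup norm). -/
def vnorm (v : V3) : ℝ := √(v ⬝ᵥ v)

/-- The third axis; it points downward, along gravity. -/
def e3 : V3 := ![0, 0, 1]

/-- The hat map, `hat x *ᵥ y = x × y`. -/
def hat (x : V3) : Mat3 := !![0, -x 2, x 1; x 2, 0, -x 0; -x 1, x 0, 0]

/-- The vee map, inverse of the hat map on skew-symmetric matrices. -/
def vee (S : Mat3) : V3 := ![S 2 1, S 0 2, S 1 0]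

theorem hat_mulVec (x y : V3) : hat x *ᵥ y = x ⨯₃ y := by
  ext i
  fin_cases i <;> simp [hat, Matrix.mulVec, dotProduct, Fin.sum_univ_three, cross_apply] <;> ring

theorem vee_hat (x : V3) : vee (hat x) = x := by
  ext i
  fin_cases i <;> simp [hat, vee]

/-- The special orthogonal group `SO(3)`. -/
def SO3 : Set Mat3 := {R | R ∈ Matrix.specialOrthogonalGroup (Fin 3) ℝ}

/-- The attitude error vector `½ (Rdᵀ R - Rᵀ Rd)^∨` of `R` relative to `Rd`. -/
def attErr (Rd R : Mat3) : V3 := (1 / 2 : ℝ) • vee (Rdᵀ * R - Rᵀ * Rd)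

/-- The configuration error function `½ tr (I - Rdᵀ R)` on `SO(3)`. -/
def attPsi (Rd R : Mat3) : ℝ := 1 / 2 * (1 - Rdᵀ * R).trace

/-! ## The model -/

variable {n : ℕ} {ν : Fin n → ℕ}

/-- Physical parameters of `n` quadrotors carrying a rigid body, the `i`-th of them through a cable
of `ν i` serially connected links. Links are numbered from the quadrotor toward the payload. -/
structure Params (n : ℕ) (ν : Fin n → ℕ) where
  /-- gravitational acceleration -/
  g : ℝ
  /-- mass of the payload -/
  m0 : ℝ
  /-- inertia matrix of the payload -/
  J0 : Mat3
  /-- mass of the `i`-th quadrotor -/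
  m : Fin n → ℝ
  /-- inertia matrix of the `i`-th quadrotor -/
  J : Fin n → Mat3
  /-- attachment point of the `i`-th cable, in the payload frame, from its mass center -/
  ρ : Fin n → V3
  /-- mass of the `j`-th link of the `i`-th cable -/
  mL : (i : Fin n) → Fin (ν i) → ℝ
  /-- length of the `j`-th link of the `i`-th cable -/
  l : (i : Fin n) → Fin (ν i) → ℝ
  g_pos : 0 < g
  m0_pos : 0 < m0
  J0_pos : J0.PosDef
  m_pos : ∀ i, 0 < m i
  J_pos : ∀ i, (J i).PosDef
  mL_pos : ∀ i j, 0 < mL i j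
  l_pos : ∀ i j, 0 < l i j

namespace Params

/-- `M_{iT}`, the mass of the `i`-th quadrotor and its cable. -/
def MiT (p : Params n ν) (i : Fin n) : ℝ := (∑ j, p.mL i j) + p.m i

/-- `M_T`, the total mass. -/
def MT (p : Params n ν) : ℝ := p.m0 + ∑ i, p.MiT i

/-- `M_{0ij}`, the mass of the `i`-th quadrotor and of the links of its cable before the `j`-th
one. With links numbered from `0`, these are the links `a < j`. -/
def M0 (p : Params n ν) (i : Fin n) (j : ℕ) : ℝ :=
  p.m i + ∑ a : Fin (ν i), if (a : ℕ) < j then p.mL i a else 0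

/-- `J̄₀ = J₀ - ∑ᵢ M_{iT} ρ̂ᵢ²`. -/
def Jbar (p : Params n ν) : Mat3 := p.J0 - ∑ i, p.MiT i • (hat (p.ρ i) * hat (p.ρ i))

end Params

/-- The state of the system without the angular velocities of the quadrotors. -/
structure State (n : ℕ) (ν : Fin n → ℕ) where
  /-- position of the payload -/
  x0 : V3
  /-- velocity of the payload -/
  v0 : V3
  /-- attitude of the payload -/
  R0 : Mat3
  /-- angular velocity of the payload, in its body frame -/
  Ω0 : V3
  /-- direction of the `j`-th link of the `i`-th cable, from the quadrotor toward the payload -/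
  q : (i : Fin n) → Fin (ν i) → V3
  /-- angular velocity of that link -/
  ω : (i : Fin n) → Fin (ν i) → V3
  /-- attitude of the `i`-th quadrotor -/
  R : Fin n → Mat3

/-- `R₀, Rᵢ ∈ SO(3)`, `q_{ij} ∈ S²` and `q_{ij} · ω_{ij} = 0`. -/
structure State.Admissible (s : State n ν) : Prop where
  R0_mem : s.R0 ∈ SO3
  R_mem : ∀ i, s.R i ∈ SO3
  q_unit : ∀ i j, s.q i j ⬝ᵥ s.q i j = 1
  q_ω : ∀ i j, s.q i j ⬝ᵥ s.ω i j = 0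

/-- Values for the time derivatives of `v₀`, `Ω₀` and `ω_{ij}`. -/
structure Accel (n : ℕ) (ν : Fin n → ℕ) where
  /-- derivative of the payload velocity -/
  v0 : V3
  /-- derivative of the payload angular velocity -/
  Ω0 : V3
  /-- derivatives of the link angular velocities -/
  ω : (i : Fin n) → Fin (ν i) → V3

/-- The second derivative of `q_{ij}`, obtained from `q̇ = ω × q`. -/
def qdd (s : State n ν) (a : Accel n ν) (i : Fin n) (j : Fin (ν i)) : V3 :=
  a.ω i j ⨯₃ s.q i j + s.ω i j ⨯₃ (s.ω i j ⨯₃ s.q i j)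

/-- The equations of motion of payload and links when the thrust of the `i`-th quadrotor is
`-fᵢ Rᵢ e₃`. -/
structure Motion (p : Params n ν) (s : State n ν) (f : Fin n → ℝ) (a : Accel n ν) : Prop where
  payload_translation :
    p.MT • a.v0 - ∑ i, ∑ j : Fin (ν i), (p.M0 i j * p.l i j) • qdd s a i j
        - ∑ i, p.MiT i • (s.R0 *ᵥ (p.ρ i ⨯₃ a.Ω0))
      = (p.MT * p.g) • e3 + ∑ i, (-f i) • (s.R i *ᵥ e3)
        - ∑ i, p.MiT i • (s.R0 *ᵥ (s.Ω0 ⨯₃ (s.Ω0 ⨯₃ p.ρ i)))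
  payload_rotation :
    p.Jbar *ᵥ a.Ω0 + ∑ i, p.MiT i • (p.ρ i ⨯₃ (s.R0ᵀ *ᵥ a.v0))
        - ∑ i, ∑ j : Fin (ν i), (p.M0 i j * p.l i j) • (p.ρ i ⨯₃ (s.R0ᵀ *ᵥ qdd s a i j))
      = ∑ i, p.ρ i ⨯₃ (s.R0ᵀ *ᵥ ((-f i) • (s.R i *ᵥ e3) + (p.MiT i * p.g) • e3))
        - s.Ω0 ⨯₃ (p.Jbar *ᵥ s.Ω0)
  links : ∀ (i : Fin n) (j : Fin (ν i)),
    ∑ k : Fin (ν i), (p.M0 i (min (j : ℕ) k) * p.l i k) •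
          (s.q i j ⨯₃ (s.q i j ⨯₃ qdd s a i k))
        - p.M0 i j • (s.q i j ⨯₃ (s.q i j ⨯₃ a.v0))
        + p.M0 i j • (s.q i j ⨯₃ (s.q i j ⨯₃ (s.R0 *ᵥ (p.ρ i ⨯₃ a.Ω0))))
      = p.M0 i j •
          (s.q i j ⨯₃ (s.q i j ⨯₃ (s.R0 *ᵥ (s.Ω0 ⨯₃ (s.Ω0 ⨯₃ p.ρ i)))))
        - s.q i j ⨯₃ (s.q i j ⨯₃ ((p.M0 i j * p.g) • e3 - f i • (s.R i *ᵥ e3)))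

/-! ## The linearized equations and the stabilizing linear design -/

/-- Indices of the `6 + 2 ∑ᵢ νᵢ` coordinates `(δx₀, η₀, Cᵀ ξ_{ij})`, `C = [e₁, e₂]`. -/
abbrev LinIdx {n : ℕ} (ν : Fin n → ℕ) := Fin 3 ⊕ Fin 3 ⊕ (Σ i : Fin n, Fin (ν i) × Fin 2)

/-- Inertia matrix `𝐌` of the linearized equations `𝐌 ẍ + 𝐆 x = 𝐁 δu`. -/
def linM (p : Params n ν) : Matrix (LinIdx ν) (LinIdx ν) ℝ
  | .inl a, .inl b => p.MT * (1 : Mat3) a b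
  | .inl a, .inr (.inl b) => -∑ i, p.MiT i * hat (p.ρ i) a b
  | .inl a, .inr (.inr ⟨i, j, c⟩) => p.M0 i j * p.l i j * hat e3 a c.castSucc
  | .inr (.inl a), .inl b => ∑ i, p.MiT i * hat (p.ρ i) a b
  | .inr (.inl a), .inr (.inl b) => p.Jbar a b
  | .inr (.inl a), .inr (.inr ⟨i, j, c⟩) =>
      p.M0 i j * p.l i j * (hat (p.ρ i) * hat e3) a c.castSucc
  | .inr (.inr ⟨i, j, c⟩), .inl b => -(p.M0 i j * hat e3 c.castSucc b)
  | .inr (.inr ⟨i, j, c⟩), .inr (.inl b) => p.M0 i j * (hat e3 * hat (p.ρ i)) c.castSucc b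
  | .inr (.inr ⟨i, j, c⟩), .inr (.inr ⟨k, j', c'⟩) =>
      if i = k ∧ c = c' then p.M0 i (min (j : ℕ) j') * p.l k j' else 0

/-- Stiffness matrix `𝐆` of the linearized equations. -/
def linG (p : Params n ν) : Matrix (LinIdx ν) (LinIdx ν) ℝ
  | .inr (.inl a), .inr (.inl b) => ∑ i, p.m0 / n * p.g * (hat (p.ρ i) * hat e3) a b
  | .inr (.inr ⟨i, j, c⟩), .inr (.inr y) =>
      if (⟨i, j, c⟩ : Σ i : Fin n, Fin (ν i) × Fin 2) = y
        then (p.MiT i + p.m0 / n - p.M0 i j) * p.g else 0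
  | _, _ => 0

/-- Input matrix `𝐁` of the linearized equations. -/
def linB (p : Params n ν) : Matrix (LinIdx ν) (Fin n × Fin 3) ℝ
  | .inl a, (_, b) => (1 : Mat3) a b
  | .inr (.inl a), (i, b) => hat (p.ρ i) a b
  | .inr (.inr ⟨i, _, c⟩), (k, b) => if i = k then -hat e3 c.castSucc b else 0

/-- State matrix of `𝐌 ẍ + 𝐆 x = 𝐁 δu` under the PD feedback `δu = -Kx x - Kv ẋ`. -/
def linClosedLoop (p : Params n ν) (Kx Kv : Matrix (Fin n × Fin 3) (LinIdx ν) ℝ) :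
    Matrix (LinIdx ν ⊕ LinIdx ν) (LinIdx ν ⊕ LinIdx ν) ℝ :=
  Matrix.fromBlocks 0 1
    (-((linM p)⁻¹ * (linG p + linB p * Kx))) (-((linM p)⁻¹ * (linB p * Kv)))

/-- A real square matrix is Hurwitz if its complex eigenvalues have negative real part. -/
def IsHurwitz {ι : Type*} [Fintype ι] [DecidableEq ι] (A : Matrix ι ι ℝ) : Prop :=
  ∀ z ∈ spectrum ℂ (A.map (algebraMap ℝ ℂ)), z.re < 0

/-! ## The controller -/

/-- The vector `x = (x₀ - x_{0d}, e_{R₀}, Cᵀ (e₃ × q_{ij}))` fed to the linear design. -/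
def linPos (xd : V3) (s : State n ν) : LinIdx ν → ℝ
  | .inl a => (s.x0 - xd) a
  | .inr (.inl a) => attErr 1 s.R0 a
  | .inr (.inr ⟨i, j, c⟩) => (e3 ⨯₃ s.q i j) c.castSucc

/-- The vector `ẋ = (v₀, Ω₀, Cᵀ ω_{ij})` fed to the linear design. -/
def linVel (s : State n ν) : LinIdx ν → ℝ
  | .inl a => s.v0 a
  | .inr (.inl a) => s.Ω0 a
  | .inr (.inr ⟨i, j, c⟩) => s.ω i j c.castSucc

/-- The ideal total thrust `Aᵢ = uᵢ* - K_{xᵢ} x - K_{ẋᵢ} ẋ`, `uᵢ* = -(M_{iT} + m₀ / n) g e₃`. -/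
def idealThrust (p : Params n ν) (Kx Kv : Matrix (Fin n × Fin 3) (LinIdx ν) ℝ) (xd : V3)
    (s : State n ν) (i : Fin n) : V3 :=
  -((p.MiT i + p.m0 / n) * p.g) • e3
    - (fun a => (Kx *ᵥ linPos xd s) (i, a)) - (fun a => (Kv *ᵥ linVel s) (i, a))

/-- `v / ‖v‖`. -/
def unit (v : V3) : V3 := (vnorm v)⁻¹ • v

/-- The desired third body axis `b₃ = -A / ‖A‖`. -/
def axis3 (A : V3) : V3 := -unit A

/-- The desired attitude: the matrix with columns `-b̂₃² b₁ / ‖b̂₃² b₁‖`, `b̂₃ b₁ / ‖b̂₃ b₁‖`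
and `b₃ = -A / ‖A‖`. -/
def desiredAttitude (A b1 : V3) : Mat3 :=
  (Matrix.of ![-unit (axis3 A ⨯₃ (axis3 A ⨯₃ b1)), unit (axis3 A ⨯₃ b1), axis3 A])ᵀ

/-- The desired attitude `R_{ic}` of the `i`-th quadrotor in state `s` at time `t`. -/
def cmdAttitude (p : Params n ν) (Kx Kv : Matrix (Fin n × Fin 3) (LinIdx ν) ℝ) (xd : V3)
    (b1 : Fin n → ℝ → V3) (t : ℝ) (s : State n ν) (i : Fin n) : Mat3 :=
  desiredAttitude (idealThrust p Kx Kv xd s i) (b1 i t)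

/-- The angular velocity error `e_Ω = Ω - Rᵀ R_c Ω_c`. -/
def angVelErr (Rc R : Mat3) (Ωc Ω : V3) : V3 := Ω - (Rᵀ * Rc) *ᵥ Ωc

/-- The control moment, where `dΩc` is the time derivative of `Ωc`. -/
def moment (kR kΩ : ℝ) (J Rc R : Mat3) (Ωc dΩc Ω : V3) : V3 :=
  -kR • attErr Rc R - kΩ • angVelErr Rc R Ωc Ω
    + ((Rᵀ * Rc) *ᵥ Ωc) ⨯₃ (J *ᵥ ((Rᵀ * Rc) *ᵥ Ωc)) + J *ᵥ ((Rᵀ * Rc) *ᵥ dΩc)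

/-! ## The closed-loop system and its tracking errors -/

/-- `(s, Ω)` is a motion of the controlled full system on the time set `I`, and `Ωc i` is the
desired angular velocity `(R_{ic}ᵀ Ṙ_{ic})^∨` along it. The controller is required to be defined
along the motion: `Aᵢ ≠ 0` and `b₃ᵢ × b₁ᵢ ≠ 0`. -/
structure IsMotion (p : Params n ν) (Kx Kv : Matrix (Fin n × Fin 3) (LinIdx ν) ℝ) (kR kΩ : ℝ)
    (xd : V3) (b1 : Fin n → ℝ → V3) (I : Set ℝ)
    (s : ℝ → State n ν) (Ω Ωc : ℝ → Fin n → V3) : Prop where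
  admissible : ∀ t ∈ I, (s t).Admissible
  thrust_ne_zero : ∀ t ∈ I, ∀ i, idealThrust p Kx Kv xd (s t) i ≠ 0
  axes_ne_zero : ∀ t ∈ I, ∀ i, axis3 (idealThrust p Kx Kv xd (s t) i) ⨯₃ b1 i t ≠ 0
  deriv_x0 : ∀ t ∈ I, HasDerivWithinAt (fun τ => (s τ).x0) (s t).v0 I t
  deriv_R0 : ∀ t ∈ I, ∀ a b,
    HasDerivWithinAt (fun τ => (s τ).R0 a b) (((s t).R0 * hat (s t).Ω0) a b) I t
  deriv_q : ∀ t ∈ I, ∀ i j,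
    HasDerivWithinAt (fun τ => (s τ).q i j) ((s t).ω i j ⨯₃ (s t).q i j) I t
  deriv_R : ∀ t ∈ I, ∀ i a b,
    HasDerivWithinAt (fun τ => (s τ).R i a b) (((s t).R i * hat (Ω t i)) a b) I t
  dynamics : ∀ t ∈ I, ∃ acc : Accel n ν,
    HasDerivWithinAt (fun τ => (s τ).v0) acc.v0 I t ∧
    HasDerivWithinAt (fun τ => (s τ).Ω0) acc.Ω0 I t ∧
    (∀ i j, HasDerivWithinAt (fun τ => (s τ).ω i j) (acc.ω i j) I t) ∧
    Motion p (s t) (fun i => -(idealThrust p Kx Kv xd (s t) i ⬝ᵥ ((s t).R i *ᵥ e3))) acc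
  deriv_Rc : ∀ t ∈ I, ∀ i a b,
    HasDerivWithinAt (fun τ => cmdAttitude p Kx Kv xd b1 τ (s τ) i a b)
      ((cmdAttitude p Kx Kv xd b1 t (s t) i * hat (Ωc t i)) a b) I t
  attitude_dynamics : ∀ t ∈ I, ∀ i, ∃ dΩ dΩc : V3,
    HasDerivWithinAt (fun τ => Ω τ i) dΩ I t ∧
    HasDerivWithinAt (fun τ => Ωc τ i) dΩc I t ∧
    p.J i *ᵥ dΩ + Ω t i ⨯₃ (p.J i *ᵥ Ω t i) =
      moment kR kΩ (p.J i) (cmdAttitude p Kx Kv xd b1 t (s t) i) ((s t).R i) (Ωc t i) dΩc (Ω t i)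

/-- The Euclidean size of the tracking errors `e_{x₀} = x₀ - x_{0d}`, `ė_{x₀} = v₀`,
`e_{R₀} = ½ (R₀ - R₀ᵀ)^∨`, `e_{Ω₀} = Ω₀`, `e_{q_{ij}} = q_{ij} - e₃`, `e_{ω_{ij}} = ω_{ij}`,
`e_{Rᵢ}` and `e_{Ωᵢ}`, where `Rc` are the desired attitudes and `eΩ` the errors `e_{Ωᵢ}`. -/
def trackErr (xd : V3) (s : State n ν) (Rc : Fin n → Mat3) (eΩ : Fin n → V3) : ℝ :=
  √(vnorm (s.x0 - xd) ^ 2 + vnorm s.v0 ^ 2 + vnorm (attErr 1 s.R0) ^ 2 + vnorm s.Ω0 ^ 2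
    + (∑ i, ∑ j, (vnorm (s.q i j - e3) ^ 2 + vnorm (s.ω i j) ^ 2))
    + ∑ i, (vnorm (attErr (Rc i) (s.R i)) ^ 2 + vnorm (eΩ i) ^ 2))

/-- The attitude errors of the payload and of all quadrotors are less than `90°`: `Ψ < 1`. On this
domain the attitude error vectors vanish only at the desired attitudes. -/
def InDomain (s : State n ν) (Rc : Fin n → Mat3) : Prop :=
  attPsi 1 s.R0 < 1 ∧ ∀ i, attPsi (Rc i) (s.R i) < 1

/-- Exponential stability of the zero equilibrium of the tracking errors, uniform in the initial
time: with constants `c, κ, γ > 0`, for every initial time `t₀ ≥ 0`, all initial data with tracking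
errors less than `c` start a motion on `[t₀, ∞)`, and every motion on an interval `[t₀, T)` with
such initial data has tracking errors at most `κ e^{-γ (t - t₀)}` times the initial ones. The
initial angular velocities of the quadrotors are prescribed through the errors `e_{Ωᵢ}(t₀)`. -/
def ErrorsExpStable (p : Params n ν) (Kx Kv : Matrix (Fin n × Fin 3) (LinIdx ν) ℝ) (kR kΩ : ℝ)
    (xd : V3) (b1 : Fin n → ℝ → V3) : Prop :=
  let Rc : ℝ → State n ν → Fin n → Mat3 := fun t s i => cmdAttitude p Kx Kv xd b1 t s i
  let eΩ : ℝ → State n ν → (Fin n → V3) → (Fin n → V3) → Fin n → V3 :=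
    fun t s Ωc Ω i => angVelErr (Rc t s i) (s.R i) (Ωc i) (Ω i)
  ∃ c > 0, ∃ κ > 0, ∃ γ > 0, ∀ t₀ : ℝ, 0 ≤ t₀ →
    (∀ (sI : State n ν) (eI : Fin n → V3), sI.Admissible → InDomain sI (Rc t₀ sI) →
      trackErr xd sI (Rc t₀ sI) eI < c →
      ∃ (s : ℝ → State n ν) (Ω Ωc : ℝ → Fin n → V3),
        IsMotion p Kx Kv kR kΩ xd b1 (Set.Ici t₀) s Ω Ωc ∧
        s t₀ = sI ∧ eΩ t₀ (s t₀) (Ωc t₀) (Ω t₀) = eI) ∧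
    (∀ (T : ℝ) (s : ℝ → State n ν) (Ω Ωc : ℝ → Fin n → V3), t₀ < T →
      IsMotion p Kx Kv kR kΩ xd b1 (Set.Ico t₀ T) s Ω Ωc →
      InDomain (s t₀) (Rc t₀ (s t₀)) →
      trackErr xd (s t₀) (Rc t₀ (s t₀)) (eΩ t₀ (s t₀) (Ωc t₀) (Ω t₀)) < c →
      ∀ t ∈ Set.Ico t₀ T,
        InDomain (s t) (Rc t (s t)) ∧
        trackErr xd (s t) (Rc t (s t)) (eΩ t (s t) (Ωc t) (Ω t)) ≤
          κ * Real.exp (-γ * (t - t₀)) *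
            trackErr xd (s t₀) (Rc t₀ (s t₀)) (eΩ t₀ (s t₀) (Ωc t₀) (Ω t₀)))

end QuadPayload

end

open QuadPayload

noncomputable section

namespace QuadPayload

/-! ## Lyapunov norms of Hurwitz matrices -/

/-! Let `z` be the state of payload and links, `Qᵢ = R_{ic}ᵀ Rᵢ` the relative attitudes and `eᵢ` the
angular velocity errors. In the variables `(z, Q, e)` the closed loop is an ordinary differential
equation `closedField`, driven by `(b₁, ḃ₁)` and smooth on an open set. This works because the
accelerations depend on the attitudes of the quadrotors but not on their angular velocities, so the
desired angular velocity is an explicit function of `z`, `Q`, `b₁` and `ḃ₁`. Stability follows from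
a Lyapunov function for this equation that is the sum of an outer and an attitude part.

Outer part. The Hurwitz condition yields an inner product in which the linear closed loop is
strictly dissipative (`IsHurwitz.exists_dissipative`). It also makes the inertia matrix invertible,
so near the hanging state the equations of motion, written as `massOp = forcing`, can be solved for
the accelerations. Expanded exactly around the hanging state, they become the linear design plus
`resid` (`linM_mulVec_perp_of_massOp_eq`), and every term of `resid` is a product of two small
factors (`resid_isLittleO`). The quadrotors do not point exactly along the ideal thrust, which adds
a disturbance `δ` bounded by the attitude errors (`norm_thrustDev_le`). The result is `V̇₀ ≤ -c ‖z‖²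
+ K ‖z‖ ‖δ‖`, with `z` measured from equilibrium (`exists_outer_lyapunov`).

Attitude part. The energy `½ e·Je + kR Ψ` has derivative `-kΩ |e|²`. A small cross term `ε e_R·Je`
also produces decay in `e_R`. Uniform estimates need the desired angular velocity only to be
bounded, not small (`exists_attLyap`). Adding the attitude functions to `V₀` with a large weight
absorbs the coupling term (`exists_lyapunov`). All constants are uniform in time, since `(b₁, ḃ₁)`
stays in a compact set for `t ≥ 0`.

Consequences. A continuity argument turns the local Lyapunov inequality into exponential decay
(`exists_exp_decay`). For existence, the vector field is cut off to a bounded Lipschitz one. Its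
global solutions satisfy the constraints, and by the decay estimate they never leave the region
where the cutoff equals one. `IsMotion.hasDerivWithinAt` and `isMotion_of_solution` translate
between motions and solutions. -/

open Module in
/-- An endomorphism of a finite-dimensional complex space whose eigenvalues have negative real
parts is strictly dissipative for some inner product. -/
theorem exists_dissipative_complex (d : ℕ) : ∀ {V : Type} [AddCommGroup V] [Module ℂ V]
    [FiniteDimensional ℂ V], finrank ℂ V = d → ∀ T : V →ₗ[ℂ] V,
    (∀ z, Module.End.HasEigenvalue T z → z.re < 0) →
    ∃ (E : Type) (_ : NormedAddCommGroup E) (_ : InnerProductSpace ℂ E) (S : V →ₗ[ℂ] E) (α : ℝ),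
      0 < α ∧ Function.Injective S ∧ ∀ x, (inner ℂ (S x) (S (T x))).re ≤ -α * ‖S x‖ ^ 2 := by
  induction d with
  | zero =>
    intro V _ _ _ hV T _
    have hs : Subsingleton V := finrank_zero_iff.mp hV
    refine ⟨ℂ, inferInstance, inferInstance, 0, 1, one_pos, fun x y _ => hs.elim x y, by simp⟩
  | succ d ih =>
    intro V _ _ _ hV T hT
    have : Nontrivial V := nontrivial_of_finrank_pos (R := ℂ) (by omega)
    -- An eigenvector of the transpose is used because its kernel is an invariant hyperplane, to
    -- which the induction hypothesis applies.
    obtain ⟨z, hz⟩ := Module.End.exists_eigenvalue (Module.Dual.transpose (R := ℂ) T)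
    obtain ⟨φ, hφ⟩ := hz.exists_hasEigenvector
    have hφ0 : φ ≠ 0 := hφ.2
    have hφT : ∀ x, φ (T x) = z * φ x := fun x => by
      have := LinearMap.congr_fun hφ.apply_eq_smul x
      simpa [Module.Dual.transpose_apply] using this
    have hzre : z.re < 0 := by
      apply hT
      -- If `z` were no eigenvalue of `T`, then `T - z` would be surjective. But `φ` vanishes on its
      -- range, which would force `φ = 0`.
      by_contra hne
      have hker : LinearMap.ker (T - algebraMap ℂ (Module.End ℂ V) z) = ⊥ := by
        by_contra h
        exact hne (by
          rw [Module.End.hasEigenvalue_iff, Module.End.eigenspace_def]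
          exact h)
      have hsurj := LinearMap.injective_iff_surjective.mp (LinearMap.ker_eq_bot.mp hker)
      apply hφ0
      ext v
      obtain ⟨x, rfl⟩ := hsurj v
      simp [hφT, Module.algebraMap_end_apply]
    obtain ⟨v₀, hv₀⟩ : ∃ v, φ v ≠ 0 := by
      by_contra h
      push Not at h
      exact hφ0 (LinearMap.ext h)
    -- With `φ v = 1` the space splits as `ker φ ⊕ ℂ v`. In this splitting `T` is block triangular,
    -- with coupling `u` from the line into the hyperplane.
    set v := (φ v₀)⁻¹ • v₀ with hv_def
    have hv : φ v = 1 := by simp [hv_def, hv₀]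
    have hTW : ∀ x ∈ LinearMap.ker φ, T x ∈ LinearMap.ker φ := fun x hx => by
      rw [LinearMap.mem_ker] at hx ⊢
      rw [hφT, hx, mul_zero]
    set TW := T.restrict hTW with hTW_def
    have hdimW : finrank ℂ (LinearMap.ker φ) = d := by
      have h1 := LinearMap.finrank_range_add_finrank_ker φ
      have h2 : LinearMap.range φ = ⊤ := LinearMap.range_eq_top.mpr fun c => ⟨c • v, by simp [hv]⟩
      rw [h2, finrank_top, finrank_self] at h1
      omega
    obtain ⟨E, _, _, S, α, hα, hS, hdis⟩ := ih hdimW TW (fun w hw => by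
      obtain ⟨x, hx⟩ := hw.exists_hasEigenvector
      refine hT w (Module.End.hasEigenvalue_of_hasEigenvector (x := (x : V)) ⟨?_, ?_⟩)
      · rw [Module.End.mem_eigenspace_iff]
        have := congrArg Subtype.val hx.apply_eq_smul
        simpa [hTW_def] using this
      · simpa using hx.2)
    let π : V →ₗ[ℂ] LinearMap.ker φ :=
      LinearMap.codRestrict _ (LinearMap.id - φ.smulRight v) (fun x => by simp [hv])
    have hπ : ∀ x, (π x : V) = x - φ x • v := fun x => rfl
    let u := π (T v)
    have hπT : ∀ x, π (T x) = TW (π x) + φ x • u := fun x => by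
      ext
      simp only [hπ, hφT, hTW_def, u, Submodule.coe_add, Submodule.coe_smul,
        LinearMap.coe_restrict_apply, map_sub, map_smul, hv]
      module
    set β := -z.re with hβ
    have hβ0 : 0 < β := by linarith
    -- The norm on the hyperplane is scaled by `δ`, which multiplies the coupling by `δ`. This
    -- choice of `δ` lets the two diagonal decay rates absorb it. The `+ 1` covers `S u = 0`.
    obtain ⟨δ, hδ, hδu⟩ : ∃ δ : ℝ, 0 < δ ∧ (δ * ‖S u‖) ^ 2 ≤ α * β := by
      refine ⟨√(α * β) / (‖S u‖ + 1), by positivity, ?_⟩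
      rw [div_mul_eq_mul_div, mul_div_assoc, mul_pow, Real.sq_sqrt (by positivity)]
      have h1 : ‖S u‖ / (‖S u‖ + 1) ≤ 1 := by
        rw [div_le_one (by positivity)]; linarith
      have h2 : (‖S u‖ / (‖S u‖ + 1)) ^ 2 ≤ 1 := pow_le_one₀ (by positivity) h1
      nlinarith [mul_pos hα hβ0]
    let S' : V →ₗ[ℂ] WithLp 2 (E × ℂ) := (WithLp.linearEquiv 2 ℂ (E × ℂ)).symm.toLinearMap ∘ₗ
        (((δ : ℂ) • (S ∘ₗ π)).prod φ)
    have hS' : ∀ x, S' x = WithLp.toLp 2 ((δ : ℂ) • S (π x), φ x) := fun x => rfl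
    refine ⟨WithLp 2 (E × ℂ), inferInstance, inferInstance, S', min α β / 2, by positivity, ?_, ?_⟩
    · intro x y hxy
      rw [hS', hS'] at hxy
      obtain ⟨h1, h2⟩ := Prod.mk.inj ((WithLp.toLp_injective 2) hxy)
      have h3 := hS (smul_right_injective E (by exact_mod_cast hδ.ne' : (δ : ℂ) ≠ 0) h1)
      have h4 := congrArg Subtype.val h3
      rw [hπ, hπ, h2] at h4
      exact sub_left_injective h4
    · intro x
      have hd := hdis (π x)
      have hb : (inner ℂ (S (π x)) (φ x • S u)).re ≤ ‖S (π x)‖ * (‖φ x‖ * ‖S u‖) := by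
        refine (Complex.re_le_norm _).trans ((norm_inner_le_norm _ _).trans ?_)
        rw [norm_smul]
      have hre : (inner ℂ (φ x) (z * φ x)).re = -β * ‖φ x‖ ^ 2 := by
        have : ‖φ x‖ ^ 2 = (φ x).re * (φ x).re + (φ x).im * (φ x).im := by
          rw [← Complex.normSq_eq_norm_sq, Complex.normSq_apply]
        rw [this]
        simp [Complex.mul_re, Complex.mul_im, hβ]
        ring
      rw [hS', hS']
      rw [WithLp.prod_inner_apply, WithLp.prod_norm_sq_eq_of_L2]
      change _ ≤ -(min α β / 2) * (‖(δ : ℂ) • S (π x)‖ ^ 2 + ‖φ x‖ ^ 2)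
      rw [inner_smul_right] at hb
      simp only [hφT, hπT, map_add, map_smul, inner_smul_left, inner_smul_right, inner_add_right,
        norm_smul, Complex.add_re, smul_add]
      have e1 : ∀ w : ℂ, ((δ : ℂ) * ((starRingEnd ℂ) (δ : ℂ) * w)).re = δ ^ 2 * w.re := by
        intro w
        rw [Complex.conj_ofReal, ← mul_assoc, ← Complex.ofReal_mul, Complex.re_ofReal_mul]; ring
      rw [hre, mul_left_comm (φ x), e1, e1, Complex.norm_real,
        Real.norm_of_nonneg hδ.le]
      have hb' := mul_le_mul_of_nonneg_left hb (sq_nonneg δ)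
      have hd' := mul_le_mul_of_nonneg_left hd (sq_nonneg δ)
      have m1 : min α β / 2 ≤ α / 2 := by linarith [min_le_left α β]
      have m2 : min α β / 2 ≤ β / 2 := by linarith [min_le_right α β]
      have m3 := mul_le_mul_of_nonneg_right m1 (sq_nonneg (δ * ‖S (π x)‖))
      have m4 := mul_le_mul_of_nonneg_right m2 (sq_nonneg ‖φ x‖)
      -- Completing the square and using `(δ ‖S u‖)² ≤ αβ`, the cross term costs at most half of
      -- each decay rate.
      have key : δ ^ 2 * (‖S (π x)‖ * (‖φ x‖ * ‖S u‖)) ≤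
          α / 2 * (δ * ‖S (π x)‖) ^ 2 + β / 2 * ‖φ x‖ ^ 2 := by
        have h1 : 0 ≤ (α * (δ * ‖S (π x)‖) - δ * ‖S u‖ * ‖φ x‖) ^ 2 := sq_nonneg _
        have h2 := mul_le_mul_of_nonneg_right hδu (sq_nonneg ‖φ x‖)
        have h3 : 0 ≤ α * (α / 2 * (δ * ‖S (π x)‖) ^ 2 + β / 2 * ‖φ x‖ ^ 2 -
          δ ^ 2 * (‖S (π x)‖ * (‖φ x‖ * ‖S u‖))) := by nlinarith
        have := nonneg_of_mul_nonneg_right h3 hα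
        linarith
      nlinarith

/-- A Hurwitz matrix is strictly dissipative for some inner product. -/
theorem IsHurwitz.exists_dissipative {ι : Type} [Fintype ι] [DecidableEq ι] {A : Matrix ι ι ℝ}
    (hA : IsHurwitz A) :
    ∃ (E : Type) (_ : NormedAddCommGroup E) (_ : InnerProductSpace ℝ E) (S : (ι → ℝ) →ₗ[ℝ] E)
      (α : ℝ), 0 < α ∧ Function.Injective S ∧
        ∀ x, inner ℝ (S x) (S (A *ᵥ x)) ≤ -α * ‖S x‖ ^ 2 := by
  obtain ⟨E, _, _, S, α, hα, hS, h⟩ := exists_dissipative_complex _ (V := ι → ℂ) rfl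
    (Matrix.toLin' (A.map (algebraMap ℝ ℂ))) (fun z hz => hA z (by
      rw [← Matrix.spectrum_toLin']
      exact Module.End.hasEigenvalue_iff_mem_spectrum.mp hz))
  -- The real part of the Hermitian product is a real inner product, and real vectors embed
  -- injectively into complex ones.
  let _ : InnerProductSpace ℝ E := InnerProductSpace.rclikeToReal ℂ E
  let c : (ι → ℝ) →ₗ[ℝ] (ι → ℂ) :=
    { toFun := fun x i => (x i : ℂ)
      map_add' := fun x y => by ext; simp
      map_smul' := fun x y => by ext; simp }
  refine ⟨E, inferInstance, inferInstance, (S.restrictScalars ℝ) ∘ₗ c, α, hα, ?_, ?_⟩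
  · rw [LinearMap.coe_comp]
    refine hS.comp fun x y hxy => ?_
    ext i
    exact Complex.ofReal_injective (congrFun hxy i)
  · intro x
    have hc : c (A *ᵥ x) = Matrix.toLin' (A.map (algebraMap ℝ ℂ)) (c x) := by
      ext i
      simp [c, Matrix.mulVec, dotProduct]
    have := h (c x)
    rw [← hc] at this
    exact this

/-- A matrix with vanishing lower blocks is not Hurwitz. -/
theorem not_isHurwitz_fromBlocks_zero {ι : Type*} [Fintype ι] [DecidableEq ι] [Nonempty ι]
    (B : Matrix ι ι ℝ) : ¬ IsHurwitz (Matrix.fromBlocks 0 B 0 0 : Matrix (ι ⊕ ι) (ι ⊕ ι) ℝ) := by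
  intro h
  have h0 := h 0 (by
    rw [spectrum.zero_mem_iff, Matrix.isUnit_iff_isUnit_det, Matrix.fromBlocks_map]
    simp [Matrix.det_fromBlocks_zero₂₁])
  simp at h0

/-! ## Differential inequalities and global solutions -/

section DifferentialEquations

open Set Filter Topology

/-- Grönwall's argument: `V t * exp (2γ (t - a))` has nonpositive derivative. -/
theorem le_exp_of_deriv_le {V : ℝ → ℝ} {γ a b : ℝ} (hab : a ≤ b)
    (hV : ∀ t ∈ Icc a b, ∃ V', HasDerivWithinAt V V' (Icc a b) t ∧ V' ≤ -(2 * γ) * V t) :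
    V b ≤ V a * Real.exp (-(2 * γ) * (b - a)) := by
  choose! V' hd hle using hV
  have hE : ∀ t, HasDerivAt (fun t => Real.exp (2 * γ * (t - a)))
      (2 * γ * Real.exp (2 * γ * (t - a))) t := fun t => by
    have := (((hasDerivAt_id' t).sub_const a).const_mul (2 * γ)).exp
    convert this using 1

    ring
  have hW : ∀ t ∈ Icc a b, HasDerivWithinAt (fun t => V t * Real.exp (2 * γ * (t - a)))
      (V' t * Real.exp (2 * γ * (t - a)) + V t * (2 * γ * Real.exp (2 * γ * (t - a))))
      (Icc a b) t := fun t ht => (hd t ht).mul (hE t).hasDerivWithinAt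
  have hanti : AntitoneOn (fun t => V t * Real.exp (2 * γ * (t - a))) (Icc a b) := by
    refine antitoneOn_of_hasDerivWithinAt_nonpos (convex_Icc a b)
      (fun t ht => (hW t ht).continuousWithinAt)
      (fun t ht => (hW t (interior_subset ht)).mono interior_subset) (fun t ht => ?_)
    nlinarith [hle t (interior_subset ht), Real.exp_pos (2 * γ * (t - a))]
  have h := hanti (left_mem_Icc.mpr hab) (right_mem_Icc.mpr hab) hab
  simp only [sub_self, mul_zero, Real.exp_zero, mul_one] at h
  rw [neg_mul, Real.exp_neg, ← div_eq_mul_inv, le_div_iff₀ (Real.exp_pos _)]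
  exact h

/-- A Lyapunov function that is quadratic in the error `e` and decreases exponentially as long as
`e < r` keeps a small error below `r` and makes it decay exponentially. -/
theorem exp_decay_of_local_lyapunov {e V : ℝ → ℝ} {t₀ T r c₁ c₂ γ : ℝ} (hc₁ : 0 < c₁)
    (hγ : 0 < γ) (hr : 0 < r) (he : ContinuousOn e (Ico t₀ T)) (he0 : ∀ t, 0 ≤ e t)
    (hV : ∀ t ∈ Ico t₀ T, e t < r → c₁ * e t ^ 2 ≤ V t ∧ V t ≤ c₂ * e t ^ 2 ∧
      ∃ V', HasDerivWithinAt V V' (Ico t₀ T) t ∧ V' ≤ -(2 * γ) * V t)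
    (h₀ : e t₀ < r) (h₀' : c₂ * e t₀ ^ 2 < c₁ * r ^ 2) :
    ∀ t ∈ Ico t₀ T, e t < r ∧ e t ≤ √(c₂ / c₁) * Real.exp (-γ * (t - t₀)) * e t₀ := by
  have hdec : ∀ b ∈ Ico t₀ T, (∀ t ∈ Icc t₀ b, e t < r) →
      c₁ * e b ^ 2 ≤ c₂ * e t₀ ^ 2 * Real.exp (-(2 * γ) * (b - t₀)) := by
    intro b hb hlt
    have hsub : Icc t₀ b ⊆ Ico t₀ T := fun t ht => ⟨ht.1, ht.2.trans_lt hb.2⟩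
    have h1 := le_exp_of_deriv_le (V := V) (γ := γ) hb.1 (fun t ht => by
      obtain ⟨V', h, h'⟩ := (hV t (hsub ht) (hlt t ht)).2.2
      exact ⟨V', h.mono hsub, h'⟩)
    have h2 := (hV b hb (hlt b ⟨hb.1, le_rfl⟩)).1
    have h3 := (hV t₀ ⟨le_rfl, hb.1.trans_lt hb.2⟩ h₀).2.1
    exact h2.trans (h1.trans (mul_le_mul_of_nonneg_right h3 (Real.exp_pos _).le))
  -- The sign of `c₂` is not assumed. It is read off from `c₁ e² ≤ V ≤ c₂ e²` at the initial time,
  -- which requires a nonempty interval.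
  have hc₂ : 0 ≤ c₂ * e t₀ ^ 2 ∨ ¬ t₀ < T := by
    by_cases hT : t₀ < T
    · left
      have h := hV t₀ ⟨le_rfl, hT⟩ h₀
      exact (mul_nonneg hc₁.le (sq_nonneg _)).trans (h.1.trans h.2.1)
    · exact .inr hT
  have hlt : ∀ t ∈ Ico t₀ T, e t < r := by
    by_contra hcon
    push Not at hcon
    obtain ⟨t, ht, hrt⟩ := hcon
    have hsub : Icc t₀ t ⊆ Ico t₀ T := fun s hs => ⟨hs.1, hs.2.trans_lt ht.2⟩
    -- Consider the first time `s` at which `e ≥ r`. Before `s` the Lyapunov estimate bounds `c₁ e²`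
    -- by `c₂ e(t₀)²`, which is less than `c₁ r²`. The bound passes to the limit at `s`, a
    -- contradiction.
    have hcomp : IsCompact (Icc t₀ t ∩ e ⁻¹' Ici r) :=
      isCompact_Icc.of_isClosed_subset
        ((he.mono hsub).preimage_isClosed_of_isClosed isClosed_Icc isClosed_Ici) inter_subset_left
    obtain ⟨s, ⟨hs, hrs⟩, hmin⟩ := hcomp.exists_isLeast ⟨t, ⟨ht.1, le_rfl⟩, hrt⟩
    have hts : t₀ < s := lt_of_le_of_ne hs.1 (fun h => by
      rw [← h] at hrs; exact absurd hrs (not_le.mpr h₀))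
    have hbefore : ∀ b ∈ Ico t₀ s, e b < r := fun b hb => by
      by_contra hge
      exact absurd (hmin ⟨⟨hb.1, hb.2.le.trans hs.2⟩, not_lt.mp hge⟩) (not_le.mpr hb.2)
    have hle : ∀ b ∈ Ico t₀ s, c₁ * e b ^ 2 ≤ c₂ * e t₀ ^ 2 := fun b hb => by
      refine (hdec b ⟨hb.1, (hb.2.trans_le hs.2).trans ht.2⟩
        (fun t ht => hbefore t ⟨ht.1, ht.2.trans_lt hb.2⟩)).trans ?_
      refine mul_le_of_le_one_right (hc₂.resolve_right (not_not.mpr (hts.trans_le hs.2 |>.trans ht.2))) ?_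
      rw [Real.exp_le_one_iff]
      nlinarith [hb.1]
    have hlim : Tendsto (fun b => c₁ * e b ^ 2) (𝓝[Ico t₀ s] s) (𝓝 (c₁ * e s ^ 2)) :=
      (((he s (hsub hs)).mono (fun b hb => hsub ⟨hb.1, hb.2.le.trans hs.2⟩)).pow 2).const_mul c₁
    have : (𝓝[Ico t₀ s] s).NeBot := by
      rw [nhdsWithin_Ico_eq_nhdsLT hts]; infer_instance
    have h1 : c₁ * e s ^ 2 ≤ c₂ * e t₀ ^ 2 :=
      le_of_tendsto hlim (eventually_nhdsWithin_of_forall hle)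
    have h2 : r ^ 2 ≤ e s ^ 2 := pow_le_pow_left₀ hr.le hrs 2
    nlinarith
  intro t ht
  refine ⟨hlt t ht, ?_⟩
  have h := hdec t ht (fun s hs => hlt s ⟨hs.1, hs.2.trans_lt ht.2⟩)
  refine abs_le_of_sq_le_sq' ?_ (by have := he0 t₀; positivity) |>.2
  have hsq : Real.exp (-γ * (t - t₀)) ^ 2 = Real.exp (-(2 * γ) * (t - t₀)) := by
    rw [← Real.exp_nat_mul]; congr 1; push_cast; ring
  rw [mul_pow, mul_pow, hsq]
  -- If `e t₀ = 0` nothing is known about the sign of `c₂`, so the square root of `c₂ / c₁` cannot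
  -- be squared back.
  by_cases hz : e t₀ = 0
  · rw [hz] at h ⊢
    have : e t ^ 2 ≤ 0 := by nlinarith
    simpa using this
  · have hc₂' : 0 ≤ c₂ := by
      have h1 := hc₂.resolve_right (not_not.mpr (ht.1.trans_lt ht.2))
      have h2 : 0 < e t₀ ^ 2 := by positivity
      exact nonneg_of_mul_nonneg_left h1 h2
    rw [Real.sq_sqrt (by positivity), div_mul_eq_mul_div, div_mul_eq_mul_div, le_div_iff₀ hc₁]
    linarith

/-- A continuously differentiable map on an open set can be cut off to a compactly supported
continuously differentiable map without changing it on a given compact set. -/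
theorem exists_cutoff {E F : Type*} [NormedAddCommGroup E] [NormedSpace ℝ E]
    [FiniteDimensional ℝ E] [NormedAddCommGroup F] [NormedSpace ℝ F] {f : E → F} {K U : Set E}
    (hK : IsCompact K) (hU : IsOpen U) (hKU : K ⊆ U) (hf : ContDiffOn ℝ 1 f U) :
    ∃ χ : E → ℝ, (∀ x ∈ K, χ x = 1) ∧ (∀ x, χ x ≠ 0 → x ∈ U) ∧
      ContDiff ℝ 1 (fun x => χ x • f x) ∧ HasCompactSupport (fun x => χ x • f x) := by
  obtain ⟨K', hK', hKK', hK'U⟩ := exists_compact_between hK hU hKU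
  obtain ⟨χ, h0, h1, -⟩ := exists_contMDiffMap_zero_one_of_isClosed (n := 1)
    (modelWithCornersSelf ℝ E) (s := (interior K')ᶜ) (t := K) isOpen_interior.isClosed_compl
    hK.isClosed (disjoint_compl_left_iff_subset.mpr hKK')
  have hχ : ContDiff ℝ 1 χ := χ.contMDiff.contDiff
  have hsupp : ∀ x, x ∉ K' → χ x = 0 := fun x hx => h0 (fun h => hx (interior_subset h))
  refine ⟨χ, fun x hx => h1 hx, fun x hx => ?_, ?_, ?_⟩
  · by_contra hxU
    exact hx (hsupp x fun h => hxU (hK'U h))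
  · rw [contDiff_iff_contDiffAt]
    intro x
    by_cases hx : x ∈ U
    · exact hχ.contDiffAt.smul (hf.contDiffAt (hU.mem_nhds hx))
    -- Nothing is known about `f` outside `U`, but such a point has a neighbourhood outside `K'`,
    -- where the cutoff vanishes.
    · have hx' : x ∈ K'ᶜ := fun h => hx (hK'U h)
      refine (contDiffAt_const (c := (0 : F))).congr_of_eventuallyEq ?_
      filter_upwards [hK'.isClosed.isOpen_compl.mem_nhds hx'] with y hy
      rw [hsupp y hy, zero_smul]
  · exact HasCompactSupport.intro hK' fun x hx => by rw [hsupp x hx, zero_smul]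

open scoped NNReal in
/-- Global existence for a bounded Lipschitz vector field. -/
theorem exists_global_solution {E : Type*} [NormedAddCommGroup E] [NormedSpace ℝ E]
    [CompleteSpace E] {f : ℝ → E → E} {K L : ℝ≥0} (hlip : ∀ t, LipschitzWith K (f t))
    (hcont : ∀ x, Continuous fun t => f t x) (hb : ∀ t x, ‖f t x‖ ≤ L) (t₀ : ℝ) (x₀ : E) :
    ∃ α : ℝ → E, α t₀ = x₀ ∧ ∀ t ∈ Ici t₀, HasDerivWithinAt α (f t (α t)) (Ici t₀) t := by
  have hloc : ∀ N : ℕ, ∃ α : ℝ → E, α t₀ = x₀ ∧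
      ∀ t ∈ Icc t₀ (t₀ + N), HasDerivWithinAt α (f t (α t)) (Icc t₀ (t₀ + N)) t := fun N => by
    have hN : t₀ ∈ Icc t₀ (t₀ + N) := ⟨le_rfl, by simp⟩
    -- A field bounded by `L` moves a point by at most `L * N` in time `N`. With this radius
    -- Picard–Lindelöf applies on the whole interval at once.
    have hP : IsPicardLindelof f (⟨t₀, hN⟩ : Icc t₀ (t₀ + N)) x₀ (L * N) 0 L K :=
      { lipschitzOnWith := fun t _ => (hlip t).lipschitzOnWith
        continuousOn := fun x _ => (hcont x).continuousOn
        norm_le := fun t _ x _ => hb t x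
        mul_max_le := by simp }
    exact hP.exists_eq_forall_mem_Icc_hasDerivWithinAt₀
  choose α h0 hα using hloc
  have hagree : ∀ N M : ℕ, N ≤ M → EqOn (α N) (α M) (Icc t₀ (t₀ + N)) := fun N M hNM => by
    have hsub : Icc t₀ (t₀ + N) ⊆ Icc t₀ (t₀ + M) :=
      Icc_subset_Icc le_rfl (by gcongr)
    have hright : ∀ k : ℕ, ∀ t ∈ Ico t₀ (t₀ + k), ∀ g : ℝ → E, ∀ g' : E,
        HasDerivWithinAt g g' (Icc t₀ (t₀ + k)) t → HasDerivWithinAt g g' (Ici t) t :=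
      fun k t ht g g' h => h.mono_of_mem_nhdsWithin (Icc_mem_nhdsGE_of_mem ht)
    refine ODE_solution_unique hlip (fun t ht => (hα N t ht).continuousWithinAt)
      (fun t ht => hright N t ht _ _ (hα N t (Ico_subset_Icc_self ht)))
      (fun t ht => ((hα M t (hsub ht)).mono hsub).continuousWithinAt)
      (fun t ht => hright N t ht _ _ ((hα M t (hsub (Ico_subset_Icc_self ht))).mono hsub))
      ((h0 N).trans (h0 M).symm)
  -- The solutions agree on overlaps by uniqueness. The `+ 1` puts `t` strictly before the end of
  -- its interval, so that the glued function coincides with a single solution near `t`.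
  let k : ℝ → ℕ := fun t => ⌈t - t₀⌉₊ + 1
  have hk : ∀ t, t < t₀ + k t := fun t => by
    have := Nat.le_ceil (t - t₀)
    simp only [k]; push_cast; linarith
  have heq : ∀ (N : ℕ), ∀ t ∈ Ico t₀ (t₀ + N), α (k t) t = α N t := fun N t ht => by
    rcases le_total (k t) N with h | h
    · exact hagree _ _ h ⟨ht.1, (hk t).le⟩
    · exact (hagree _ _ h ⟨ht.1, ht.2.le⟩).symm
  refine ⟨fun t => α (k t) t, h0 _, fun t ht => ?_⟩
  have hmem : Ico t₀ (t₀ + k t) ∈ 𝓝[Ici t₀] t := by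
    rw [← Ici_inter_Iio]
    exact inter_mem_nhdsWithin _ (Iio_mem_nhds (hk t))
  have hd := ((hα (k t) t ⟨ht, (hk t).le⟩).mono Ico_subset_Icc_self).mono_of_mem_nhdsWithin hmem
  refine hd.congr_of_eventuallyEq ?_ rfl
  filter_upwards [hmem] with s hs using heq _ s hs

end DifferentialEquations

/-! ## Calculus of vectors and matrices in coordinates -/

attribute [local instance] Matrix.normedAddCommGroup Matrix.normedSpace

/-! ### Smoothness of the vector and matrix operations. -/

section Smooth

variable {E : Type*} [NormedAddCommGroup E] [NormedSpace ℝ E] {k : WithTop ℕ∞} {x : E}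

theorem contDiffAt_mat {f : E → Mat3} :
    ContDiffAt ℝ k f x ↔ ∀ a b, ContDiffAt ℝ k (fun y => f y a b) x := by
  have h1 := contDiffAt_pi (𝕜 := ℝ) (E := E) (Φ := f) (F' := fun _ : Fin 3 => Fin 3 → ℝ)
    (n := k) (x := x)
  exact h1.trans (forall_congr' fun a => contDiffAt_pi)

@[fun_prop]
-- Link variables form a dependent family, since each cable has its own number of links; their
-- coordinate projections are registered for `fun_prop`.
theorem contDiff_apply_dep {ι : Type*} [Fintype ι] {F : ι → Type*} [∀ i, NormedAddCommGroup (F i)]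
    [∀ i, NormedSpace ℝ (F i)] (i : ι) : ContDiff ℝ k (fun f : ∀ i, F i => f i) :=
  contDiff_pi.mp contDiff_id i

@[fun_prop]
theorem contDiffAt_apply_dep {ι : Type*} [Fintype ι] {F : ι → Type*}
    [∀ i, NormedAddCommGroup (F i)] [∀ i, NormedSpace ℝ (F i)] (i : ι) (f₀ : ∀ i, F i) :
    ContDiffAt ℝ k (fun f : ∀ i, F i => f i) f₀ :=
  (contDiff_apply_dep i).contDiffAt

@[fun_prop]
theorem ContDiffAt.cross {f g : E → V3} (hf : ContDiffAt ℝ k f x) (hg : ContDiffAt ℝ k g x) :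
    ContDiffAt ℝ k (fun y => f y ⨯₃ g y) x := by
  rw [contDiffAt_pi]
  intro i
  fin_cases i <;> simp [cross_apply] <;> fun_prop

@[fun_prop]
theorem ContDiff.cross {f g : E → V3} (hf : ContDiff ℝ k f) (hg : ContDiff ℝ k g) :
    ContDiff ℝ k (fun y => f y ⨯₃ g y) :=
  contDiff_iff_contDiffAt.mpr fun _ => ContDiffAt.cross hf.contDiffAt hg.contDiffAt

@[fun_prop]
theorem ContDiffAt.mulVec {f : E → Mat3} {g : E → V3} (hf : ContDiffAt ℝ k f x)
    (hg : ContDiffAt ℝ k g x) : ContDiffAt ℝ k (fun y => f y *ᵥ g y) x := by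
  have hf' := contDiffAt_mat.mp hf
  rw [contDiffAt_pi]
  intro i
  simp only [Matrix.mulVec, dotProduct]
  fun_prop

@[fun_prop]
theorem ContDiff.mulVec {f : E → Mat3} {g : E → V3} (hf : ContDiff ℝ k f) (hg : ContDiff ℝ k g) :
    ContDiff ℝ k (fun y => f y *ᵥ g y) :=
  contDiff_iff_contDiffAt.mpr fun _ => ContDiffAt.mulVec hf.contDiffAt hg.contDiffAt

@[fun_prop]
theorem ContDiffAt.dotV3 {f g : E → V3} (hf : ContDiffAt ℝ k f x) (hg : ContDiffAt ℝ k g x) :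
    ContDiffAt ℝ k (fun y => f y ⬝ᵥ g y) x := by
  simp only [dotProduct]
  fun_prop

@[fun_prop]
theorem ContDiff.dotV3 {f g : E → V3} (hf : ContDiff ℝ k f) (hg : ContDiff ℝ k g) :
    ContDiff ℝ k (fun y => f y ⬝ᵥ g y) :=
  contDiff_iff_contDiffAt.mpr fun _ => ContDiffAt.dotV3 hf.contDiffAt hg.contDiffAt

@[fun_prop]
theorem ContDiffAt.matMul {f g : E → Mat3} (hf : ContDiffAt ℝ k f x) (hg : ContDiffAt ℝ k g x) :
    ContDiffAt ℝ k (fun y => f y * g y) x := by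
  have hf' := contDiffAt_mat.mp hf
  have hg' := contDiffAt_mat.mp hg
  rw [contDiffAt_mat]
  intro a b
  simp only [Matrix.mul_apply]
  fun_prop

@[fun_prop]
theorem ContDiff.matMul {f g : E → Mat3} (hf : ContDiff ℝ k f) (hg : ContDiff ℝ k g) :
    ContDiff ℝ k (fun y => f y * g y) :=
  contDiff_iff_contDiffAt.mpr fun _ => ContDiffAt.matMul hf.contDiffAt hg.contDiffAt

@[fun_prop]
theorem ContDiffAt.matTranspose {f : E → Mat3} (hf : ContDiffAt ℝ k f x) :
    ContDiffAt ℝ k (fun y => (f y)ᵀ) x :=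
  contDiffAt_mat.mpr fun a b => contDiffAt_mat.mp hf b a

@[fun_prop]
theorem ContDiff.matTranspose {f : E → Mat3} (hf : ContDiff ℝ k f) :
    ContDiff ℝ k (fun y => (f y)ᵀ) :=
  contDiff_iff_contDiffAt.mpr fun _ => ContDiffAt.matTranspose hf.contDiffAt

@[fun_prop]
theorem ContDiffAt.vee {f : E → Mat3} (hf : ContDiffAt ℝ k f x) :
    ContDiffAt ℝ k (fun y => vee (f y)) x := by
  have hf' := contDiffAt_mat.mp hf
  rw [contDiffAt_pi]
  intro i
  fin_cases i <;> simp [QuadPayload.vee] <;> fun_prop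

@[fun_prop]
theorem ContDiff.vee {f : E → Mat3} (hf : ContDiff ℝ k f) :
    ContDiff ℝ k (fun y => vee (f y)) :=
  contDiff_iff_contDiffAt.mpr fun _ => ContDiffAt.vee hf.contDiffAt

@[fun_prop]
theorem ContDiffAt.hat {f : E → V3} (hf : ContDiffAt ℝ k f x) :
    ContDiffAt ℝ k (fun y => hat (f y)) x := by
  rw [contDiffAt_mat]
  intro a b
  fin_cases a <;> fin_cases b <;> simp [QuadPayload.hat] <;> fun_prop

@[fun_prop]
theorem ContDiff.hat {f : E → V3} (hf : ContDiff ℝ k f) :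
    ContDiff ℝ k (fun y => hat (f y)) :=
  contDiff_iff_contDiffAt.mpr fun _ => ContDiffAt.hat hf.contDiffAt

@[fun_prop]
theorem ContDiff.attErr {f g : E → Mat3} (hf : ContDiff ℝ k f) (hg : ContDiff ℝ k g) :
    ContDiff ℝ k (fun y => attErr (f y) (g y)) := by
  unfold QuadPayload.attErr
  fun_prop

end Smooth

/-! ### Product rules along curves of vectors and matrices. -/

section Derivative

variable {I : Set ℝ} {t : ℝ}

theorem hasDerivWithinAt_mat {f : ℝ → Mat3} {f' : Mat3} :
    HasDerivWithinAt f f' I t ↔ ∀ a b, HasDerivWithinAt (fun τ => f τ a b) (f' a b) I t := by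
  have h1 := hasDerivWithinAt_pi (φ := f) (φ' := f') (E' := fun _ : Fin 3 => Fin 3 → ℝ)
    (s := I) (x := t) (𝕜 := ℝ)
  exact h1.trans (forall_congr' fun a => hasDerivWithinAt_pi)

theorem HasDerivWithinAt.dotV3 {f g : ℝ → V3} {f' g' : V3} (hf : HasDerivWithinAt f f' I t)
    (hg : HasDerivWithinAt g g' I t) :
    HasDerivWithinAt (fun τ => f τ ⬝ᵥ g τ) (f' ⬝ᵥ g t + f t ⬝ᵥ g') I t := by
  have hf := hasDerivWithinAt_pi.mp hf
  have hg := hasDerivWithinAt_pi.mp hg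
  have h := HasDerivWithinAt.fun_sum (u := Finset.univ) fun i _ => (hf i).mul (hg i)
  exact h.congr_deriv (by simp [dotProduct, Finset.sum_add_distrib])

theorem HasDerivWithinAt.mulVec {f : ℝ → Mat3} {g : ℝ → V3} {f' : Mat3} {g' : V3}
    (hf : HasDerivWithinAt f f' I t) (hg : HasDerivWithinAt g g' I t) :
    HasDerivWithinAt (fun τ => f τ *ᵥ g τ) (f' *ᵥ g t + f t *ᵥ g') I t := by
  have hf := hasDerivWithinAt_mat.mp hf
  rw [hasDerivWithinAt_pi]
  exact fun i => HasDerivWithinAt.dotV3 (hasDerivWithinAt_pi.mpr (hf i)) hg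

theorem HasDerivWithinAt.matTranspose {f : ℝ → Mat3} {f' : Mat3}
    (hf : HasDerivWithinAt f f' I t) : HasDerivWithinAt (fun τ => (f τ)ᵀ) f'ᵀ I t :=
  hasDerivWithinAt_mat.mpr fun a b => hasDerivWithinAt_mat.mp hf b a

theorem HasDerivWithinAt.matMul {f g : ℝ → Mat3} {f' g' : Mat3}
    (hf : HasDerivWithinAt f f' I t) (hg : HasDerivWithinAt g g' I t) :
    HasDerivWithinAt (fun τ => f τ * g τ) (f' * g t + f t * g') I t := by
  have hf := hasDerivWithinAt_mat.mp hf
  have hg := hasDerivWithinAt_mat.mp hg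
  rw [hasDerivWithinAt_mat]
  exact fun a b => HasDerivWithinAt.dotV3 (hasDerivWithinAt_pi.mpr (hf a))
    (hasDerivWithinAt_pi.mpr fun c => hg c b)

/-- `attErr 1` is linear in its second argument, so it commutes with differentiation. -/
theorem HasDerivWithinAt.attErr_one {f : ℝ → Mat3} {f' : Mat3} (hf : HasDerivWithinAt f f' I t) :
    HasDerivWithinAt (fun τ => attErr 1 (f τ)) (attErr 1 f') I t := by
  have hf := hasDerivWithinAt_mat.mp hf
  rw [hasDerivWithinAt_pi]
  intro i
  fin_cases i
  · exact (((hf 2 1).fun_sub (hf 1 2)).const_mul (1 / 2)).congr (fun τ _ => by simp [attErr, vee])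
      (by simp [attErr, vee]) |>.congr_deriv (by simp [attErr, vee])
  · exact (((hf 0 2).fun_sub (hf 2 0)).const_mul (1 / 2)).congr (fun τ _ => by simp [attErr, vee])
      (by simp [attErr, vee]) |>.congr_deriv (by simp [attErr, vee])
  · exact (((hf 1 0).fun_sub (hf 0 1)).const_mul (1 / 2)).congr (fun τ _ => by simp [attErr, vee])
      (by simp [attErr, vee]) |>.congr_deriv (by simp [attErr, vee])

theorem HasDerivWithinAt.attPsi_one {f : ℝ → Mat3} {f' : Mat3} (hf : HasDerivWithinAt f f' I t) :
    HasDerivWithinAt (fun τ => attPsi 1 (f τ)) (-(1 / 2) * f'.trace) I t := by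
  have hf := hasDerivWithinAt_mat.mp hf
  have h := ((((hf 0 0).fun_add (hf 1 1)).fun_add (hf 2 2)).const_sub 3).const_mul (1 / 2)
  have e : ∀ A : Mat3, attPsi 1 A = 1 / 2 * (3 - (A 0 0 + A 1 1 + A 2 2)) := fun A => by
    simp [attPsi, Matrix.trace, Fin.sum_univ_three]
  refine (h.congr (fun τ _ => e _) (e _)).congr_deriv ?_
  simp [Matrix.trace, Fin.sum_univ_three]
  ring

end Derivative

/-! ### Operation bounds in the sup norm, where the dimension enters through factors 2 and 3. -/

section Bounds

theorem norm_cross_le (a b : V3) : ‖a ⨯₃ b‖ ≤ 2 * ‖a‖ * ‖b‖ := by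
  rw [pi_norm_le_iff_of_nonneg (by positivity)]
  have h : ∀ i j k l : Fin 3, ‖a i * b j - a k * b l‖ ≤ 2 * ‖a‖ * ‖b‖ := fun i j k l => by
    refine (norm_sub_le _ _).trans ?_
    rw [norm_mul, norm_mul]
    have := mul_le_mul (norm_le_pi_norm a i) (norm_le_pi_norm b j) (norm_nonneg _) (norm_nonneg _)
    have := mul_le_mul (norm_le_pi_norm a k) (norm_le_pi_norm b l) (norm_nonneg _) (norm_nonneg _)
    linarith
  intro i
  fin_cases i <;> simpa [cross_apply] using h _ _ _ _

theorem abs_dotProduct_le (a b : V3) : |a ⬝ᵥ b| ≤ 3 * ‖a‖ * ‖b‖ := by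
  rw [dotProduct]
  refine (Finset.abs_sum_le_sum_abs _ _).trans ?_
  have h : ∀ i ∈ Finset.univ, |a i * b i| ≤ ‖a‖ * ‖b‖ := fun i _ => by
    rw [abs_mul]
    exact mul_le_mul (norm_le_pi_norm a i) (norm_le_pi_norm b i) (abs_nonneg _) (norm_nonneg _)
  refine (Finset.sum_le_sum h).trans ?_
  simp [mul_assoc]

theorem norm_sq_le_dotProduct (a : V3) : ‖a‖ ^ 2 ≤ a ⬝ᵥ a := by
  have h : ‖a‖ ≤ √(a ⬝ᵥ a) := by
    rw [pi_norm_le_iff_of_nonneg (Real.sqrt_nonneg _)]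
    intro i
    apply Real.abs_le_sqrt
    rw [dotProduct, sq]
    exact Finset.single_le_sum (f := fun i => a i * a i) (fun j _ => mul_self_nonneg _)
      (Finset.mem_univ i)
  have h0 : 0 ≤ a ⬝ᵥ a := Finset.sum_nonneg fun j _ => mul_self_nonneg _
  calc ‖a‖ ^ 2 ≤ √(a ⬝ᵥ a) ^ 2 := pow_le_pow_left₀ (norm_nonneg _) h 2
    _ = _ := Real.sq_sqrt h0

theorem dotProduct_self_le (a : V3) : a ⬝ᵥ a ≤ 3 * ‖a‖ ^ 2 := by
  have := (le_abs_self _).trans (abs_dotProduct_le a a)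
  linarith [sq ‖a‖]

theorem norm_mulVec_le (A : Mat3) (v : V3) : ‖A *ᵥ v‖ ≤ 3 * ‖A‖ * ‖v‖ := by
  rw [pi_norm_le_iff_of_nonneg (by positivity)]
  intro i
  refine (abs_dotProduct_le _ _).trans ?_
  have : ‖A i‖ ≤ ‖A‖ := norm_le_pi_norm (show Fin 3 → Fin 3 → ℝ from A) i
  gcongr

theorem norm_mat_le {A : Mat3} {c : ℝ} (hc : 0 ≤ c) : ‖A‖ ≤ c ↔ ∀ a b, |A a b| ≤ c :=
  Matrix.norm_le_iff hc

theorem norm_attErr_one_le (A : Mat3) : ‖attErr 1 A‖ ≤ ‖A‖ := by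
  have h : ∀ a b, |A a b| ≤ ‖A‖ := (norm_mat_le (norm_nonneg _)).mp le_rfl
  have h' : ∀ a b c d, ‖1 / 2 * (A a b - A c d)‖ ≤ ‖A‖ := fun a b c d => by
    rw [norm_mul, Real.norm_eq_abs, Real.norm_eq_abs, abs_of_pos (by norm_num : (0 : ℝ) < 1 / 2)]
    linarith [abs_sub (A a b) (A c d), h a b, h c d]
  rw [pi_norm_le_iff_of_nonneg (norm_nonneg _)]
  intro i
  fin_cases i <;> simpa [attErr, vee] using h' _ _ _ _

theorem norm_matMul_le (A B : Mat3) : ‖A * B‖ ≤ 3 * ‖A‖ * ‖B‖ := by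
  rw [norm_mat_le (by positivity)]
  intro a b
  have h : |A a ⬝ᵥ (fun c => B c b)| ≤ _ := abs_dotProduct_le _ _
  refine h.trans ?_
  have h1 : ‖A a‖ ≤ ‖A‖ := norm_le_pi_norm (show Fin 3 → Fin 3 → ℝ from A) a
  have h2 : ‖fun c => B c b‖ ≤ ‖B‖ := by
    rw [pi_norm_le_iff_of_nonneg (norm_nonneg _)]
    exact fun c => (norm_mat_le (norm_nonneg _)).mp le_rfl c b
  gcongr

theorem norm_hat_le (v : V3) : ‖hat v‖ ≤ ‖v‖ := by
  rw [norm_mat_le (norm_nonneg _)]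
  have := norm_le_pi_norm v
  simp only [Real.norm_eq_abs] at this
  intro a b
  fin_cases a <;> fin_cases b <;> simp [hat, this]

theorem sq_vnorm (v : V3) : vnorm v ^ 2 = v ⬝ᵥ v :=
  Real.sq_sqrt (Finset.sum_nonneg fun _ _ => mul_self_nonneg _)

theorem norm_le_vnorm (v : V3) : ‖v‖ ≤ vnorm v :=
  Real.le_sqrt_of_sq_le (norm_sq_le_dotProduct v)

end Bounds

/-! ### Algebra of `SO(3)` and comparison of its attitude errors. -/

section Rotations

/-- Along `Q̇ = Q ê` this gives `Ψ̇ = e_R · e`, which the term `-kR e_R` of the moment cancels in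
the energy balance. -/
theorem trace_mul_hat (A : Mat3) (e : V3) :
    -(1 / 2) * (A * hat e).trace = attErr 1 A ⬝ᵥ e := by
  simp [Matrix.trace, Matrix.mul_apply, Fin.sum_univ_three, hat, attErr, vee, dotProduct]
  ring

variable {Q : Mat3}

theorem SO3.mul_transpose (hQ : Q ∈ SO3) : Q * Qᵀ = 1 :=
  Matrix.mem_orthogonalGroup_iff (Fin 3) ℝ |>.mp (Matrix.mem_specialOrthogonalGroup_iff.mp hQ).1

theorem SO3.transpose_mul (hQ : Q ∈ SO3) : Qᵀ * Q = 1 :=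
  Matrix.mem_orthogonalGroup_iff' (Fin 3) ℝ |>.mp (Matrix.mem_specialOrthogonalGroup_iff.mp hQ).1

theorem SO3.det_eq (hQ : Q ∈ SO3) : Q.det = 1 := (Matrix.mem_specialOrthogonalGroup_iff.mp hQ).2

theorem SO3.mk (h : Q * Qᵀ = 1) (hd : Q.det = 1) : Q ∈ SO3 :=
  Matrix.mem_specialOrthogonalGroup_iff.mpr ⟨(Matrix.mem_orthogonalGroup_iff (Fin 3) ℝ).mpr h, hd⟩

theorem SO3.mul_mem {P : Mat3} (hP : P ∈ SO3) (hQ : Q ∈ SO3) : P * Q ∈ SO3 :=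
  Submonoid.mul_mem (Matrix.specialOrthogonalGroup (Fin 3) ℝ) hP hQ

theorem SO3.transpose_mem (hQ : Q ∈ SO3) : Qᵀ ∈ SO3 :=
  SO3.mk (by simpa using SO3.transpose_mul hQ) (by simpa using SO3.det_eq hQ)

/-- Each entry of a rotation equals its cofactor. These quadratic relations carry the polynomial
identities `SO3.attErr_sq` and `SO3.mulVec_cross`. -/
theorem SO3.adjugate_eq (hQ : Q ∈ SO3) : Q.adjugate = Qᵀ := by
  have h := Matrix.mul_adjugate Q
  rw [SO3.det_eq hQ, one_smul] at h
  calc Q.adjugate = Qᵀ * Q * Q.adjugate := by rw [SO3.transpose_mul hQ, one_mul]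
    _ = Qᵀ := by rw [mul_assoc, h, mul_one]

theorem SO3.abs_apply_le (hQ : Q ∈ SO3) (a b : Fin 3) : |Q a b| ≤ 1 := by
  have h := congrFun (congrFun (SO3.mul_transpose hQ) a) a
  simp only [Matrix.mul_apply, Matrix.transpose_apply, Matrix.one_apply_eq] at h
  have h1 : Q a b * Q a b ≤ 1 := by
    rw [← h]
    exact Finset.single_le_sum (f := fun c => Q a c * Q a c) (fun j _ => mul_self_nonneg _)
      (Finset.mem_univ b)
  exact abs_le_one_iff_mul_self_le_one.mpr h1

theorem SO3.norm_le (hQ : Q ∈ SO3) : ‖Q‖ ≤ 1 :=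
  (norm_mat_le zero_le_one).mpr (SO3.abs_apply_le hQ)

/-- For rotation angle `θ` one has `Ψ = 1 - cos θ` and `|e_R| = |sin θ|`, so this is `sin² θ = (1 -
cos θ)(1 + cos θ)`. -/
theorem SO3.attErr_sq (hQ : Q ∈ SO3) :
    attErr 1 Q ⬝ᵥ attErr 1 Q = attPsi 1 Q * (2 - attPsi 1 Q) := by
  have hadj := SO3.adjugate_eq hQ
  rw [Matrix.adjugate_fin_three] at hadj
  have h0 := congrFun (congrFun hadj 0) 0
  have h1 := congrFun (congrFun hadj 1) 1
  have h2 := congrFun (congrFun hadj 2) 2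
  have hs := congrArg Matrix.trace (SO3.mul_transpose hQ)
  simp [Matrix.trace, Matrix.mul_apply, Fin.sum_univ_three] at h0 h1 h2 hs
  simp [attErr, attPsi, vee, dotProduct, Matrix.trace, Fin.sum_univ_three]
  linear_combination (1 / 4) * hs + (1 / 2) * h0 + (1 / 2) * h1 + (1 / 2) * h2

/-- The squared Frobenius distance expands to `tr (Q Qᵀ) - 2 tr Q + 3 = 6 - 2 tr Q`. -/
theorem SO3.sum_sq_sub_one (hQ : Q ∈ SO3) :
    ∑ a, ∑ b, (Q - 1) a b ^ 2 = 4 * attPsi 1 Q := by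
  have hs := congrArg Matrix.trace (SO3.mul_transpose hQ)
  simp [Matrix.trace, Matrix.mul_apply, Fin.sum_univ_three] at hs
  simp [attPsi, Matrix.trace, Fin.sum_univ_three]
  linear_combination hs

theorem SO3.attPsi_nonneg (hQ : Q ∈ SO3) : 0 ≤ attPsi 1 Q := by
  have h : 0 ≤ ∑ a, ∑ b, (Q - 1) a b ^ 2 :=
    Finset.sum_nonneg fun a _ => Finset.sum_nonneg fun b _ => sq_nonneg _
  rw [SO3.sum_sq_sub_one hQ] at h
  linarith

theorem SO3.norm_sub_one_sq_le (hQ : Q ∈ SO3) : ‖Q - 1‖ ^ 2 ≤ 4 * attPsi 1 Q := by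
  have h : ‖Q - 1‖ ≤ √(4 * attPsi 1 Q) := by
    rw [norm_mat_le (Real.sqrt_nonneg _)]
    intro a b
    apply Real.abs_le_sqrt
    rw [← SO3.sum_sq_sub_one hQ]
    exact (Finset.single_le_sum (f := fun b => (Q - 1) a b ^ 2) (fun j _ => sq_nonneg _)
      (Finset.mem_univ b)).trans (Finset.single_le_sum (f := fun a => ∑ b, (Q - 1) a b ^ 2)
      (fun j _ => Finset.sum_nonneg fun b _ => sq_nonneg _) (Finset.mem_univ a))
  calc ‖Q - 1‖ ^ 2 ≤ √(4 * attPsi 1 Q) ^ 2 := pow_le_pow_left₀ (norm_nonneg _) h 2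
    _ = _ := Real.sq_sqrt (by have := SO3.attPsi_nonneg hQ; linarith)

theorem SO3.attPsi_le (hQ : Q ∈ SO3) : attPsi 1 Q ≤ 9 / 4 * ‖Q - 1‖ ^ 2 := by
  have h1 : ∑ a, ∑ b, (Q - 1) a b ^ 2 ≤ ∑ a : Fin 3, ∑ b : Fin 3, ‖Q - 1‖ ^ 2 :=
    Finset.sum_le_sum fun a _ => Finset.sum_le_sum fun b _ => by
      rw [← sq_abs]
      exact pow_le_pow_left₀ (abs_nonneg _) ((norm_mat_le (norm_nonneg _)).mp le_rfl a b) 2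
  rw [SO3.sum_sq_sub_one hQ] at h1
  simp at h1
  linarith

theorem attErr_one_one : attErr 1 (1 : Mat3) = 0 := by
  ext i; fin_cases i <;> simp [attErr, vee]

theorem attErr_one_sub (A B : Mat3) : attErr 1 (A - B) = attErr 1 A - attErr 1 B := by
  ext i; fin_cases i <;> simp [attErr, vee] <;> ring

theorem norm_attErr_one_le_sub_one (A : Mat3) : ‖attErr 1 A‖ ≤ ‖A - 1‖ := by
  have := norm_attErr_one_le (A - 1)
  rwa [attErr_one_sub, attErr_one_one, sub_zero] at this

/-- On the domain `Ψ < 1` the attitude error vector controls the attitude error. -/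
theorem SO3.norm_sub_one_sq_le_attErr (hQ : Q ∈ SO3) (hΨ : attPsi 1 Q < 1) :
    ‖Q - 1‖ ^ 2 ≤ 12 * ‖attErr 1 Q‖ ^ 2 := by
  -- The factor 12 is `4 · 3`: `‖Q - 1‖² ≤ 4Ψ`, then `Ψ ≤ Ψ (2 - Ψ) = |e_R|²` because `Ψ < 1`, and
  -- `|e_R|² ≤ 3 ‖e_R‖²` between Euclidean and sup norm.
  have h1 := SO3.norm_sub_one_sq_le hQ
  have h2 := SO3.attErr_sq hQ
  have h3 := dotProduct_self_le (attErr 1 Q)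
  have h4 := SO3.attPsi_nonneg hQ
  nlinarith

theorem attErr_eq (P R : Mat3) : attErr P R = attErr 1 (Pᵀ * R) := by
  simp [attErr, Matrix.transpose_mul]

theorem attPsi_eq (P R : Mat3) : attPsi P R = attPsi 1 (Pᵀ * R) := by
  simp [attPsi]

/-- Rotations commute with the cross product. -/
theorem SO3.mulVec_cross (hQ : Q ∈ SO3) (a b : V3) : Q *ᵥ (a ⨯₃ b) = (Q *ᵥ a) ⨯₃ (Q *ᵥ b) := by
  have hadj := SO3.adjugate_eq hQ
  rw [Matrix.adjugate_fin_three] at hadj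
  have h := fun i j => congrFun (congrFun hadj j) i
  ext i
  fin_cases i
  · have h0 := h 0 0
    have h1 := h 0 1
    have h2 := h 0 2
    simp at h0 h1 h2
    simp [Matrix.mulVec, dotProduct, Fin.sum_univ_three, cross_apply]
    rw [← h0, ← h1, ← h2]
    ring
  · have h0 := h 1 0
    have h1 := h 1 1
    have h2 := h 1 2
    simp at h0 h1 h2
    simp [Matrix.mulVec, dotProduct, Fin.sum_univ_three, cross_apply]
    rw [← h0, ← h1, ← h2]
    ring
  · have h0 := h 2 0
    have h1 := h 2 1
    have h2 := h 2 2
    simp at h0 h1 h2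
    simp [Matrix.mulVec, dotProduct, Fin.sum_univ_three, cross_apply]
    rw [← h0, ← h1, ← h2]
    ring

theorem SO3.hat_mulVec_mul (hQ : Q ∈ SO3) (w : V3) : hat (Q *ᵥ w) * Q = Q * hat w := by
  apply Matrix.ext_of_mulVec_single
  intro i
  rw [← Matrix.mulVec_mulVec, ← Matrix.mulVec_mulVec, hat_mulVec, hat_mulVec, SO3.mulVec_cross hQ]

end Rotations

/-! ## The attitude subsystem -/

/-- `J ė_Ω` along the controlled attitude dynamics, where `w = Rᵀ R_c Ω_c`. -/
def attRhs (kR kΩ : ℝ) (J Q : Mat3) (w e : V3) : V3 :=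
  -kR • attErr 1 Q - kΩ • e - e ⨯₃ (J *ᵥ (e + w)) - w ⨯₃ (J *ᵥ e) + J *ᵥ (e ⨯₃ w)

/-- Lyapunov function of the attitude subsystem with a cross term of weight `ε`. -/
def attLyap (kR ε : ℝ) (J Q : Mat3) (e : V3) : ℝ :=
  1 / 2 * (e ⬝ᵥ (J *ᵥ e)) + kR * attPsi 1 Q + ε * (attErr 1 Q ⬝ᵥ (J *ᵥ e))

/-- The derivative of `attLyap` along `Q̇ = Q ê`, `J ė = h`. -/
def attLyapDeriv (kR ε : ℝ) (J Q : Mat3) (e h : V3) : ℝ :=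
  e ⬝ᵥ h + kR * (attErr 1 Q ⬝ᵥ e) +
    ε * (attErr 1 (Q * hat e) ⬝ᵥ (J *ᵥ e) + attErr 1 Q ⬝ᵥ h)

theorem dotProduct_mulVec_comm_of_isSymm {J : Mat3} (hJ : Jᵀ = J) (a b : V3) :
    a ⬝ᵥ (J *ᵥ b) = b ⬝ᵥ (J *ᵥ a) := by
  rw [Matrix.dotProduct_mulVec, dotProduct_comm, ← Matrix.mulVec_transpose, hJ]

theorem hasDerivWithinAt_attLyap {kR ε : ℝ} {J : Mat3} (hJ : Jᵀ = J) {Q : ℝ → Mat3} {e : ℝ → V3}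
    {e' h : V3} {I : Set ℝ} {t : ℝ} (hQ : HasDerivWithinAt Q (Q t * hat (e t)) I t)
    (he : HasDerivWithinAt e e' I t) (hh : J *ᵥ e' = h) :
    HasDerivWithinAt (fun τ => attLyap kR ε J (Q τ) (e τ))
      (attLyapDeriv kR ε J (Q t) (e t) h) I t := by
  have hJe : HasDerivWithinAt (fun τ => J *ᵥ e τ) h I t := by
    have := HasDerivWithinAt.mulVec (hasDerivWithinAt_const t I J) he
    simpa [hh] using this
  have h1 := (HasDerivWithinAt.dotV3 he hJe).const_mul (1 / 2)
  have h2 := (HasDerivWithinAt.attPsi_one hQ).const_mul kR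
  have h3 := (HasDerivWithinAt.dotV3 (HasDerivWithinAt.attErr_one hQ) hJe).const_mul ε
  refine ((h1.fun_add h2).fun_add h3).congr_deriv ?_
  rw [dotProduct_mulVec_comm_of_isSymm hJ, hh, trace_mul_hat, attLyapDeriv]
  ring

/-- The gyroscopic terms do no work: `e · (e × ·) = 0`, and the two remaining terms with `w` cancel
by symmetry of `J`. The desired angular velocity therefore drops out of the energy balance. -/
theorem dot_attRhs {kR kΩ : ℝ} {J Q : Mat3} (hJ : Jᵀ = J) (w e : V3) :
    e ⬝ᵥ attRhs kR kΩ J Q w e = -kR * (attErr 1 Q ⬝ᵥ e) - kΩ * (e ⬝ᵥ e) := by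
  have h1 : e ⬝ᵥ (J *ᵥ (e ⨯₃ w)) = e ⬝ᵥ (w ⨯₃ (J *ᵥ e)) := by
    rw [dotProduct_mulVec_comm_of_isSymm hJ, dotProduct_comm, triple_product_permutation]
  simp only [attRhs, dotProduct_add, dotProduct_sub, dotProduct_smul, dot_self_cross, h1,
    smul_eq_mul, dotProduct_comm e (attErr 1 Q)]
  ring

/-- The quadratic form attains a positive minimum on the compact unit sphere; the rest is scaling.
-/
theorem Matrix.PosDef.exists_lower_bound {J : Mat3} (hJ : J.PosDef) :
    ∃ c > 0, ∀ e : V3, c * ‖e‖ ^ 2 ≤ e ⬝ᵥ (J *ᵥ e) := by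
  have hcont : Continuous fun e : V3 => e ⬝ᵥ (J *ᵥ e) :=
    (ContDiff.dotV3 (k := 0) contDiff_id (ContDiff.mulVec contDiff_const contDiff_id)).continuous
  obtain ⟨x, hx, hmin⟩ := (isCompact_sphere (0 : V3) 1).exists_isMinOn
    (NormedSpace.sphere_nonempty.mpr zero_le_one) hcont.continuousOn
  have hx0 : x ≠ 0 := fun h => by simp [h] at hx
  have hpos : 0 < x ⬝ᵥ (J *ᵥ x) := by simpa using hJ.dotProduct_mulVec_pos hx0
  refine ⟨_, hpos, fun e => ?_⟩
  by_cases he : e = 0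
  · simp [he]
  have hn : 0 < ‖e‖ := norm_pos_iff.mpr he
  have h := hmin (a := ‖e‖⁻¹ • e) (by simp [norm_smul, hn.ne'])
  simp only [Set.mem_ofPred_eq, Matrix.mulVec_smul, dotProduct_smul, smul_dotProduct,
    smul_eq_mul] at h
  calc x ⬝ᵥ (J *ᵥ x) * ‖e‖ ^ 2 ≤ ‖e‖⁻¹ * (‖e‖⁻¹ * (e ⬝ᵥ (J *ᵥ e))) * ‖e‖ ^ 2 := by gcongr
    _ = _ := by field_simp

set_option maxHeartbeats 1000000 in
/-- Exponential Lyapunov estimate of the attitude subsystem, uniform in the commanded angular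
velocity as long as it is bounded. -/
theorem exists_attLyap {kR kΩ : ℝ} (hkR : 0 < kR) (hkΩ : 0 < kΩ) {J : Mat3} (hJ : J.PosDef)
    (B : ℝ) (hB : 0 ≤ B) :
    ∃ ε > 0, ∃ c₁ > 0, ∃ c₂ > 0, ∃ β > 0, ∀ Q ∈ SO3, attPsi 1 Q < 1 → ∀ e : V3,
      c₁ * (‖e‖ ^ 2 + ‖Q - 1‖ ^ 2) ≤ attLyap kR ε J Q e ∧
      attLyap kR ε J Q e ≤ c₂ * (‖e‖ ^ 2 + ‖Q - 1‖ ^ 2) ∧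
      ∀ w : V3, ‖w‖ ≤ B → ‖e‖ ≤ 1 →
        attLyapDeriv kR ε J Q e (attRhs kR kΩ J Q w e) ≤ -β * (‖e‖ ^ 2 + ‖Q - 1‖ ^ 2) := by
  obtain ⟨j, hj, hJlow⟩ := Matrix.PosDef.exists_lower_bound hJ
  have hJs : Jᵀ = J := by simpa using hJ.isHermitian.eq
  set N := ‖J‖ with hN
  have hN0 : 0 ≤ N := norm_nonneg _
  -- `C₂` bounds `e_R · (J ė + kR e_R)` by a multiple of `‖e_R‖ ‖e‖`, `C₁` bounds `ė_R · J e` by a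
  -- multiple of `‖e‖²`, and `C₃` bounds the cross term `e_R · J e` itself.
  set C₂ : ℝ := 3 * (kΩ + 12 * N * (1 + 2 * B) + 12 * N * B) with hC₂
  have hC₂0 : 0 < C₂ := by positivity
  set C₁ : ℝ := 27 * N with hC₁
  set C₃ : ℝ := 9 * N with hC₃
  -- The first condition keeps the growth caused by the cross term below half of the damping `kΩ
  -- ‖e‖²`. The second keeps the Lyapunov function positive definite.
  obtain ⟨ε, hε, hε1, hε2⟩ : ∃ ε > 0, ε * (C₁ + C₂ ^ 2 / (2 * kR)) ≤ kΩ / 2 ∧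
      ε * C₃ ≤ min j kR / 2 := by
    have hm : 0 < min j kR := lt_min hj hkR
    refine ⟨min (kΩ / 2 / (C₁ + C₂ ^ 2 / (2 * kR))) (min j kR / 2 / (C₃ + 1)), by positivity,
      ?_, ?_⟩
    · rw [← le_div_iff₀ (by positivity)]
      exact min_le_left _ _
    · have : min (kΩ / 2 / (C₁ + C₂ ^ 2 / (2 * kR))) (min j kR / 2 / (C₃ + 1)) * (C₃ + 1) ≤
          min j kR / 2 := by
        rw [← le_div_iff₀ (by positivity)]
        exact min_le_right _ _
      refine le_trans (mul_le_mul_of_nonneg_left ?_ (by positivity)) this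
      linarith
  refine ⟨ε, hε, min (j / 4) (kR / 8), by positivity, 3 * N * 3 + kR * 9 / 4 + ε * C₃,
    by positivity, min (kΩ / 2) (ε * kR / 2 / 12), by positivity, fun Q hQ hΨ e => ?_⟩
  set r := attErr 1 Q with hr
  set Ψ := attPsi 1 Q with hΨdef
  have hΨ0 : 0 ≤ Ψ := SO3.attPsi_nonneg hQ
  have hrΨ : r ⬝ᵥ r = Ψ * (2 - Ψ) := SO3.attErr_sq hQ
  have hr2 := norm_sq_le_dotProduct r
  have hQ1 : ‖Q - 1‖ ^ 2 ≤ 4 * Ψ := SO3.norm_sub_one_sq_le hQ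
  have hQ2 : ‖Q - 1‖ ^ 2 ≤ 12 * ‖r‖ ^ 2 := SO3.norm_sub_one_sq_le_attErr hQ hΨ
  have hrQ : ‖r‖ ≤ ‖Q - 1‖ := norm_attErr_one_le_sub_one Q
  have hJe : ‖J *ᵥ e‖ ≤ 3 * N * ‖e‖ := norm_mulVec_le J e
  have hx := norm_nonneg e
  have hy := norm_nonneg r
  have hcross : |r ⬝ᵥ (J *ᵥ e)| ≤ C₃ * (‖r‖ * ‖e‖) := by
    refine (abs_dotProduct_le _ _).trans ?_
    calc 3 * ‖r‖ * ‖J *ᵥ e‖ ≤ 3 * ‖r‖ * (3 * N * ‖e‖) := by gcongr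
      _ = _ := by rw [hC₃]; ring
  have hcross' := abs_le.mp hcross
  have hxy : ‖r‖ * ‖e‖ ≤ (‖e‖ ^ 2 + ‖r‖ ^ 2) / 2 := by nlinarith [sq_nonneg (‖r‖ - ‖e‖)]
  refine ⟨?_, ?_, ?_⟩
  · have h1 := hJlow e
    have h3 : -(min j kR / 2 * ((‖e‖ ^ 2 + ‖r‖ ^ 2) / 2)) ≤ ε * (r ⬝ᵥ (J *ᵥ e)) := by
      have h4 : ε * C₃ * (‖r‖ * ‖e‖) ≤ min j kR / 2 * ((‖e‖ ^ 2 + ‖r‖ ^ 2) / 2) := by gcongr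
      nlinarith [hcross'.1]
    have h5 : min j kR * ‖e‖ ^ 2 ≤ j * ‖e‖ ^ 2 := by gcongr; exact min_le_left _ _
    have h6 : min j kR * ‖r‖ ^ 2 ≤ kR * ‖r‖ ^ 2 := by gcongr; exact min_le_right _ _
    have h7 : min (j / 4) (kR / 8) * ‖e‖ ^ 2 ≤ j / 4 * ‖e‖ ^ 2 := by gcongr; exact min_le_left _ _
    -- The potential `kR Ψ` is split in two halves: one controls `‖Q - 1‖²`, the other absorbs the
    -- `e_R` part of the cross term.
    have h8 : min (j / 4) (kR / 8) * ‖Q - 1‖ ^ 2 ≤ kR / 8 * (4 * Ψ) :=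
      mul_le_mul (min_le_right _ _) hQ1 (sq_nonneg _) (by positivity)
    have h9 : kR * ‖r‖ ^ 2 ≤ kR * (2 * Ψ) := by
      gcongr; nlinarith
    simp only [attLyap, ← hr, ← hΨdef]
    linarith
  · have h1 := (le_abs_self _).trans (abs_dotProduct_le e (J *ᵥ e))
    have h2 : 3 * ‖e‖ * ‖J *ᵥ e‖ ≤ 3 * ‖e‖ * (3 * N * ‖e‖) := by gcongr
    have h3 : kR * Ψ ≤ kR * (9 / 4 * ‖Q - 1‖ ^ 2) := by gcongr; exact SO3.attPsi_le hQ
    have h4 : ε * (r ⬝ᵥ (J *ᵥ e)) ≤ ε * (C₃ * ((‖e‖ ^ 2 + ‖Q - 1‖ ^ 2) / 2)) := by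
      have : ‖r‖ ^ 2 ≤ ‖Q - 1‖ ^ 2 := pow_le_pow_left₀ hy hrQ 2
      gcongr
      refine hcross'.2.trans ?_
      gcongr
      linarith
    simp only [attLyap, ← hr, ← hΨdef]
    have p1 : 0 ≤ N * ‖Q - 1‖ ^ 2 := by positivity
    have p2 : 0 ≤ N * ‖e‖ ^ 2 := by positivity
    have p3 : 0 ≤ kR * ‖e‖ ^ 2 := by positivity
    have p4 : 0 ≤ ε * C₃ * ‖e‖ ^ 2 := by positivity
    have p5 : 0 ≤ ε * C₃ * ‖Q - 1‖ ^ 2 := by positivity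
    have p6 : 3 * ‖e‖ * (3 * N * ‖e‖) = 9 * (N * ‖e‖ ^ 2) := by ring
    have p7 : (3 * N * 3 + kR * 9 / 4 + ε * C₃) * (‖e‖ ^ 2 + ‖Q - 1‖ ^ 2) =
      9 * (N * ‖e‖ ^ 2) + 9 * (N * ‖Q - 1‖ ^ 2) + kR * (9 / 4 * ‖Q - 1‖ ^ 2) +
        9 / 4 * (kR * ‖e‖ ^ 2) + ε * C₃ * ‖e‖ ^ 2 + ε * C₃ * ‖Q - 1‖ ^ 2 := by ring
    have p8 : ε * (C₃ * ((‖e‖ ^ 2 + ‖Q - 1‖ ^ 2) / 2)) =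
      (ε * C₃ * ‖e‖ ^ 2 + ε * C₃ * ‖Q - 1‖ ^ 2) / 2 := by ring
    rw [p7]
    linarith
  · intro w hw he
    have hdot := dot_attRhs (kR := kR) (kΩ := kΩ) (Q := Q) hJs w e
    have hA : attErr 1 (Q * hat e) ⬝ᵥ (J *ᵥ e) ≤ C₁ * ‖e‖ ^ 2 := by
      have h1 : ‖attErr 1 (Q * hat e)‖ ≤ 3 * ‖e‖ := by
        refine (norm_attErr_one_le _).trans ((norm_matMul_le _ _).trans ?_)
        have := SO3.norm_le hQ
        have := norm_hat_le e
        calc 3 * ‖Q‖ * ‖hat e‖ ≤ 3 * 1 * ‖e‖ := by gcongr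
          _ = _ := by ring
      calc _ ≤ 3 * ‖attErr 1 (Q * hat e)‖ * ‖J *ᵥ e‖ :=
            (le_abs_self _).trans (abs_dotProduct_le _ _)
        _ ≤ 3 * (3 * ‖e‖) * (3 * N * ‖e‖) := by gcongr
        _ = _ := by rw [hC₁]; ring
    have hBd : r ⬝ᵥ attRhs kR kΩ J Q w e ≤ -kR * ‖r‖ ^ 2 + C₂ * (‖r‖ * ‖e‖) := by
      -- Every term of `m` is at least linear in `e`. The bound `‖e‖ ≤ 1` makes the quadratic term
      -- `e × J e` linear too, and `w` only has to be bounded.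
      set m := kΩ • e + e ⨯₃ (J *ᵥ (e + w)) + w ⨯₃ (J *ᵥ e) - J *ᵥ (e ⨯₃ w) with hm
      have e1 : attRhs kR kΩ J Q w e = -kR • r - m := by rw [attRhs, hm, ← hr]; abel
      have n1 : ‖e ⨯₃ (J *ᵥ (e + w))‖ ≤ 2 * ‖e‖ * (3 * N * (1 + B)) := by
        refine (norm_cross_le _ _).trans ?_
        gcongr
        refine (norm_mulVec_le _ _).trans ?_
        gcongr
        exact (norm_add_le _ _).trans (add_le_add he hw)
      have n2 : ‖w ⨯₃ (J *ᵥ e)‖ ≤ 2 * B * (3 * N * ‖e‖) := by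
        refine (norm_cross_le _ _).trans ?_
        gcongr
      have n3 : ‖J *ᵥ (e ⨯₃ w)‖ ≤ 3 * N * (2 * ‖e‖ * B) := by
        refine (norm_mulVec_le _ _).trans ?_
        gcongr
        refine (norm_cross_le _ _).trans ?_
        gcongr
      have n0 : ‖kΩ • e‖ = kΩ * ‖e‖ := by rw [norm_smul, Real.norm_of_nonneg hkΩ.le]
      have hmn : 3 * ‖m‖ ≤ C₂ * ‖e‖ := by
        have := norm_sub_le (kΩ • e + e ⨯₃ (J *ᵥ (e + w)) + w ⨯₃ (J *ᵥ e)) (J *ᵥ (e ⨯₃ w))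
        have := norm_add₃_le (a := kΩ • e) (b := e ⨯₃ (J *ᵥ (e + w))) (c := w ⨯₃ (J *ᵥ e))
        rw [← hm] at *
        have p2 : 0 ≤ N * ‖e‖ := by positivity
        have p3 : 0 ≤ N * ‖e‖ * B := by positivity
        rw [hC₂, n0] at *
        linarith
      have h2 : -(r ⬝ᵥ m) ≤ 3 * ‖r‖ * ‖m‖ := (neg_le_abs _).trans (abs_dotProduct_le _ _)
      have h3 : ‖r‖ * (3 * ‖m‖) ≤ ‖r‖ * (C₂ * ‖e‖) := by gcongr
      have h4 : kR * ‖r‖ ^ 2 ≤ kR * (r ⬝ᵥ r) := by gcongr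
      rw [e1, dotProduct_sub, dotProduct_smul, smul_eq_mul]
      linarith
    -- Young's inequality, spending half of the gain `-kR ‖e_R‖²`.
    have hcomb : C₂ * (‖r‖ * ‖e‖) ≤ kR / 2 * ‖r‖ ^ 2 + C₂ ^ 2 / (2 * kR) * ‖e‖ ^ 2 := by
      have : 0 ≤ kR / 2 * (‖r‖ - C₂ / kR * ‖e‖) ^ 2 := by positivity
      have h2 : kR / 2 * (‖r‖ - C₂ / kR * ‖e‖) ^ 2 = kR / 2 * ‖r‖ ^ 2 +
        C₂ ^ 2 / (2 * kR) * ‖e‖ ^ 2 - C₂ * (‖r‖ * ‖e‖) := by field_simp; ring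
      linarith
    have hee := norm_sq_le_dotProduct e
    have h1 : ε * (attErr 1 (Q * hat e) ⬝ᵥ (J *ᵥ e) + r ⬝ᵥ attRhs kR kΩ J Q w e) ≤
        ε * (C₁ * ‖e‖ ^ 2 + (-kR * ‖r‖ ^ 2 + (kR / 2 * ‖r‖ ^ 2 +
          C₂ ^ 2 / (2 * kR) * ‖e‖ ^ 2))) := by
      gcongr
      linarith
    have h2 : ε * (C₁ + C₂ ^ 2 / (2 * kR)) * ‖e‖ ^ 2 ≤ kΩ / 2 * ‖e‖ ^ 2 := by gcongr
    have h3 : kΩ * ‖e‖ ^ 2 ≤ kΩ * (e ⬝ᵥ e) := by gcongr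
    have h4 : min (kΩ / 2) (ε * kR / 2 / 12) * ‖e‖ ^ 2 ≤ kΩ / 2 * ‖e‖ ^ 2 := by
      gcongr; exact min_le_left _ _
    have h5 : min (kΩ / 2) (ε * kR / 2 / 12) * ‖Q - 1‖ ^ 2 ≤ ε * kR / 2 / 12 * (12 * ‖r‖ ^ 2) :=
      mul_le_mul (min_le_right _ _) hQ2 (sq_nonneg _) (by positivity)
    rw [attLyapDeriv, hdot, ← hr]
    linarith

variable {n : ℕ} {ν : Fin n → ℕ}

/-! ## The equations of motion as a linear equation for the accelerations -/

/-- One vector for every link. -/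
abbrev LinkV (ν : Fin n → ℕ) := (i : Fin n) → Fin (ν i) → V3

/-- Values of `(v̇₀, Ω̇₀, ω̇)`. -/
abbrev AccV (ν : Fin n → ℕ) := V3 × V3 × LinkV ν

/-- The inertia operator. The last term of the link equations enforces `q · ω̇ = 0`. -/
def massOp (p : Params n ν) (R0 : Mat3) (q : LinkV ν) (a : AccV ν) : AccV ν :=
  (p.MT • a.1 - ∑ i, ∑ j : Fin (ν i), (p.M0 i j * p.l i j) • (a.2.2 i j ⨯₃ q i j)
      - ∑ i, p.MiT i • (R0 *ᵥ (p.ρ i ⨯₃ a.2.1)),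
    p.Jbar *ᵥ a.2.1 + ∑ i, p.MiT i • (p.ρ i ⨯₃ (R0ᵀ *ᵥ a.1))
      - ∑ i, ∑ j : Fin (ν i), (p.M0 i j * p.l i j) • (p.ρ i ⨯₃ (R0ᵀ *ᵥ (a.2.2 i j ⨯₃ q i j))),
    fun i j => q i j ⨯₃ (∑ k : Fin (ν i), (p.M0 i (min (j : ℕ) k) * p.l i k) •
        (a.2.2 i k ⨯₃ q i k) - p.M0 i j • a.1 + p.M0 i j • (R0 *ᵥ (p.ρ i ⨯₃ a.2.1)))
      + (q i j ⬝ᵥ a.2.2 i j) • q i j)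

/-- The right-hand side of the equations of motion for thrust vectors `u`. -/
def forcing (p : Params n ν) (R0 : Mat3) (Ω0 : V3) (q ω : LinkV ν) (u : Fin n → V3) : AccV ν :=
  ((p.MT * p.g) • e3 + ∑ i, u i - ∑ i, p.MiT i • (R0 *ᵥ (Ω0 ⨯₃ (Ω0 ⨯₃ p.ρ i)))
      + ∑ i, ∑ j : Fin (ν i), (p.M0 i j * p.l i j) • (ω i j ⨯₃ (ω i j ⨯₃ q i j)),
    ∑ i, p.ρ i ⨯₃ (R0ᵀ *ᵥ (u i + (p.MiT i * p.g) • e3)) - Ω0 ⨯₃ (p.Jbar *ᵥ Ω0)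
      + ∑ i, ∑ j : Fin (ν i), (p.M0 i j * p.l i j) •
        (p.ρ i ⨯₃ (R0ᵀ *ᵥ (ω i j ⨯₃ (ω i j ⨯₃ q i j)))),
    fun i j => -(q i j ⨯₃ (∑ k : Fin (ν i), (p.M0 i (min (j : ℕ) k) * p.l i k) •
        (ω i k ⨯₃ (ω i k ⨯₃ q i k)) - p.M0 i j • (R0 *ᵥ (Ω0 ⨯₃ (Ω0 ⨯₃ p.ρ i)))
        + (p.M0 i j * p.g) • e3 + u i)))

theorem cross_cross_cross_self (q X : V3) : q ⨯₃ (q ⨯₃ (q ⨯₃ X)) = -(q ⬝ᵥ q) • (q ⨯₃ X) := by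
  ext i
  fin_cases i <;> simp [cross_apply, dotProduct, Fin.sum_univ_three] <;> ring

/-- The link equations of the model carry `q̂²`, and for unit `q` one factor `q̂` can be removed.
The remaining equation has no component along `q`, which leaves room for the constraint on `q · ω̇`
in `massOp`. -/
theorem cross_cross_eq_zero_iff {q : V3} (hq : q ⬝ᵥ q = 1) (X : V3) :
    q ⨯₃ (q ⨯₃ X) = 0 ↔ q ⨯₃ X = 0 := by
  constructor
  · intro h
    have := cross_cross_cross_self q X
    rw [h, map_zero, hq, neg_smul, one_smul] at this
    exact neg_eq_zero.mp this.symm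
  · intro h
    rw [h, map_zero]

/-- Taking the scalar product of the link equation with `q` removes all cross products and leaves
the constraint term. -/
theorem dot_eq_zero_of_massOp_eq_forcing {p : Params n ν} {R0 : Mat3} {Ω0 : V3} {q ω : LinkV ν}
    {u : Fin n → V3} {a : AccV ν} (hq : ∀ i j, q i j ⬝ᵥ q i j = 1)
    (h : massOp p R0 q a = forcing p R0 Ω0 q ω u) (i : Fin n) (j : Fin (ν i)) :
    q i j ⬝ᵥ a.2.2 i j = 0 := by
  have h3 := congrArg (fun v => q i j ⬝ᵥ v) (congrFun (congrFun (congrArg (fun b => b.2.2) h) i) j)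
  simpa only [massOp, forcing, dotProduct_add, dotProduct_neg, dot_self_cross, dotProduct_smul, hq,
    smul_eq_mul, mul_one, zero_add, neg_zero] using h3

/-- The centripetal part `ω × (ω × q)` of `qdd` goes to the right-hand side, and what remains is
linear in the accelerations. Given `q · ω̇ = 0`, the added constraint term is zero. -/
theorem motion_iff {p : Params n ν} {s : State n ν} {f : Fin n → ℝ} {a : Accel n ν}
    (hq : ∀ i j, s.q i j ⬝ᵥ s.q i j = 1) (ha : ∀ i j, s.q i j ⬝ᵥ a.ω i j = 0) :
    Motion p s f a ↔ massOp p s.R0 s.q (a.v0, a.Ω0, a.ω) =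
      forcing p s.R0 s.Ω0 s.q s.ω (fun i => (-f i) • (s.R i *ᵥ e3)) := by
  have key : ∀ i, ∀ j : Fin (ν i), (∑ k : Fin (ν i), (p.M0 i (min (j : ℕ) k) * p.l i k) •
          (s.q i j ⨯₃ (s.q i j ⨯₃ qdd s a i k))
        - p.M0 i j • (s.q i j ⨯₃ (s.q i j ⨯₃ a.v0))
        + p.M0 i j • (s.q i j ⨯₃ (s.q i j ⨯₃ (s.R0 *ᵥ (p.ρ i ⨯₃ a.Ω0))))
      = p.M0 i j •
          (s.q i j ⨯₃ (s.q i j ⨯₃ (s.R0 *ᵥ (s.Ω0 ⨯₃ (s.Ω0 ⨯₃ p.ρ i)))))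
        - s.q i j ⨯₃ (s.q i j ⨯₃ ((p.M0 i j * p.g) • e3 - f i • (s.R i *ᵥ e3)))) ↔
      s.q i j ⨯₃ (∑ k : Fin (ν i), (p.M0 i (min (j : ℕ) k) * p.l i k) •
        (a.ω i k ⨯₃ s.q i k) - p.M0 i j • a.v0 + p.M0 i j • (s.R0 *ᵥ (p.ρ i ⨯₃ a.Ω0)))
      = -(s.q i j ⨯₃ (∑ k : Fin (ν i), (p.M0 i (min (j : ℕ) k) * p.l i k) •
        (s.ω i k ⨯₃ (s.ω i k ⨯₃ s.q i k)) - p.M0 i j • (s.R0 *ᵥ (s.Ω0 ⨯₃ (s.Ω0 ⨯₃ p.ρ i)))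
        + (p.M0 i j * p.g) • e3 + (-f i) • (s.R i *ᵥ e3))) := by
    intro i j
    rw [eq_neg_iff_add_eq_zero, ← map_add, ← cross_cross_eq_zero_iff (hq i j), ← sub_eq_zero]
    apply iff_of_eq
    congr 1
    simp only [qdd, map_add, map_sub, map_sum, map_smul, smul_add,
      Finset.sum_add_distrib, neg_smul, map_neg]
    abel
  constructor
  · rintro ⟨h1, h2, h3⟩
    refine Prod.ext ?_ (Prod.ext ?_ ?_)
    · simp only [qdd, smul_add, Finset.sum_add_distrib] at h1
      simp only [massOp, forcing]
      linear_combination (exp := 1) h1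
    · simp only [qdd, smul_add, Finset.sum_add_distrib, Matrix.mulVec_add, map_add] at h2
      simp only [massOp, forcing, Matrix.mulVec_add, map_add, Finset.sum_add_distrib]
      linear_combination (exp := 1) h2
    · funext i j
      simp only [massOp, forcing, ha, zero_smul, add_zero]
      exact (key i j).mp (h3 i j)
  · intro h
    have h1 := congrArg (fun b => b.1) h
    have h2 := congrArg (fun b => b.2.1) h
    have h3 := fun i j => congrFun (congrFun (congrArg (fun b => b.2.2) h) i) j
    refine ⟨?_, ?_, fun i j => (key i j).mpr ?_⟩
    · simp only [massOp, forcing] at h1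
      simp only [qdd, smul_add, Finset.sum_add_distrib]
      linear_combination (exp := 1) h1
    · simp only [massOp, forcing, Matrix.mulVec_add, map_add, Finset.sum_add_distrib] at h2
      simp only [qdd, smul_add, Finset.sum_add_distrib, Matrix.mulVec_add, map_add]
      linear_combination (exp := 1) h2
    · have := h3 i j
      simp only [massOp, forcing, ha, zero_smul, add_zero] at this
      exact this

/-! ## Comparison with the linearized equations -/

/-- The coordinates of `(v̇₀, Ω̇₀, ω̇)` used in the linear design. -/
def perp (a : AccV ν) : LinIdx ν → ℝ
  | .inl c => a.1 c
  | .inr (.inl c) => a.2.1 c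
  | .inr (.inr ⟨i, j, c⟩) => a.2.2 i j c.castSucc

theorem cross_apply_eq_sum (x y : V3) (c : Fin 3) : (x ⨯₃ y) c = ∑ b, hat x c b * y b := by
  rw [← hat_mulVec]; rfl

theorem e3_cross_apply_eq_sum (y : V3) (c : Fin 3) :
    (e3 ⨯₃ y) c = ∑ b : Fin 2, hat e3 c b.castSucc * y b.castSucc := by
  fin_cases c <;> simp [e3, hat, cross_apply, Fin.sum_univ_two]

theorem cross_e3_cross_apply_eq_sum (x y : V3) (c : Fin 3) :
    (x ⨯₃ (e3 ⨯₃ y)) c = ∑ b : Fin 2, (hat x * hat e3) c b.castSucc * y b.castSucc := by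
  fin_cases c <;> simp [e3, hat, cross_apply, Fin.sum_univ_two, Matrix.mul_apply,
    Fin.sum_univ_three]

theorem hat_mul_hat_apply_sum (x y z : V3) (c : Fin 3) :
    ∑ b, (hat x * hat y) c b * z b = (x ⨯₃ (y ⨯₃ z)) c := by
  rw [← hat_mulVec, ← hat_mulVec, Matrix.mulVec_mulVec]; rfl

theorem sum_linIdx {f : LinIdx ν → ℝ} : ∑ y, f y = ∑ a, f (.inl a) + (∑ a, f (.inr (.inl a)) +
    ∑ i, ∑ j, ∑ c, f (.inr (.inr ⟨i, j, c⟩))) := by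
  simp only [Fintype.sum_sum_type, Fintype.sum_sigma, Fintype.sum_prod_type]

theorem sum_sum_mul {ι κ : Type*} [Fintype ι] [Fintype κ] (f : ι → κ → ℝ) (g : κ → ℝ) :
    ∑ b, (∑ i, f i b) * g b = ∑ i, ∑ b, f i b * g b := by
  simp_rw [Finset.sum_mul]
  exact Finset.sum_comm

/-- At the hanging configuration `ω̇` enters only through cross products with `e3`, which do not see
its third component. The one exception is the constraint term, which points along `e3` and is
discarded by `perp`. -/
theorem linM_mulVec_perp (p : Params n ν) (a : AccV ν) :
    linM p *ᵥ perp a = perp (massOp p 1 (fun _ _ => e3) a) := by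
  have hneg : ∀ x y : V3, x ⨯₃ y = -(y ⨯₃ x) := fun x y => (cross_anticomm y x).symm
  ext y
  rcases y with c | c | ⟨i, j, c⟩
  · simp only [Matrix.mulVec, dotProduct, sum_linIdx, linM, perp, massOp, Matrix.one_mulVec,
      Pi.sub_apply, Pi.smul_apply, Finset.sum_apply, smul_eq_mul, neg_mul,
      Finset.sum_neg_distrib, sum_sum_mul, mul_assoc, ← Finset.mul_sum, ← cross_apply_eq_sum,
      ← e3_cross_apply_eq_sum]
    simp only [hneg _ e3, Matrix.one_apply, Pi.neg_apply, ite_mul, one_mul, zero_mul,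
      Finset.sum_ite_eq, Finset.mem_univ, if_true, mul_neg, Finset.sum_neg_distrib]
    ring
  · simp only [Matrix.mulVec, dotProduct, sum_linIdx, linM, perp, massOp, Matrix.one_mulVec,
      Matrix.transpose_one, Pi.add_apply,
      Pi.sub_apply, Pi.smul_apply, Finset.sum_apply, smul_eq_mul, sum_sum_mul, mul_assoc, ← Finset.mul_sum, ← cross_apply_eq_sum,
      ← cross_e3_cross_apply_eq_sum]
    simp only [hneg _ e3, map_neg, Pi.neg_apply, mul_neg, Finset.sum_neg_distrib]
    ring
  · have h2 : ∀ c : Fin 2, e3 c.castSucc = 0 := fun c => by fin_cases c <;> rfl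
    have h3 : ∀ (y : V3) (c : Fin 2), (e3 ⨯₃ (y ⨯₃ e3)) c.castSucc = y c.castSucc := fun y c => by
      fin_cases c <;> simp [e3, cross_apply]
    simp only [Matrix.mulVec, dotProduct, sum_linIdx, linM, perp, massOp, Matrix.one_mulVec,
      Pi.add_apply, Pi.sub_apply, Pi.smul_apply, Finset.sum_apply, smul_eq_mul, neg_mul, map_add,
      map_sub, map_sum, map_smul,
      Finset.sum_neg_distrib, mul_assoc, ← Finset.mul_sum, ← cross_apply_eq_sum,
      hat_mul_hat_apply_sum, h2, h3, mul_zero, add_zero]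
    have h4 : ∑ k, ∑ j' : Fin (ν k), ∑ c', (if i = k ∧ c = c' then p.M0 i (min (j : ℕ) j') * p.l k j' else 0) *
        a.2.2 k j' c'.castSucc =
        ∑ k : Fin (ν i), p.M0 i (min (j : ℕ) k) * (p.l i k * a.2.2 i k c.castSucc) := by
      rw [Finset.sum_eq_single i]
      · simp [mul_assoc]
      · intro k _ hk
        simp [hk.symm]
      · simp
    rw [h4]
    ring

theorem linG_mulVec_rot (p : Params n ν) (y : LinIdx ν → ℝ) (c : Fin 3) :
    (linG p *ᵥ y) (.inr (.inl c)) =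
      ∑ i, p.m0 / n * p.g * (p.ρ i ⨯₃ (e3 ⨯₃ fun b => y (.inr (.inl b)))) c := by
  simp only [Matrix.mulVec, dotProduct, sum_linIdx, linG, zero_mul, Finset.sum_const_zero,
    zero_add, add_zero, sum_sum_mul, mul_assoc, ← Finset.mul_sum, hat_mul_hat_apply_sum]

theorem linG_mulVec_link (p : Params n ν) (y : LinIdx ν → ℝ) (i : Fin n) (j : Fin (ν i))
    (c : Fin 2) : (linG p *ᵥ y) (.inr (.inr ⟨i, j, c⟩)) =
      (p.MiT i + p.m0 / n - p.M0 i j) * p.g * y (.inr (.inr ⟨i, j, c⟩)) := by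
  simp only [Matrix.mulVec, dotProduct, Fintype.sum_sum_type, linG, zero_mul,
    Finset.sum_const_zero, zero_add, ite_mul, Finset.sum_ite_eq, Finset.mem_univ, if_true]

theorem linG_mulVec_trans (p : Params n ν) (y : LinIdx ν → ℝ) (c : Fin 3) :
    (linG p *ᵥ y) (.inl c) = 0 := by
  simp only [Matrix.mulVec, dotProduct, linG, zero_mul, Finset.sum_const_zero]

theorem linB_mulVec_trans (p : Params n ν) (w : Fin n × Fin 3 → ℝ) (c : Fin 3) :
    (linB p *ᵥ w) (.inl c) = ∑ i, w (i, c) := by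
  simp [Matrix.mulVec, dotProduct, linB, Fintype.sum_prod_type, Matrix.one_apply]

theorem linB_mulVec_rot (p : Params n ν) (w : Fin n × Fin 3 → ℝ) (c : Fin 3) :
    (linB p *ᵥ w) (.inr (.inl c)) = ∑ i, (p.ρ i ⨯₃ fun b => w (i, b)) c := by
  simp only [Matrix.mulVec, dotProduct, linB, Fintype.sum_prod_type, cross_apply_eq_sum]

theorem linB_mulVec_link (p : Params n ν) (w : Fin n × Fin 3 → ℝ) (i : Fin n) (j : Fin (ν i))
    (c : Fin 2) :
    (linB p *ᵥ w) (.inr (.inr ⟨i, j, c⟩)) = -(e3 ⨯₃ fun b => w (i, b)) c.castSucc := by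
  simp only [Matrix.mulVec, dotProduct, linB, Fintype.sum_prod_type, cross_apply_eq_sum]
  rw [Finset.sum_eq_single i]
  · simp
  · intro k _ hk
    simp [hk.symm]
  · simp

/-- The thrust vector `uᵢ*` of the hanging equilibrium. -/
def thrustEq (p : Params n ν) (i : Fin n) : V3 := -((p.MiT i + p.m0 / n) * p.g) • e3

/-- The `n` shares `m₀ / n` add up to the payload mass, so the equilibrium thrusts carry the total
weight. -/
theorem sum_thrustEq (hn : 0 < n) (p : Params n ν) :
    ∑ i, thrustEq p i = -((p.MT * p.g) • e3) := by
  have hn' : (n : ℝ) ≠ 0 := by positivity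
  simp only [thrustEq, ← Finset.sum_smul, ← neg_smul, Finset.sum_neg_distrib, ← Finset.sum_mul,
    Finset.sum_add_distrib, Params.MT]
  congr 3
  simp [mul_div_cancel₀ _ hn', add_comm]

/-- The terms of second order in the equations of motion, with thrust vectors `u* + d`. -/
def resid (p : Params n ν) (R0 : Mat3) (Ω0 : V3) (q ω : LinkV ν) (a : AccV ν) (d : Fin n → V3) :
    AccV ν :=
  (∑ i, ∑ j : Fin (ν i), (p.M0 i j * p.l i j) • (a.2.2 i j ⨯₃ (q i j - e3))
      + ∑ i, p.MiT i • ((R0 - 1) *ᵥ (p.ρ i ⨯₃ a.2.1))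
      - ∑ i, p.MiT i • (R0 *ᵥ (Ω0 ⨯₃ (Ω0 ⨯₃ p.ρ i)))
      + ∑ i, ∑ j : Fin (ν i), (p.M0 i j * p.l i j) • (ω i j ⨯₃ (ω i j ⨯₃ q i j)),
    -∑ i, p.MiT i • (p.ρ i ⨯₃ ((R0ᵀ - 1) *ᵥ a.1))
      + ∑ i, ∑ j : Fin (ν i), (p.M0 i j * p.l i j) •
        (p.ρ i ⨯₃ ((R0ᵀ - 1) *ᵥ (a.2.2 i j ⨯₃ q i j)) + p.ρ i ⨯₃ (a.2.2 i j ⨯₃ (q i j - e3)))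
      + ∑ i, p.ρ i ⨯₃ ((R0ᵀ - 1) *ᵥ d i) - Ω0 ⨯₃ (p.Jbar *ᵥ Ω0)
      + ∑ i, ∑ j : Fin (ν i), (p.M0 i j * p.l i j) •
        (p.ρ i ⨯₃ (R0ᵀ *ᵥ (ω i j ⨯₃ (ω i j ⨯₃ q i j))))
      + ∑ i, (p.m0 / n * p.g / 2) • (p.ρ i ⨯₃ ((R0 - 1) *ᵥ ((R0 - 1)ᵀ *ᵥ e3))),
    fun i j => -((q i j - e3) ⨯₃ (∑ k : Fin (ν i), (p.M0 i (min (j : ℕ) k) * p.l i k) •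
        (a.2.2 i k ⨯₃ q i k) - p.M0 i j • a.1 + p.M0 i j • (R0 *ᵥ (p.ρ i ⨯₃ a.2.1))))
      - e3 ⨯₃ (∑ k : Fin (ν i), (p.M0 i (min (j : ℕ) k) * p.l i k) •
        (a.2.2 i k ⨯₃ (q i k - e3)) + p.M0 i j • ((R0 - 1) *ᵥ (p.ρ i ⨯₃ a.2.1)))
      - ((q i j - e3) ⬝ᵥ a.2.2 i j) • q i j - (e3 ⬝ᵥ a.2.2 i j) • (q i j - e3)
      - (q i j - e3) ⨯₃ d i
      - q i j ⨯₃ (∑ k : Fin (ν i), (p.M0 i (min (j : ℕ) k) * p.l i k) •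
        (ω i k ⨯₃ (ω i k ⨯₃ q i k)) - p.M0 i j • (R0 *ᵥ (Ω0 ⨯₃ (Ω0 ⨯₃ p.ρ i)))))

/-- An exact expansion of a rotation at the identity. The skew part of `R0` is the hat of `attErr 1
R0`. By orthogonality `(R0 - 1)(R0 - 1)ᵀ = 2 - R0 - R0ᵀ`, so the symmetric part differs from the
identity by a term quadratic in `R0 - 1`. -/
theorem SO3.transpose_mulVec {R0 : Mat3} (hR : R0 ∈ SO3) (x : V3) :
    R0ᵀ *ᵥ x = x + x ⨯₃ attErr 1 R0 - (1 / 2 : ℝ) • ((R0 - 1) *ᵥ ((R0 - 1)ᵀ *ᵥ x)) := by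
  have h1 : (R0 - 1) * (R0 - 1)ᵀ = 2 • 1 - R0 - R0ᵀ := by
    rw [Matrix.transpose_sub, Matrix.transpose_one, sub_mul, mul_sub, mul_sub,
      SO3.mul_transpose hR]
    simp only [mul_one, one_mul]
    abel
  rw [Matrix.mulVec_mulVec, h1, Matrix.sub_mulVec, Matrix.sub_mulVec, two_smul, Matrix.add_mulVec,
    Matrix.one_mulVec]
  ext i
  fin_cases i <;> simp [attErr, vee, cross_apply, Matrix.mulVec, dotProduct, Fin.sum_univ_three,
    Matrix.vecHead, Matrix.vecTail] <;> ring

/-- This is where `∑ ρᵢ` parallel to `e3` enters: the constant moments on the hanging payload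
balance. -/
theorem sum_cross_e3 (p : Params n ν) (hρ : (∑ i, p.ρ i) 0 = 0 ∧ (∑ i, p.ρ i) 1 = 0) :
    ∑ i, p.ρ i ⨯₃ e3 = 0 := by
  have h : ∑ i, p.ρ i ⨯₃ e3 = (∑ i, p.ρ i) ⨯₃ e3 := by
    rw [map_sum, LinearMap.sum_apply]
  rw [h]
  ext i
  fin_cases i <;> simp [cross_apply, e3]
  · simpa using hρ.2
  · simpa using hρ.1

/-- Accelerations satisfy the linearized equations up to terms of second order. -/
theorem linM_mulVec_perp_of_massOp_eq (hn : 0 < n) {p : Params n ν}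
    (hρ : (∑ i, p.ρ i) 0 = 0 ∧ (∑ i, p.ρ i) 1 = 0) {R0 : Mat3} (hR : R0 ∈ SO3) {Ω0 : V3}
    {q ω : LinkV ν} {a : AccV ν} {d : Fin n → V3} {y : LinIdx ν → ℝ}
    (hy : ∀ b, y (.inr (.inl b)) = attErr 1 R0 b)
    (hy' : ∀ i j c, y (.inr (.inr ⟨i, j, c⟩)) = (e3 ⨯₃ q i j) c.castSucc)
    (h : massOp p R0 q a = forcing p R0 Ω0 q ω (fun i => thrustEq p i + d i)) :
    linM p *ᵥ perp a + linG p *ᵥ y - linB p *ᵥ (fun ic => d ic.1 ic.2)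
      = perp (resid p R0 Ω0 q ω a d) := by
  rw [linM_mulVec_perp]
  have h1 := congrArg (fun b => b.1) h
  have h2 := congrArg (fun b => b.2.1) h
  have h3 := fun i j => congrFun (congrFun (congrArg (fun b => b.2.2) h) i) j
  simp only [massOp, forcing] at h1 h2 h3
  have e1 : (massOp p 1 (fun _ _ => e3) a).1 - ∑ i, d i = (resid p R0 Ω0 q ω a d).1 := by
    simp only [massOp, resid, map_sub, Matrix.sub_mulVec, smul_sub, Finset.sum_sub_distrib,
      Matrix.one_mulVec]
    rw [Finset.sum_add_distrib, sum_thrustEq hn] at h1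
    linear_combination (norm := module) h1
  have e2 : (massOp p 1 (fun _ _ => e3) a).2.1
      + ∑ i, (p.m0 / n * p.g) • (p.ρ i ⨯₃ (e3 ⨯₃ attErr 1 R0)) - ∑ i, p.ρ i ⨯₃ d i
      = (resid p R0 Ω0 q ω a d).2.1 := by
    -- Gravity cancels the share `M_{iT}` of the equilibrium thrust. The moment of the remaining
    -- `-(m₀/n) g e3`, seen from the tilted payload, is the stiffness of the payload attitude.
    have hu : ∀ i, thrustEq p i + d i + (p.MiT i * p.g) • e3 = d i - (p.m0 / n * p.g) • e3 := by
      intro i; rw [thrustEq]; module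
    have hz : ∑ i, (p.m0 / n * p.g) • (p.ρ i ⨯₃ e3) = 0 := by
      rw [← Finset.smul_sum, sum_cross_e3 p hρ, smul_zero]
    simp only [hu, Matrix.mulVec_sub, Matrix.mulVec_smul, SO3.transpose_mulVec hR e3, map_sub,
      map_add, map_smul, smul_add, smul_sub, Finset.sum_sub_distrib, Finset.sum_add_distrib, hz,
      smul_smul, Matrix.sub_mulVec, Matrix.one_mulVec] at h2
    simp only [massOp, resid, map_sub, Matrix.sub_mulVec, smul_sub, Finset.sum_sub_distrib,
      Matrix.one_mulVec, Matrix.transpose_one, smul_add, Finset.sum_add_distrib]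
    have hc : p.m0 / n * p.g * (1 / 2) = p.m0 / n * p.g / 2 := by ring
    rw [hc] at h2
    linear_combination (norm := module) h2
  have e3' : ∀ i j, (massOp p 1 (fun _ _ => e3) a).2.2 i j
      + ((p.MiT i + p.m0 / n - p.M0 i j) * p.g) • (e3 ⨯₃ q i j) + e3 ⨯₃ d i
      = (resid p R0 Ω0 q ω a d).2.2 i j := by
    intro i j
    have h3 := h3 i j
    have hqe : q i j ⨯₃ e3 = -(e3 ⨯₃ q i j) := (cross_anticomm _ _).symm
    simp only [thrustEq, map_add, map_sub, map_sum, map_smul, hqe] at h3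
    simp only [massOp, resid, map_add, map_sub, map_sum, map_smul, Matrix.sub_mulVec, smul_sub,
      Finset.sum_sub_distrib, Matrix.one_mulVec, LinearMap.sub_apply, sub_dotProduct]
    linear_combination (norm := module) h3
  ext x
  rcases x with c | c | ⟨i, j, c⟩
  · simp only [Pi.add_apply, Pi.sub_apply, linG_mulVec_trans, linB_mulVec_trans]
    have := congrFun e1 c
    simp only [Pi.sub_apply, Finset.sum_apply] at this
    simpa [perp] using this
  · simp only [Pi.add_apply, Pi.sub_apply, linG_mulVec_rot, linB_mulVec_rot, hy]
    have := congrFun e2 c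
    simp only [Pi.sub_apply, Pi.add_apply, Finset.sum_apply, Pi.smul_apply, smul_eq_mul] at this
    exact this
  · simp only [Pi.add_apply, Pi.sub_apply, linG_mulVec_link, linB_mulVec_link, hy', sub_neg_eq_add]
    have := congrFun (e3' i j) c.castSucc
    simp only [Pi.add_apply, Pi.smul_apply, smul_eq_mul] at this
    exact this

/-! ### The residual is of second order -/

section Small

open Asymptotics Topology

variable {E : Type*} [NormedAddCommGroup E] {x₀ : E}

/-- A bilinear expression is of second order if one factor tends to zero and the other is of first
order. All terms of the residual are handled this way. -/
theorem isLittleO_of_norm_le_mul {F G H : Type*} [NormedAddCommGroup F] [NormedSpace ℝ F]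
    [NormedAddCommGroup G] [NormedSpace ℝ G] [NormedAddCommGroup H] {f : E → F} {g : E → G}
    {h : E → H} (C : ℝ) (hf : f =o[𝓝 x₀] fun _ => (1 : ℝ)) (hg : g =O[𝓝 x₀] fun x => x - x₀)
    (hh : ∀ x, ‖h x‖ ≤ C * ‖f x‖ * ‖g x‖) : h =o[𝓝 x₀] fun x => x - x₀ := by
  have h1 : (fun x => ‖f x‖ * ‖g x‖) =o[𝓝 x₀] fun x => (1 : ℝ) * ‖x - x₀‖ :=
    hf.norm_left.mul_isBigO hg.norm_norm
  simp only [one_mul] at h1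
  refine IsBigO.trans_isLittleO (IsBigO.of_bound |C| (Filter.Eventually.of_forall fun x => ?_))
    h1.of_norm_right
  refine (hh x).trans ?_
  rw [Real.norm_of_nonneg (by positivity), mul_assoc]
  gcongr
  exact le_abs_self C

theorem isLittleO_finset_sum {ι F : Type*} [NormedAddCommGroup F] {s : Finset ι} {f : ι → E → F}
    (hf : ∀ i, f i =o[𝓝 x₀] fun x => x - x₀) :
    (fun x => ∑ i ∈ s, f i x) =o[𝓝 x₀] fun x => x - x₀ := by
  have := IsLittleO.sum (s := s) fun i _ => hf i
  simpa only [Finset.sum_fn] using this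

theorem isLittleO_const_smul {F : Type*} [NormedAddCommGroup F] [NormedSpace ℝ F] {f : E → F}
    (c : ℝ) (hf : f =o[𝓝 x₀] fun x => x - x₀) : (fun x => c • f x) =o[𝓝 x₀] fun x => x - x₀ :=
  hf.const_smul_left c

variable [NormedSpace ℝ E]

theorem isBigO_of_contDiff {F : Type*} [NormedAddCommGroup F] [NormedSpace ℝ F] {f : E → F}
    (hf : ContDiff ℝ 1 f) (h0 : f x₀ = 0) : f =O[𝓝 x₀] fun x => x - x₀ := by
  have := (hf.differentiable one_ne_zero x₀).isBigO_sub
  simpa [h0] using this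

theorem isLittleO_one_of_contDiff {F : Type*} [NormedAddCommGroup F] [NormedSpace ℝ F] {f : E → F}
    (hf : ContDiff ℝ 1 f) (h0 : f x₀ = 0) : f =o[𝓝 x₀] fun _ => (1 : ℝ) := by
  rw [isLittleO_one_iff, ← h0]
  exact hf.continuous.continuousAt

theorem isLittleO_cross {f g : E → V3} (hf : ContDiff ℝ 1 f) (hg : ContDiff ℝ 1 g)
    (hf0 : f x₀ = 0) (hg0 : g x₀ = 0) : (fun x => f x ⨯₃ g x) =o[𝓝 x₀] fun x => x - x₀ :=
  isLittleO_of_norm_le_mul 2 (isLittleO_one_of_contDiff hf hf0) (isBigO_of_contDiff hg hg0)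
    fun _ => norm_cross_le _ _

theorem isLittleO_mulVec {f : E → Mat3} {g : E → V3} (hf : ContDiff ℝ 1 f) (hg : ContDiff ℝ 1 g)
    (hf0 : f x₀ = 0) (hg0 : g x₀ = 0) : (fun x => f x *ᵥ g x) =o[𝓝 x₀] fun x => x - x₀ :=
  isLittleO_of_norm_le_mul 3 (isLittleO_one_of_contDiff hf hf0) (isBigO_of_contDiff hg hg0)
    fun _ => norm_mulVec_le _ _

theorem isLittleO_smul {f : E → ℝ} {g : E → V3} (hf : ContDiff ℝ 1 f) (hg : ContDiff ℝ 1 g)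
    (hf0 : f x₀ = 0) (hg0 : g x₀ = 0) : (fun x => f x • g x) =o[𝓝 x₀] fun x => x - x₀ :=
  isLittleO_of_norm_le_mul 1 (isLittleO_one_of_contDiff hf hf0) (isBigO_of_contDiff hg hg0)
    fun _ => by rw [norm_smul, one_mul]

theorem isLittleO_cross_left {f g : E → V3} (hf : ContDiff ℝ 1 f)
    (hg : g =o[𝓝 x₀] fun x => x - x₀) : (fun x => f x ⨯₃ g x) =o[𝓝 x₀] fun x => x - x₀ := by
  have h1 : (fun x => ‖f x‖ * ‖g x‖) =o[𝓝 x₀] fun x => (1 : ℝ) * ‖x - x₀‖ :=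
    (hf.continuous.continuousAt.isBigO_one ℝ).norm_left.mul_isLittleO hg.norm_norm
  simp only [one_mul] at h1
  refine IsBigO.trans_isLittleO (IsBigO.of_bound 2 (Filter.Eventually.of_forall fun x => ?_))
    h1.of_norm_right
  rw [Real.norm_of_nonneg (by positivity), ← mul_assoc]
  exact norm_cross_le _ _

theorem isLittleO_mulVec_left {f : E → Mat3} {g : E → V3} (hf : ContDiff ℝ 1 f)
    (hg : g =o[𝓝 x₀] fun x => x - x₀) : (fun x => f x *ᵥ g x) =o[𝓝 x₀] fun x => x - x₀ := by
  have h1 : (fun x => ‖f x‖ * ‖g x‖) =o[𝓝 x₀] fun x => (1 : ℝ) * ‖x - x₀‖ :=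
    (hf.continuous.continuousAt.isBigO_one ℝ).norm_left.mul_isLittleO hg.norm_norm
  simp only [one_mul] at h1
  refine IsBigO.trans_isLittleO (IsBigO.of_bound 3 (Filter.Eventually.of_forall fun x => ?_))
    h1.of_norm_right
  rw [Real.norm_of_nonneg (by positivity), ← mul_assoc]
  exact norm_mulVec_le _ _

theorem isLittleO_dot_smul {f g h : E → V3} (hf : ContDiff ℝ 1 f) (hg : ContDiff ℝ 1 g)
    (hh : ContDiff ℝ 1 h) (hf0 : f x₀ = 0) (hg0 : g x₀ = 0) :
    (fun x => (f x ⬝ᵥ g x) • h x) =o[𝓝 x₀] fun x => x - x₀ := by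
  have h1 : (fun x => f x ⬝ᵥ g x) =o[𝓝 x₀] fun x => x - x₀ :=
    isLittleO_of_norm_le_mul 3 (isLittleO_one_of_contDiff hf hf0) (isBigO_of_contDiff hg hg0)
      fun _ => abs_dotProduct_le _ _
  have h2 := h1.norm_norm.smul_isBigO (hh.continuous.continuousAt.isBigO_one ℝ)
  simp only [smul_eq_mul, mul_one] at h2
  refine IsBigO.trans_isLittleO (IsBigO.of_bound 1 (Filter.Eventually.of_forall fun x => ?_))
    h2.of_norm_right
  rw [norm_smul, norm_smul, norm_norm, one_mul]

end Small

/-- Values of `(x₀ - x_{0d}, v₀, R₀, Ω₀, q, ω)`. -/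
abbrev Outer (ν : Fin n → ℕ) := V3 × V3 × Mat3 × V3 × LinkV ν × LinkV ν

/-- The hanging equilibrium. -/
def outerEq (ν : Fin n → ℕ) : Outer ν := (0, 0, 1, 0, fun _ _ => e3, 0)

-- Each summand of `resid` contains two factors that vanish at the equilibrium, possibly multiplied
-- by a further continuous factor. The accelerations are treated here as independent variables near
-- zero.
open Asymptotics Topology in
theorem resid_isLittleO (p : Params n ν) :
    (fun w : Outer ν × AccV ν × (Fin n → V3) =>
        resid p w.1.2.2.1 w.1.2.2.2.1 w.1.2.2.2.2.1 w.1.2.2.2.2.2 w.2.1 w.2.2)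
      =o[𝓝 (outerEq ν, 0, 0)] fun w => w - (outerEq ν, 0, 0) := by
  set w₀ : Outer ν × AccV ν × (Fin n → V3) := (outerEq ν, 0, 0) with hw₀
  have hR : w₀.1.2.2.1 - 1 = 0 := sub_self _
  have hRt : (w₀.1.2.2.1)ᵀ - 1 = 0 := by simp [hw₀, outerEq]
  have hRt' : (w₀.1.2.2.1 - 1)ᵀ = 0 := by simp [hw₀, outerEq]
  have hq : ∀ i j, w₀.1.2.2.2.2.1 i j - e3 = 0 := fun i j => sub_self _
  have hΩ : w₀.1.2.2.2.1 = 0 := rfl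
  have hω : ∀ i j, w₀.1.2.2.2.2.2 i j = 0 := fun i j => rfl
  have h1 : w₀.2.1.1 = 0 := rfl
  have h2 : w₀.2.1.2.1 = 0 := rfl
  have h3 : ∀ i j, w₀.2.1.2.2 i j = 0 := fun i j => rfl
  have hd : ∀ i, w₀.2.2 i = 0 := fun i => rfl
  refine IsLittleO.prod_left ?_ (IsLittleO.prod_left ?_ ?_)
  · refine ((IsLittleO.add ?_ ?_).sub ?_).add ?_
    · refine isLittleO_finset_sum fun i => isLittleO_finset_sum fun j => isLittleO_const_smul _ ?_
      exact isLittleO_cross (by fun_prop) (by fun_prop) (h3 i j) (hq i j)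
    · refine isLittleO_finset_sum fun i => isLittleO_const_smul _ ?_
      exact isLittleO_mulVec (by fun_prop) (by fun_prop) hR (by simp [h2])
    · refine isLittleO_finset_sum fun i => isLittleO_const_smul _ ?_
      refine isLittleO_mulVec_left (by fun_prop) ?_
      exact isLittleO_cross (by fun_prop) (by fun_prop) hΩ (by simp [hΩ])
    · refine isLittleO_finset_sum fun i => isLittleO_finset_sum fun j => isLittleO_const_smul _ ?_
      exact isLittleO_cross (by fun_prop) (by fun_prop) (hω i j) (by simp [hω])
  · refine (((((IsLittleO.neg_left ?_).add ?_).add ?_).sub ?_).add ?_).add ?_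
    · refine isLittleO_finset_sum fun i => isLittleO_const_smul _ ?_
      refine isLittleO_cross_left (by fun_prop) ?_
      exact isLittleO_mulVec (by fun_prop) (by fun_prop) hRt h1
    · refine isLittleO_finset_sum fun i => isLittleO_finset_sum fun j => isLittleO_const_smul _ ?_
      refine IsLittleO.add ?_ ?_
      · refine isLittleO_cross_left (by fun_prop) ?_
        exact isLittleO_mulVec (by fun_prop) (by fun_prop) hRt (by simp [h3])
      · refine isLittleO_cross_left (by fun_prop) ?_
        exact isLittleO_cross (by fun_prop) (by fun_prop) (h3 i j) (hq i j)
    · refine isLittleO_finset_sum fun i => isLittleO_cross_left (by fun_prop) ?_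
      exact isLittleO_mulVec (by fun_prop) (by fun_prop) hRt (hd i)
    · exact isLittleO_cross (by fun_prop) (by fun_prop) hΩ (by simp [hΩ])
    · refine isLittleO_finset_sum fun i => isLittleO_finset_sum fun j => isLittleO_const_smul _ ?_
      refine isLittleO_cross_left (by fun_prop) (isLittleO_mulVec_left (by fun_prop) ?_)
      exact isLittleO_cross (by fun_prop) (by fun_prop) (hω i j) (by simp [hω])
    · refine isLittleO_finset_sum fun i => isLittleO_const_smul _ ?_
      refine isLittleO_cross_left (by fun_prop) ?_
      exact isLittleO_mulVec (by fun_prop) (by fun_prop) hR (by simp [hRt'])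
  · refine isLittleO_pi.2 fun i => isLittleO_pi.2 fun j => ?_
    refine (((((IsLittleO.neg_left ?_).sub ?_).sub ?_).sub ?_).sub ?_).sub ?_
    · refine isLittleO_cross (by fun_prop) (by fun_prop) (hq i j) ?_
      simp [h1, h2, h3]
    · refine isLittleO_cross_left (by fun_prop) (IsLittleO.add ?_ ?_)
      · refine isLittleO_finset_sum fun k => isLittleO_const_smul _ ?_
        exact isLittleO_cross (by fun_prop) (by fun_prop) (h3 i k) (hq i k)
      · refine isLittleO_const_smul _ ?_
        exact isLittleO_mulVec (by fun_prop) (by fun_prop) hR (by simp [h2])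
    · exact isLittleO_dot_smul (by fun_prop) (by fun_prop) (by fun_prop) (hq i j) (h3 i j)
    · exact isLittleO_smul (by fun_prop) (by fun_prop) (by simp [h3]) (hq i j)
    · exact isLittleO_cross (by fun_prop) (by fun_prop) (hq i j) (hd i)
    · refine isLittleO_cross_left (by fun_prop) (IsLittleO.sub ?_ ?_)
      · refine isLittleO_finset_sum fun k => isLittleO_const_smul _ ?_
        exact isLittleO_cross (by fun_prop) (by fun_prop) (hω i k) (by simp [hω])
      · refine isLittleO_const_smul _ (isLittleO_mulVec_left (by fun_prop) ?_)
        exact isLittleO_cross (by fun_prop) (by fun_prop) hΩ (by simp [hΩ])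

/-! ## The accelerations as a function of the state -/

/-- `massOp` as a continuous linear map. -/
def massCLM (p : Params n ν) (R0 : Mat3) (q : LinkV ν) : AccV ν →L[ℝ] AccV ν :=
  LinearMap.toContinuousLinearMap
    { toFun := massOp p R0 q
      map_add' := fun a b => by
        refine Prod.ext ?_ (Prod.ext ?_ ?_)
        · simp only [massOp, Prod.fst_add, Prod.snd_add, Pi.add_apply, map_add,
            LinearMap.add_apply, smul_add, Finset.sum_add_distrib, Matrix.mulVec_add]
          abel
        · simp only [massOp, Prod.fst_add, Prod.snd_add, Pi.add_apply, map_add,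
            LinearMap.add_apply, smul_add, Finset.sum_add_distrib, Matrix.mulVec_add]
          abel
        · funext i j
          simp only [massOp, Prod.fst_add, Prod.snd_add, Pi.add_apply, map_add, map_sub,
            LinearMap.add_apply, smul_add, Finset.sum_add_distrib, Matrix.mulVec_add,
            dotProduct_add, add_smul]
          abel
      map_smul' := fun c a => by
        have hc : ∀ (r : ℝ) (x : V3), r • c • x = c • r • x := fun r x => smul_comm r c x
        refine Prod.ext ?_ (Prod.ext ?_ ?_)
        · simp only [massOp, Prod.smul_fst, Prod.smul_snd, Pi.smul_apply, map_smul,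
            LinearMap.smul_apply, Matrix.mulVec_smul, RingHom.id_apply, hc, ← Finset.smul_sum,
            smul_sub]
        · simp only [massOp, Prod.smul_fst, Prod.smul_snd, Pi.smul_apply, map_smul,
            LinearMap.smul_apply, Matrix.mulVec_smul, RingHom.id_apply, hc, ← Finset.smul_sum,
            smul_sub, smul_add]
        · funext i j
          simp only [massOp, Prod.smul_fst, Prod.smul_snd, Pi.smul_apply, map_smul,
            LinearMap.smul_apply, Matrix.mulVec_smul, RingHom.id_apply, hc, ← Finset.smul_sum,
            ← smul_sub, ← smul_add, dotProduct_smul, smul_assoc] }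

theorem massCLM_apply (p : Params n ν) (R0 : Mat3) (q : LinkV ν) (a : AccV ν) :
    massCLM p R0 q a = massOp p R0 q a := rfl

@[fun_prop]
theorem contDiff_massCLM {k : WithTop ℕ∞} (p : Params n ν) :
    ContDiff ℝ k fun z : Outer ν => massCLM p z.2.2.1 z.2.2.2.2.1 := by
  rw [contDiff_clm_apply_iff]
  intro a
  simp only [massCLM_apply]
  unfold massOp
  refine ContDiff.prodMk (by fun_prop) (ContDiff.prodMk (by fun_prop) ?_)
  rw [contDiff_pi]
  intro i
  rw [contDiff_pi]
  intro j
  fun_prop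

/-- The inverse of a singular matrix has the default value `0`. With a singular inertia matrix the
closed-loop matrix would thus have vanishing lower blocks, which a Hurwitz matrix cannot have. -/
theorem isUnit_linM_of_isHurwitz {p : Params n ν} {Kx Kv : Matrix (Fin n × Fin 3) (LinIdx ν) ℝ}
    (hK : IsHurwitz (linClosedLoop p Kx Kv)) : IsUnit (linM p).det := by
  by_contra h
  apply not_isHurwitz_fromBlocks_zero (ι := LinIdx ν) 1
  have h0 : (linM p)⁻¹ = 0 := Matrix.nonsing_inv_apply_not_isUnit _ h
  simpa [linClosedLoop, h0] using hK

/-- A kernel vector has `perp a = 0` because `linM` is invertible, and the third components of `ω̇`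
vanish by the constraint term. In finite dimension injectivity suffices. -/
theorem massCLM_isInvertible {p : Params n ν} (hM : IsUnit (linM p).det) :
    (massCLM p 1 (fun _ _ => e3)).IsInvertible := by
  have hinj : Function.Injective (massCLM p 1 (fun _ _ => e3)).toLinearMap := by
    rw [← LinearMap.ker_eq_bot, LinearMap.ker_eq_bot']
    intro a ha
    have ha : massOp p 1 (fun _ _ => e3) a = 0 := ha
    have h1 := linM_mulVec_perp p a
    rw [ha] at h1
    have h2 : perp a = 0 := by
      have h3 : perp (0 : AccV ν) = 0 := by
        funext x
        rcases x with c | c | ⟨i, j, c⟩ <;> rfl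
      rw [h3] at h1
      exact Matrix.eq_zero_of_mulVec_eq_zero (by simpa using hM.ne_zero) h1
    refine Prod.ext (funext fun c => congrFun h2 (.inl c)) (Prod.ext
      (funext fun c => congrFun h2 (.inr (.inl c))) (funext fun i => funext fun j => ?_))
    have h4 := congrFun (congrFun (congrFun (congrArg (fun b => b.2.2) ha) i) j) 2
    have h5 : ∀ y : V3, (e3 ⨯₃ y) 2 = 0 := fun y => by simp [e3, cross_apply]
    simp only [massOp, Pi.add_apply, h5] at h4
    funext c
    fin_cases c
    · exact congrFun h2 (.inr (.inr ⟨i, j, 0⟩))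
    · exact congrFun h2 (.inr (.inr ⟨i, j, 1⟩))
    · simpa [e3, dotProduct, Fin.sum_univ_three] using h4
  exact ⟨(LinearEquiv.ofInjectiveEndo _ hinj).toContinuousLinearEquiv,
    ContinuousLinearMap.ext fun _ => rfl⟩

/-- The accelerations for thrust vectors `u* + d`. -/
def acc (p : Params n ν) (z : Outer ν) (d : Fin n → V3) : AccV ν :=
  (massCLM p z.2.2.1 z.2.2.2.2.1).inverse
    (forcing p z.2.2.1 z.2.2.2.1 z.2.2.2.2.1 z.2.2.2.2.2 fun i => thrustEq p i + d i)

/-- The states in which the accelerations are determined by the equations of motion. -/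
def regularSet (p : Params n ν) : Set (Outer ν) :=
  {z | (massCLM p z.2.2.1 z.2.2.2.2.1).IsInvertible}

theorem isOpen_regularSet (p : Params n ν) : IsOpen (regularSet p) :=
  ContinuousLinearEquiv.isOpen.preimage (contDiff_massCLM (k := 0) p).continuous

/-- Regularity is essential: for a non-invertible operator `inverse` has the default value zero, and
`acc` then says nothing about the equations of motion. -/
theorem acc_eq_iff {p : Params n ν} {z : Outer ν} (hz : z ∈ regularSet p) {d : Fin n → V3}
    {a : AccV ν} : acc p z d = a ↔ massOp p z.2.2.1 z.2.2.2.2.1 a =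
      forcing p z.2.2.1 z.2.2.2.1 z.2.2.2.2.1 z.2.2.2.2.2 fun i => thrustEq p i + d i := by
  rw [acc, ContinuousLinearMap.IsInvertible.inverse_apply_eq hz, massCLM_apply, eq_comm]

@[fun_prop]
theorem contDiff_forcing {k : WithTop ℕ∞} (p : Params n ν) :
    ContDiff ℝ k fun w : Outer ν × (Fin n → V3) => forcing p w.1.2.2.1 w.1.2.2.2.1 w.1.2.2.2.2.1
      w.1.2.2.2.2.2 fun i => thrustEq p i + w.2 i := by
  unfold forcing
  refine ContDiff.prodMk (by fun_prop) (ContDiff.prodMk (by fun_prop) ?_)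
  rw [contDiff_pi]
  intro i
  rw [contDiff_pi]
  intro j
  fun_prop

theorem contDiffAt_acc {k : WithTop ℕ∞} {p : Params n ν} {w : Outer ν × (Fin n → V3)}
    (hz : w.1 ∈ regularSet p) : ContDiffAt ℝ k (fun w => acc p w.1 w.2) w := by
  have h1 : ContDiffAt ℝ k (fun w : Outer ν × (Fin n → V3) =>
      (massCLM p w.1.2.2.1 w.1.2.2.2.2.1).inverse) w :=
    ContDiffAt.comp w (ContinuousLinearMap.IsInvertible.contDiffAt_map_inverse (𝕜 := ℝ) (n := k)
        (show (massCLM p w.1.2.2.1 w.1.2.2.2.2.1).IsInvertible from hz))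
      ((contDiff_massCLM p).comp contDiff_fst).contDiffAt
  exact h1.clm_apply (contDiff_forcing p).contDiffAt

theorem outerEq_mem_regularSet {p : Params n ν} (hM : IsUnit (linM p).det) :
    outerEq ν ∈ regularSet p := massCLM_isInvertible hM

/-- The forcing vanishes at the hanging state: the thrusts balance the weight, their moments cancel,
and all link forces are parallel to the links. -/
theorem acc_outerEq (hn : 0 < n) {p : Params n ν}
    (hρ : (∑ i, p.ρ i) 0 = 0 ∧ (∑ i, p.ρ i) 1 = 0) (hM : IsUnit (linM p).det) :
    acc p (outerEq ν) 0 = 0 := by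
  rw [acc_eq_iff (outerEq_mem_regularSet hM), ← massCLM_apply, map_zero, eq_comm]
  refine Prod.ext ?_ (Prod.ext ?_ (funext fun i => funext fun j => ?_))
  · simp [forcing, outerEq, sum_thrustEq hn]
  · have hu : ∀ i, thrustEq p i + (p.MiT i * p.g) • e3 = (-(p.m0 / n * p.g)) • e3 := by
      intro i; rw [thrustEq]; module
    simp [forcing, outerEq, hu, ← Finset.smul_sum, sum_cross_e3 p hρ]
  · simp [forcing, outerEq, thrustEq]

-- `acc` is differentiable and vanishes at the equilibrium, hence is of first order there.
-- Substituting it for the free accelerations in `resid_isLittleO` preserves the order.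
open Asymptotics Topology in
theorem resid_acc_isLittleO (hn : 0 < n) {p : Params n ν}
    (hρ : (∑ i, p.ρ i) 0 = 0 ∧ (∑ i, p.ρ i) 1 = 0) (hM : IsUnit (linM p).det) :
    (fun w : Outer ν × (Fin n → V3) => resid p w.1.2.2.1 w.1.2.2.2.1 w.1.2.2.2.2.1 w.1.2.2.2.2.2
        (acc p w.1 w.2) w.2) =o[𝓝 (outerEq ν, 0)] fun w => w - (outerEq ν, 0) := by
  have hacc := contDiffAt_acc (k := 1) (p := p) (w := (outerEq ν, 0)) (outerEq_mem_regularSet hM)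
  have h0 := acc_outerEq hn hρ hM
  have hO : (fun w : Outer ν × (Fin n → V3) => acc p w.1 w.2) =O[𝓝 (outerEq ν, 0)]
      fun w => w - (outerEq ν, 0) := by
    have := (hacc.differentiableAt one_ne_zero).isBigO_sub
    simp only [h0, sub_zero] at this
    exact this
  have htend : Filter.Tendsto (fun w : Outer ν × (Fin n → V3) => (w.1, acc p w.1 w.2, w.2))
      (𝓝 (outerEq ν, 0)) (𝓝 (outerEq ν, 0, 0)) := by
    have hc : ContinuousAt (fun w : Outer ν × (Fin n → V3) => (w.1, acc p w.1 w.2, w.2))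
        (outerEq ν, 0) :=
      continuousAt_fst.prodMk (hacc.continuousAt.prodMk continuousAt_snd)
    have := hc.tendsto
    simp only [h0] at this
    exact this
  refine ((resid_isLittleO p).comp_tendsto htend).trans_isBigO ?_
  have h1 : (fun w : Outer ν × (Fin n → V3) => w.1 - outerEq ν) =O[𝓝 (outerEq ν, 0)]
      fun w => w - (outerEq ν, 0) :=
    isBigO_fst_prod' (f' := fun w : Outer ν × (Fin n → V3) => w - (outerEq ν, 0))
  have h2 : (fun w : Outer ν × (Fin n → V3) => w.2) =O[𝓝 (outerEq ν, 0)]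
      fun w => w - (outerEq ν, 0) := by
    have := isBigO_snd_prod' (f' := fun w : Outer ν × (Fin n → V3) => w - (outerEq ν, 0))
      (l := 𝓝 (outerEq ν, 0))
    simp only [Prod.snd_sub, sub_zero] at this
    exact this
  have := h1.prod_left (hO.prod_left h2)
  refine this.congr_left fun w => ?_
  simp

/-! ## The outer loop -/

/-- The position part of the coordinates of the linear design. -/
def posCoord (z : Outer ν) : LinIdx ν → ℝ
  | .inl a => z.1 a
  | .inr (.inl a) => attErr 1 z.2.2.1 a
  | .inr (.inr ⟨i, j, c⟩) => (e3 ⨯₃ z.2.2.2.2.1 i j) c.castSucc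

/-- The velocity part of the coordinates of the linear design. -/
def velCoord (z : Outer ν) : LinIdx ν → ℝ
  | .inl a => z.2.1 a
  | .inr (.inl a) => z.2.2.2.1 a
  | .inr (.inr ⟨i, j, c⟩) => z.2.2.2.2.2 i j c.castSucc

theorem attErr_one_add (A B : Mat3) : attErr 1 (A + B) = attErr 1 A + attErr 1 B := by
  ext i; fin_cases i <;> simp [attErr, vee] <;> ring

theorem attErr_one_smul (c : ℝ) (A : Mat3) : attErr 1 (c • A) = c • attErr 1 A := by
  ext i; fin_cases i <;> simp [attErr, vee] <;> ring

theorem attErr_one_hat (v : V3) : attErr 1 (hat v) = v := by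
  ext i; fin_cases i <;> simp [attErr, vee, hat] <;> ring

theorem posCoord_add (z w : Outer ν) : posCoord (z + w) = posCoord z + posCoord w := by
  funext x
  rcases x with c | c | ⟨i, j, c⟩
  · rfl
  · exact congrFun (attErr_one_add _ _) c
  · exact congrFun (map_add (crossProduct e3) _ _) c.castSucc

theorem posCoord_smul (r : ℝ) (z : Outer ν) : posCoord (r • z) = r • posCoord z := by
  funext x
  rcases x with c | c | ⟨i, j, c⟩
  · rfl
  · exact congrFun (attErr_one_smul _ _) c
  · exact congrFun (map_smul (crossProduct e3) _ _) c.castSucc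

theorem velCoord_add (z w : Outer ν) : velCoord (z + w) = velCoord z + velCoord w := by
  funext x
  rcases x with c | c | ⟨i, j, c⟩ <;> rfl

theorem velCoord_smul (r : ℝ) (z : Outer ν) : velCoord (r • z) = r • velCoord z := by
  funext x
  rcases x with c | c | ⟨i, j, c⟩ <;> rfl

/-- The coordinates of the linear design, as a linear function of the state. -/
def coords (ν : Fin n → ℕ) : Outer ν →L[ℝ] (LinIdx ν ⊕ LinIdx ν → ℝ) :=
  LinearMap.toContinuousLinearMap
    { toFun := fun z => Sum.elim (posCoord z) (velCoord z)
      map_add' := fun z w => by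
        rw [posCoord_add, velCoord_add]
        funext x; rcases x with x | x <;> rfl
      map_smul' := fun r z => by
        rw [posCoord_smul, velCoord_smul]
        funext x; rcases x with x | x <;> rfl }

theorem coords_apply (z : Outer ν) : coords ν z = Sum.elim (posCoord z) (velCoord z) := rfl

/-- The linear feedback `δuᵢ`. -/
def feedback (Kx Kv : Matrix (Fin n × Fin 3) (LinIdx ν) ℝ) : Outer ν →L[ℝ] (Fin n → V3) :=
  LinearMap.toContinuousLinearMap
    { toFun := fun z i a => -(Kx *ᵥ posCoord z) (i, a) - (Kv *ᵥ velCoord z) (i, a)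
      map_add' := fun z w => by
        funext i a
        simp only [posCoord_add, velCoord_add, Matrix.mulVec_add, Pi.add_apply]
        ring
      map_smul' := fun r z => by
        funext i a
        simp only [posCoord_smul, velCoord_smul, Matrix.mulVec_smul, Pi.smul_apply, smul_eq_mul,
          RingHom.id_apply]
        ring }

theorem feedback_apply (Kx Kv : Matrix (Fin n × Fin 3) (LinIdx ν) ℝ) (z : Outer ν) (i : Fin n)
    (a : Fin 3) : feedback Kx Kv z i a =
      -(Kx *ᵥ posCoord z) (i, a) - (Kv *ᵥ velCoord z) (i, a) := rfl

theorem posCoord_outerEq : posCoord (outerEq ν) = 0 := by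
  funext x
  rcases x with c | c | ⟨i, j, c⟩
  · rfl
  · exact congrFun attErr_one_one c
  · exact congrFun (cross_self e3) c.castSucc

theorem velCoord_outerEq : velCoord (outerEq ν) = 0 := by
  funext x
  rcases x with c | c | ⟨i, j, c⟩ <;> rfl

theorem coords_outerEq : coords ν (outerEq ν) = 0 := by
  rw [coords_apply, posCoord_outerEq, velCoord_outerEq]
  funext x; rcases x with x | x <;> rfl

theorem feedback_outerEq (Kx Kv : Matrix (Fin n × Fin 3) (LinIdx ν) ℝ) :
    feedback Kx Kv (outerEq ν) = 0 := by
  funext i a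
  simp [feedback_apply, posCoord_outerEq, velCoord_outerEq]

/-- The derivative of the state for thrust vectors `u* + d`. -/
def outerField (p : Params n ν) (z : Outer ν) (d : Fin n → V3) : Outer ν :=
  (z.2.1, (acc p z d).1, z.2.2.1 * hat z.2.2.2.1, (acc p z d).2.1,
    fun i j => z.2.2.2.2.2 i j ⨯₃ z.2.2.2.2.1 i j, (acc p z d).2.2)

theorem contDiffAt_outerField {k : WithTop ℕ∞} {p : Params n ν} {w : Outer ν × (Fin n → V3)}
    (hz : w.1 ∈ regularSet p) : ContDiffAt ℝ k (fun w => outerField p w.1 w.2) w := by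
  have h := contDiffAt_acc (k := k) hz
  unfold outerField
  refine ContDiffAt.prodMk (by fun_prop) (ContDiffAt.prodMk (by fun_prop) (ContDiffAt.prodMk
    (by fun_prop) (ContDiffAt.prodMk (by fun_prop) (ContDiffAt.prodMk ?_ (by fun_prop)))))
  rw [contDiffAt_pi]
  intro i
  rw [contDiffAt_pi]
  intro j
  fun_prop

theorem velCoord_outerField (p : Params n ν) (z : Outer ν) (d : Fin n → V3) :
    velCoord (outerField p z d) = perp (acc p z d) := by
  funext x
  rcases x with c | c | ⟨i, j, c⟩ <;> rfl

/-- The terms of second order in the kinematic equations. -/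
def kinResid (z : Outer ν) : LinIdx ν → ℝ
  | .inl _ => 0
  | .inr (.inl a) => attErr 1 ((z.2.2.1 - 1) * hat z.2.2.2.1) a
  | .inr (.inr ⟨i, j, c⟩) =>
      (e3 ⨯₃ (z.2.2.2.2.2 i j ⨯₃ (z.2.2.2.2.1 i j - e3))) c.castSucc

/-- The position coordinates are affine in the state, so writing `R0 = 1 + (R0 - 1)` and `q = e3 +
(q - e3)` in the kinematic equations separates the linear part exactly. -/
theorem posCoord_outerField (p : Params n ν) (z : Outer ν) (d : Fin n → V3) :
    posCoord (outerField p z d) = velCoord z + kinResid z := by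
  funext x
  rcases x with c | c | ⟨i, j, c⟩
  · exact (add_zero _).symm
  · simp only [posCoord, outerField, velCoord, kinResid, Pi.add_apply, sub_mul, one_mul,
      attErr_one_sub, attErr_one_hat, Pi.sub_apply]
    ring
  · have h3 : ∀ (y : V3) (c : Fin 2), (e3 ⨯₃ (y ⨯₃ e3)) c.castSucc = y c.castSucc := fun y c => by
      fin_cases c <;> simp [e3, cross_apply]
    simp only [posCoord, outerField, velCoord, kinResid, Pi.add_apply, map_sub, Pi.sub_apply, h3]
    ring

open Asymptotics Topology in
theorem kinResid_isLittleO :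
    (kinResid : Outer ν → LinIdx ν → ℝ) =o[𝓝 (outerEq ν)] fun z => z - outerEq ν := by
  refine isLittleO_pi.2 fun x => ?_
  rcases x with c | c | ⟨i, j, c⟩
  · exact isLittleO_zero _ _
  · have h : (fun z : Outer ν => (z.2.2.1 - 1) * hat z.2.2.2.1) =o[𝓝 (outerEq ν)]
        fun z => z - outerEq ν :=
      isLittleO_of_norm_le_mul (f := fun z : Outer ν => z.2.2.1 - 1)
        (g := fun z : Outer ν => hat z.2.2.2.1) 3
        (isLittleO_one_of_contDiff (by fun_prop) (sub_self _))
        (isBigO_of_contDiff (by fun_prop) (by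
          ext a b; fin_cases a <;> fin_cases b <;> simp [outerEq, hat])) fun _ => norm_matMul_le _ _
    refine IsBigO.trans_isLittleO (IsBigO.of_bound 1 (Filter.Eventually.of_forall fun z => ?_)) h
    rw [one_mul]
    exact (norm_le_pi_norm _ c).trans (norm_attErr_one_le _)
  · refine (isLittleO_pi.1 (isLittleO_cross_left (f := fun _ => e3) contDiff_const
      (isLittleO_cross (f := fun z : Outer ν => z.2.2.2.2.2 i j)
      (g := fun z : Outer ν => z.2.2.2.2.1 i j - e3)
        (by fun_prop) (by fun_prop) rfl (sub_self _)))) c.castSucc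

theorem perp_norm_le (a : AccV ν) : ‖perp a‖ ≤ ‖a‖ := by
  rw [pi_norm_le_iff_of_nonneg (norm_nonneg _)]
  intro x
  rcases x with c | c | ⟨i, j, c⟩
  · exact (norm_le_pi_norm a.1 c).trans (norm_fst_le a)
  · exact (norm_le_pi_norm a.2.1 c).trans ((norm_fst_le a.2).trans (norm_snd_le a))
  · exact (norm_le_pi_norm (a.2.2 i j) c.castSucc).trans ((norm_le_pi_norm (a.2.2 i) j).trans
      ((norm_le_pi_norm a.2.2 i).trans ((norm_snd_le a.2).trans (norm_snd_le a))))

theorem exists_norm_mulVec_le {ι κ : Type*} [Fintype ι] [Fintype κ] (A : Matrix ι κ ℝ) :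
    ∃ C : ℝ, 0 ≤ C ∧ ∀ v, ‖A *ᵥ v‖ ≤ C * ‖v‖ := by
  refine ⟨‖LinearMap.toContinuousLinearMap (Matrix.mulVecLin A)‖, norm_nonneg _, fun v => ?_⟩
  exact ContinuousLinearMap.le_opNorm (LinearMap.toContinuousLinearMap (Matrix.mulVecLin A)) v

/-- The outer loop agrees with the linear closed loop up to the disturbance `δ` of the thrusts and
terms of second order. -/
theorem coords_outerField_sub (hn : 0 < n) {p : Params n ν}
    (hρ : (∑ i, p.ρ i) 0 = 0 ∧ (∑ i, p.ρ i) 1 = 0) (hM : IsUnit (linM p).det)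
    (Kx Kv : Matrix (Fin n × Fin 3) (LinIdx ν) ℝ) {z : Outer ν} (hz : z ∈ regularSet p)
    (hR : z.2.2.1 ∈ SO3) (δ : Fin n → V3) :
    coords ν (outerField p z (feedback Kx Kv z + δ)) - linClosedLoop p Kx Kv *ᵥ coords ν z =
      Sum.elim (kinResid z) (((linM p)⁻¹ * linB p) *ᵥ (fun ic => δ ic.1 ic.2) + (linM p)⁻¹ *ᵥ
        perp (resid p z.2.2.1 z.2.2.2.1 z.2.2.2.2.1 z.2.2.2.2.2
          (acc p z (feedback Kx Kv z + δ)) (feedback Kx Kv z + δ))) := by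
  set d := feedback Kx Kv z + δ with hd
  have h := linM_mulVec_perp_of_massOp_eq hn hρ hR (y := posCoord z) (fun _ => rfl)
    (fun _ _ _ => rfl) ((acc_eq_iff hz (d := d)).mp rfl)
  have hd' : (fun ic : Fin n × Fin 3 => d ic.1 ic.2) =
      -(Kx *ᵥ posCoord z) - Kv *ᵥ velCoord z + fun ic => δ ic.1 ic.2 := by
    funext ic
    simp [hd, feedback_apply]
  rw [hd'] at h
  have h' := congrArg (fun v => (linM p)⁻¹ *ᵥ v) h
  simp only [Matrix.mulVec_add, Matrix.mulVec_sub, Matrix.mulVec_neg, Matrix.mulVec_mulVec,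
    Matrix.nonsing_inv_mul _ hM, Matrix.one_mulVec] at h'
  rw [coords_apply, coords_apply, posCoord_outerField, velCoord_outerField, linClosedLoop,
    Matrix.fromBlocks_mulVec]
  funext x
  rcases x with x | x
  · simp
  · have h'' := congrFun h' x
    simp only [Matrix.mul_add, Matrix.neg_mulVec, Matrix.add_mulVec, Pi.sub_apply, Pi.add_apply,
      Pi.neg_apply, Sum.elim_inr, Sum.elim_comp_inl, Sum.elim_comp_inr] at h'' ⊢
    linarith

-- The constant `C` is fixed before `ε`. The quadratic remainder can thus be made as small as the
-- decay rate of the linear design requires without increasing the weight of the disturbance.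
open Asymptotics Topology in
theorem exists_outerField_estimate (hn : 0 < n) {p : Params n ν}
    (hρ : (∑ i, p.ρ i) 0 = 0 ∧ (∑ i, p.ρ i) 1 = 0) (hM : IsUnit (linM p).det)
    (Kx Kv : Matrix (Fin n × Fin 3) (LinIdx ν) ℝ) :
    ∃ C : ℝ, 0 ≤ C ∧ ∀ ε > 0, ε ≤ 1 → ∀ᶠ w : Outer ν × (Fin n → V3) in 𝓝 (outerEq ν, 0),
      w.1.2.2.1 ∈ SO3 → ‖coords ν (outerField p w.1 (feedback Kx Kv w.1 + w.2)) -
        linClosedLoop p Kx Kv *ᵥ coords ν w.1‖ ≤ ε * ‖w.1 - outerEq ν‖ + C * ‖w.2‖ := by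
  obtain ⟨C₁, hC₁, h₁⟩ := exists_norm_mulVec_le ((linM p)⁻¹ * linB p)
  obtain ⟨C₂, hC₂, h₂⟩ := exists_norm_mulVec_le (linM p)⁻¹
  -- `C₁` accounts for the direct effect of the disturbance. The `+ 1` covers its share `ε ‖δ‖ ≤
  -- ‖δ‖` in the second-order terms.
  refine ⟨C₁ + 1, by positivity, fun ε hε hε1 => ?_⟩
  have hc : ContDiff ℝ 1 fun w : Outer ν × (Fin n → V3) => (w.1, feedback Kx Kv w.1 + w.2) :=
    ContDiff.prodMk contDiff_fst (by fun_prop)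
  have hres := (resid_acc_isLittleO hn hρ hM).comp_tendsto
    (show Filter.Tendsto (fun w : Outer ν × (Fin n → V3) => (w.1, feedback Kx Kv w.1 + w.2))
      (𝓝 (outerEq ν, 0)) (𝓝 (outerEq ν, 0)) by
        have := (hc.continuous.continuousAt (x := (outerEq ν, 0))).tendsto
        simp only [feedback_outerEq, add_zero] at this
        exact this)
  have hO := (hc.differentiable one_ne_zero (outerEq ν, 0)).isBigO_sub
  simp only [feedback_outerEq, add_zero] at hO
  have hres := hres.trans_isBigO hO
  have hreg : ∀ᶠ w : Outer ν × (Fin n → V3) in 𝓝 (outerEq ν, 0), w.1 ∈ regularSet p :=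
    continuousAt_fst.eventually_mem
      ((isOpen_regularSet p).mem_nhds (outerEq_mem_regularSet hM))
  have hkin : ∀ᶠ w : Outer ν × (Fin n → V3) in 𝓝 (outerEq ν, 0),
      ‖kinResid w.1‖ ≤ ε * ‖w.1 - outerEq ν‖ :=
    (continuousAt_fst (p := ((outerEq ν, 0) : Outer ν × (Fin n → V3)))).eventually
      (kinResid_isLittleO.def hε)
  -- Dividing by `C₂ + 1` compensates for the factor `M⁻¹` in front of the residual.
  filter_upwards [hreg, hkin, hres.def (show 0 < ε / (C₂ + 1) by positivity)] with w hw1 hw2 hw3 hR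
  rw [coords_outerField_sub hn hρ hM Kx Kv hw1 hR]
  have hw : ‖w - (outerEq ν, 0)‖ ≤ ‖w.1 - outerEq ν‖ + ‖w.2‖ := by
    rw [Prod.norm_def]
    refine max_le ?_ ?_
    · exact le_add_of_nonneg_right (norm_nonneg _)
    · simp
  have hδ : ‖fun ic : Fin n × Fin 3 => w.2 ic.1 ic.2‖ ≤ ‖w.2‖ := by
    rw [pi_norm_le_iff_of_nonneg (norm_nonneg _)]
    exact fun ic => (norm_le_pi_norm (w.2 ic.1) ic.2).trans (norm_le_pi_norm w.2 ic.1)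
  have hpos : 0 ≤ (C₁ + 1) * ‖w.2‖ := by positivity
  have hpos' : 0 ≤ ε * ‖w.1 - outerEq ν‖ := by positivity
  rw [pi_norm_le_iff_of_nonneg (by positivity)]
  rintro (x | x)
  · exact (norm_le_pi_norm (kinResid w.1) x).trans (hw2.trans (le_add_of_nonneg_right hpos))
  · refine (norm_le_pi_norm (_ + _ : LinIdx ν → ℝ) x).trans ((norm_add_le _ _).trans ?_)
    have h3 := (h₂ _).trans (mul_le_mul_of_nonneg_left ((perp_norm_le _).trans hw3) hC₂)
    have h4 := (h₁ _).trans (mul_le_mul_of_nonneg_left hδ hC₁)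
    have h5 : C₂ * (ε / (C₂ + 1) * ‖w - (outerEq ν, 0)‖) ≤
        ε * (‖w.1 - outerEq ν‖ + ‖w.2‖) := by
      have : C₂ * (ε / (C₂ + 1)) ≤ ε := by
        rw [mul_div_assoc', div_le_iff₀ (by positivity)]
        nlinarith
      rw [← mul_assoc]
      exact mul_le_mul this hw (norm_nonneg _) hε.le
    have h6 : ε * ‖w.2‖ ≤ ‖w.2‖ := mul_le_of_le_one_left (norm_nonneg _) hε1
    simp only [Function.comp] at h3
    linarith

/-- `R₀ ∈ SO(3)`, `q_{ij} ∈ S²` and `q_{ij} · ω_{ij} = 0`. -/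
structure OuterAdm (z : Outer ν) : Prop where
  R0_mem : z.2.2.1 ∈ SO3
  q_unit : ∀ i j, z.2.2.2.2.1 i j ⬝ᵥ z.2.2.2.2.1 i j = 1
  q_ω : ∀ i j, z.2.2.2.2.1 i j ⬝ᵥ z.2.2.2.2.2 i j = 0

/-- On this hemisphere the first two components determine a unit vector: `1 - q₂ ≤ 1 - q₂² = q₀² +
q₁² ≤ |q₀| + |q₁|`. -/
theorem norm_sub_e3_le {q : V3} (hq : q ⬝ᵥ q = 1) (h2 : 1 / 2 ≤ q 2) {m : ℝ} (h0 : |q 0| ≤ m)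
    (h1 : |q 1| ≤ m) : ‖q - e3‖ ≤ 2 * m := by
  have hm : 0 ≤ m := (abs_nonneg _).trans h0
  simp only [dotProduct, Fin.sum_univ_three] at hq
  have hq2 : q 2 ≤ 1 := by nlinarith [mul_self_nonneg (q 0), mul_self_nonneg (q 1)]
  have a0 : q 0 * q 0 ≤ |q 0| := by
    rw [← abs_mul_abs_self]
    exact mul_le_of_le_one_left (abs_nonneg _) (by
      rw [← sq_le_one_iff_abs_le_one]; nlinarith [mul_self_nonneg (q 1), mul_self_nonneg (q 2)])
  have a1 : q 1 * q 1 ≤ |q 1| := by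
    rw [← abs_mul_abs_self]
    exact mul_le_of_le_one_left (abs_nonneg _) (by
      rw [← sq_le_one_iff_abs_le_one]; nlinarith [mul_self_nonneg (q 0), mul_self_nonneg (q 2)])
  rw [pi_norm_le_iff_of_nonneg (by positivity)]
  intro i
  fin_cases i
  · simpa [e3] using h0.trans (by linarith)
  · simpa [e3] using h1.trans (by linarith)
  · simp only [Fin.reduceFinMk, Pi.sub_apply, e3, Matrix.cons_val, Real.norm_eq_abs]
    rw [abs_sub_comm, abs_of_nonneg (by linarith)]
    nlinarith

/-- Orthogonality gives `q₂ w₂ = -q₀ w₀ - q₁ w₁`, where `q₂ ≥ 1/2`. -/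
theorem norm_le_of_dot_eq_zero {q w : V3} (hq : q ⬝ᵥ q = 1) (h : q ⬝ᵥ w = 0) (h2 : 1 / 2 ≤ q 2)
    {m : ℝ} (h0 : |w 0| ≤ m) (h1 : |w 1| ≤ m) : ‖w‖ ≤ 4 * m := by
  have hm : 0 ≤ m := (abs_nonneg _).trans h0
  simp only [dotProduct, Fin.sum_univ_three] at hq h
  have a0 : |q 0| ≤ 1 := by
    rw [← sq_le_one_iff_abs_le_one]; nlinarith [mul_self_nonneg (q 1), mul_self_nonneg (q 2)]
  have a1 : |q 1| ≤ 1 := by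
    rw [← sq_le_one_iff_abs_le_one]; nlinarith [mul_self_nonneg (q 0), mul_self_nonneg (q 2)]
  have b : |q 2 * w 2| ≤ m + m := by
    rw [show q 2 * w 2 = -(q 0 * w 0) - q 1 * w 1 by linarith]
    refine (abs_sub _ _).trans ?_
    rw [abs_neg, abs_mul, abs_mul]
    have := mul_le_mul a0 h0 (abs_nonneg _) zero_le_one
    have := mul_le_mul a1 h1 (abs_nonneg _) zero_le_one
    linarith
  rw [abs_mul, abs_of_nonneg (by linarith)] at b
  have b' : |w 2| ≤ 4 * m := by
    have := mul_le_mul_of_nonneg_right h2 (abs_nonneg (w 2))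
    linarith
  rw [pi_norm_le_iff_of_nonneg (by positivity)]
  intro i
  fin_cases i
  · exact h0.trans (by linarith)
  · exact h1.trans (by linarith)
  · exact b'

theorem half_le_of_norm_sub_e3_le {q : V3} (h : ‖q - e3‖ ≤ 1 / 2) : 1 / 2 ≤ q 2 := by
  have := (norm_le_pi_norm (q - e3) 2).trans h
  simp only [Pi.sub_apply, e3, Matrix.cons_val, Real.norm_eq_abs] at this
  linarith [(abs_le.mp this).1]

theorem SO3.attPsi_lt_one {Q : Mat3} (hQ : Q ∈ SO3) (h : ‖Q - 1‖ ≤ 1 / 2) : attPsi 1 Q < 1 := by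
  have := SO3.attPsi_le hQ
  nlinarith [norm_nonneg (Q - 1)]

theorem SO3.norm_sub_one_le_attErr {Q : Mat3} (hQ : Q ∈ SO3) (h : attPsi 1 Q < 1) :
    ‖Q - 1‖ ≤ 4 * ‖attErr 1 Q‖ := by
  have := SO3.norm_sub_one_sq_le_attErr hQ h
  refine le_of_sq_le_sq ?_ (by positivity)
  nlinarith [sq_nonneg ‖attErr 1 Q‖]

/-- The linear coordinates omit the symmetric part of `R0` and the third components of `q` and `ω`.
Close to the equilibrium these are controlled by the constraints, so the coordinates measure the
full distance. -/
theorem OuterAdm.norm_sub_le_coords {z : Outer ν} (hz : OuterAdm z) (h : ‖z - outerEq ν‖ ≤ 1 / 2) :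
    ‖z - outerEq ν‖ ≤ 4 * ‖coords ν z‖ := by
  have hR : ‖z.2.2.1 - 1‖ ≤ 1 / 2 :=
    (norm_fst_le (z - outerEq ν).2.2).trans ((norm_snd_le (z - outerEq ν).2).trans
      ((norm_snd_le (z - outerEq ν)).trans h))
  have hq : ∀ i j, 1 / 2 ≤ z.2.2.2.2.1 i j 2 := fun i j => half_le_of_norm_sub_e3_le <|
    (norm_le_pi_norm ((z - outerEq ν).2.2.2.2.1 i) j).trans <|
    (norm_le_pi_norm (z - outerEq ν).2.2.2.2.1 i).trans <|
    (norm_fst_le (z - outerEq ν).2.2.2.2).trans <| (norm_snd_le (z - outerEq ν).2.2.2).trans <|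
    (norm_snd_le (z - outerEq ν).2.2).trans <| (norm_snd_le (z - outerEq ν).2).trans <|
    (norm_snd_le (z - outerEq ν)).trans h
  set m := ‖coords ν z‖ with hm
  have hc : ∀ x, |coords ν z x| ≤ m := norm_le_pi_norm (coords ν z)
  have hm0 : 0 ≤ m := norm_nonneg _
  have hv : ∀ v : V3, (∀ a, |v a| ≤ m) → ‖v‖ ≤ 4 * m := fun v hv =>
    ((pi_norm_le_iff_of_nonneg hm0).mpr hv).trans (by linarith)
  have h4 : 0 ≤ 4 * m := by positivity
  refine max_le ?_ (max_le ?_ (max_le ?_ (max_le ?_ (max_le ?_ ?_))))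
  · exact hv _ fun a => by simpa [outerEq, coords_apply, posCoord, velCoord] using hc (.inl (.inl a))
  · exact hv _ fun a => by simpa [outerEq, coords_apply, posCoord, velCoord] using hc (.inr (.inl a))
  · refine (SO3.norm_sub_one_le_attErr hz.R0_mem (SO3.attPsi_lt_one hz.R0_mem hR)).trans ?_
    have : ‖attErr 1 z.2.2.1‖ ≤ m :=
      (pi_norm_le_iff_of_nonneg hm0).mpr fun a => hc (.inl (.inr (.inl a)))
    linarith
  · exact hv _ fun a => by simpa [outerEq, coords_apply, posCoord, velCoord] using hc (.inr (.inr (.inl a)))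
  · refine (pi_norm_le_iff_of_nonneg h4).mpr fun i => (pi_norm_le_iff_of_nonneg h4).mpr fun j => ?_
    -- Since `e3 × q = (-q₁, q₀, 0)`, the second coordinate carries `q₀` and the first one `q₁`.
    have h0 := hc (.inl (.inr (.inr ⟨i, j, 1⟩)))
    have h1 := hc (.inl (.inr (.inr ⟨i, j, 0⟩)))
    simp only [coords_apply, Sum.elim_inl, posCoord, e3, cross_apply, Fin.castSucc_one,
      Fin.castSucc_zero, Matrix.cons_val, zero_mul, zero_sub, one_mul, sub_zero, abs_neg] at h0 h1
    exact (norm_sub_e3_le (hz.q_unit i j) (hq i j) h0 h1).trans (by linarith)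
  · refine (pi_norm_le_iff_of_nonneg h4).mpr fun i => (pi_norm_le_iff_of_nonneg h4).mpr fun j => ?_
    have h0 := hc (.inr (.inr (.inr ⟨i, j, 0⟩)))
    have h1 := hc (.inr (.inr (.inr ⟨i, j, 1⟩)))
    have := norm_le_of_dot_eq_zero (hz.q_unit i j) (hz.q_ω i j) (hq i j) h0 h1
    simpa [outerEq] using this

theorem exists_norm_coords_le (ν : Fin n → ℕ) :
    ∃ C : ℝ, 0 ≤ C ∧ ∀ z, ‖coords ν z‖ ≤ C * ‖z - outerEq ν‖ := by
  obtain ⟨C, hC, h⟩ := SemilinearMapClass.bound_of_continuous (coords ν).toLinearMap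
    (coords ν).continuous
  refine ⟨C, hC.le, fun z => ?_⟩
  have := h (z - outerEq ν)
  rwa [map_sub, ContinuousLinearMap.coe_coe, coords_outerEq, sub_zero] at this

/-! ## The desired attitude -/

theorem vnorm_pos {v : V3} (h : v ≠ 0) : 0 < vnorm v :=
  (norm_pos_iff.mpr h).trans_le (norm_le_vnorm v)

theorem vnorm_mul_self (v : V3) : vnorm v * vnorm v = v ⬝ᵥ v := by rw [← sq_vnorm, sq]

theorem unit_dot_unit {v : V3} (h : v ≠ 0) : unit v ⬝ᵥ unit v = 1 := by
  have := (vnorm_pos h).ne'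
  rw [unit, dotProduct_smul, smul_dotProduct, smul_eq_mul, smul_eq_mul, ← vnorm_mul_self]
  field_simp

theorem axis3_dot_axis3 {A : V3} (h : A ≠ 0) : axis3 A ⬝ᵥ axis3 A = 1 := by
  rw [axis3, neg_dotProduct, dotProduct_neg, neg_neg, unit_dot_unit h]

theorem axis3_cross (A b : V3) : axis3 A ⨯₃ b = -(vnorm A)⁻¹ • (A ⨯₃ b) := by
  rw [axis3, unit, ← neg_smul, map_smul, LinearMap.smul_apply]

/-- Both conditions for the controller to be defined, `A ≠ 0` and `b₃ × b₁ ≠ 0`, become one open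
condition without normalization. -/
theorem cross_ne_zero_iff {A b : V3} : A ⨯₃ b ≠ 0 ↔ A ≠ 0 ∧ axis3 A ⨯₃ b ≠ 0 := by
  rw [axis3_cross]
  constructor
  · intro h
    have hA : A ≠ 0 := by
      rintro rfl
      exact h (by rw [map_zero, LinearMap.zero_apply])
    exact ⟨hA, smul_ne_zero (neg_ne_zero.mpr (inv_ne_zero (vnorm_pos hA).ne')) h⟩
  · rintro ⟨-, h⟩ h0
    exact h (by rw [h0, smul_zero])

theorem SO3.of_cross {c₂ c₃ : V3} (h₂ : c₂ ⬝ᵥ c₂ = 1) (h₃ : c₃ ⬝ᵥ c₃ = 1) (h : c₂ ⬝ᵥ c₃ = 0) :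
    (Matrix.of ![c₂ ⨯₃ c₃, c₂, c₃])ᵀ ∈ SO3 := by
  have h' : c₃ ⬝ᵥ c₂ = 0 := by rw [dotProduct_comm, h]
  have hc : (c₂ ⨯₃ c₃) ⬝ᵥ (c₂ ⨯₃ c₃) = 1 := by
    rw [cross_dot_cross, h₂, h₃, h, zero_mul, sub_zero, mul_one]
  refine SO3.transpose_mem (SO3.mk ?_ ?_)
  · ext a b
    change (![c₂ ⨯₃ c₃, c₂, c₃] : Fin 3 → V3) a ⬝ᵥ (![c₂ ⨯₃ c₃, c₂, c₃] : Fin 3 → V3) b = _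
    fin_cases a <;> fin_cases b <;> simp [h₂, h₃, h, h', hc, dotProduct_comm (c₂ ⨯₃ c₃)]
  · exact (triple_product_eq_det _ _ _).symm.trans hc

/-- Since `b₃` is a unit vector orthogonal to `b₃ × b₁`, the first column has the same normalization
as the second and equals their cross product. This exhibits a right-handed orthonormal frame. -/
theorem desiredAttitude_eq {A b : V3} (h : A ⨯₃ b ≠ 0) : desiredAttitude A b =
    (Matrix.of ![unit (axis3 A ⨯₃ b) ⨯₃ axis3 A, unit (axis3 A ⨯₃ b), axis3 A])ᵀ := by
  obtain ⟨hA, h⟩ := cross_ne_zero_iff.mp h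
  have hn : vnorm (axis3 A ⨯₃ (axis3 A ⨯₃ b)) = vnorm (axis3 A ⨯₃ b) := by
    rw [vnorm, vnorm, cross_dot_cross, axis3_dot_axis3 hA, dot_self_cross]
    simp
  have : -unit (axis3 A ⨯₃ (axis3 A ⨯₃ b)) = unit (axis3 A ⨯₃ b) ⨯₃ axis3 A := by
    rw [unit, unit, hn, map_smul, LinearMap.smul_apply,
      ← cross_anticomm (axis3 A) (axis3 A ⨯₃ b), smul_neg]
  rw [desiredAttitude, this]

theorem desiredAttitude_mem_SO3 {A b : V3} (h : A ⨯₃ b ≠ 0) : desiredAttitude A b ∈ SO3 := by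
  rw [desiredAttitude_eq h]
  obtain ⟨hA, h⟩ := cross_ne_zero_iff.mp h
  refine SO3.of_cross (unit_dot_unit h) (axis3_dot_axis3 hA) ?_
  rw [unit, smul_dotProduct, dotProduct_comm, dot_self_cross, smul_zero]

theorem desiredAttitude_mulVec_e3 (A b : V3) : desiredAttitude A b *ᵥ e3 = axis3 A := by
  ext i
  simp [desiredAttitude, e3, Matrix.mulVec, dotProduct, Fin.sum_univ_three]

theorem eq_neg_vnorm_smul_axis3 {A : V3} (h : A ≠ 0) : A = -vnorm A • axis3 A := by
  rw [axis3, unit, smul_neg, neg_smul, neg_neg, smul_smul, mul_inv_cancel₀ (vnorm_pos h).ne',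
    one_smul]

section Smooth

variable {E : Type*} [NormedAddCommGroup E] [NormedSpace ℝ E] {k : WithTop ℕ∞} {x : E}

theorem contDiffAt_unit {f : E → V3} (hf : ContDiffAt ℝ k f x) (h : f x ≠ 0) :
    ContDiffAt ℝ k (fun y => unit (f y)) x := by
  have h1 : ContDiffAt ℝ k (fun y => vnorm (f y)) x :=
    (ContDiffAt.dotV3 hf hf).sqrt (by rw [← sq_vnorm]; exact (pow_pos (vnorm_pos h) 2).ne')
  exact (h1.inv (vnorm_pos h).ne').smul hf

theorem contDiffAt_desiredAttitude {f g : E → V3} (hf : ContDiffAt ℝ k f x)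
    (hg : ContDiffAt ℝ k g x) (h : f x ⨯₃ g x ≠ 0) :
    ContDiffAt ℝ k (fun y => desiredAttitude (f y) (g y)) x := by
  obtain ⟨hA, hw⟩ := cross_ne_zero_iff.mp h
  have h3 : ContDiffAt ℝ k (fun y => axis3 (f y)) x := (contDiffAt_unit hf hA).neg
  have h2 := ContDiffAt.cross h3 hg
  have hw' : axis3 (f x) ⨯₃ (axis3 (f x) ⨯₃ g x) ≠ 0 := fun h0 => by
    rw [cross_cross_eq_zero_iff (axis3_dot_axis3 hA)] at h0
    exact hw h0
  have h1 := (contDiffAt_unit (ContDiffAt.cross h3 h2) hw').neg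
  have h2 := contDiffAt_unit h2 hw
  rw [contDiffAt_mat]
  intro a b
  rw [contDiffAt_pi] at h1 h2 h3
  fin_cases b
  · exact h1 a
  · exact h2 a
  · exact h3 a

end Smooth

/-- The desired attitude as a function into a normed space. -/
def desiredAttitudeFun (w : V3 × V3) : Fin 3 → Fin 3 → ℝ := desiredAttitude w.1 w.2

theorem contDiffAt_desiredAttitudeFun {k : WithTop ℕ∞} {w : V3 × V3} (h : w.1 ⨯₃ w.2 ≠ 0) :
    ContDiffAt ℝ k desiredAttitudeFun w :=
  contDiffAt_desiredAttitude contDiffAt_fst contDiffAt_snd h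

/-! ## The closed loop as an ordinary differential equation -/

/-- Values of the state of payload and links, of `Rcᵢᵀ Rᵢ` and of `e_{Ωᵢ}`. -/
abbrev Full (ν : Fin n → ℕ) := Outer ν × (Fin n → Mat3) × (Fin n → V3)

/-- Values of `b₁` and its derivative. -/
abbrev Ref (n : ℕ) := (Fin n → V3) × (Fin n → V3)

/-- The equilibrium of zero tracking errors. -/
def fullEq (ν : Fin n → ℕ) : Full ν := (outerEq ν, fun _ => 1, 0)

variable (p : Params n ν) (Kx Kv : Matrix (Fin n × Fin 3) (LinIdx ν) ℝ)

/-- The ideal thrust of the `i`-th quadrotor. -/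
def thrust (z : Outer ν) (i : Fin n) : V3 := thrustEq p i + feedback Kx Kv z i

/-- The desired attitude of the `i`-th quadrotor. -/
def cmdAtt (b : Fin n → V3) (z : Outer ν) (i : Fin n) : Mat3 :=
  desiredAttitude (thrust p Kx Kv z i) (b i)

/-- The direction of the actual thrust of the `i`-th quadrotor. -/
def thrustDir (b : Fin n → V3) (Z : Full ν) (i : Fin n) : V3 :=
  (cmdAtt p Kx Kv b Z.1 i * Z.2.1 i) *ᵥ e3

/-- The difference between the actual and the ideal thrust. -/
def thrustDev (b : Fin n → V3) (Z : Full ν) (i : Fin n) : V3 :=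
  (thrust p Kx Kv Z.1 i ⬝ᵥ thrustDir p Kx Kv b Z i) • thrustDir p Kx Kv b Z i
    - thrust p Kx Kv Z.1 i

/-- The derivative of the state of payload and links in the closed loop. -/
def outerClosed (x : Ref n × Full ν) : Outer ν :=
  outerField p x.2.1 (feedback Kx Kv x.2.1 + thrustDev p Kx Kv x.1.1 x.2)

/-- The derivative of the desired attitude. -/
def cmdAttDeriv (x : Ref n × Full ν) (i : Fin n) : Mat3 :=
  Matrix.of (fderiv ℝ desiredAttitudeFun (thrust p Kx Kv x.2.1 i, x.1.1 i)
    (feedback Kx Kv (outerClosed p Kx Kv x) i, x.1.2 i))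

/-- The desired angular velocity. -/
def cmdAngVel (x : Ref n × Full ν) (i : Fin n) : V3 :=
  vee ((cmdAtt p Kx Kv x.1.1 x.2.1 i)ᵀ * cmdAttDeriv p Kx Kv x i)

/-- The vector field of the closed loop. -/
def closedField (kR kΩ : ℝ) (x : Ref n × Full ν) : Full ν :=
  (outerClosed p Kx Kv x, fun i => x.2.2.1 i * hat (x.2.2.2 i),
    fun i => (p.J i)⁻¹ *ᵥ attRhs kR kΩ (p.J i) (x.2.2.1 i)
      ((x.2.2.1 i)ᵀ *ᵥ cmdAngVel p Kx Kv x i) (x.2.2.2 i))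

/-- The set on which the closed loop is defined. -/
def closedDomain : Set (Ref n × Full ν) :=
  {x | x.2.1 ∈ regularSet p ∧ ∀ i, thrust p Kx Kv x.2.1 i ⨯₃ x.1.1 i ≠ 0}

variable {p Kx Kv}

theorem contDiff_thrust {k : WithTop ℕ∞} (i : Fin n) :
    ContDiff ℝ k fun z : Outer ν => thrust p Kx Kv z i := by
  unfold thrust
  fun_prop

theorem isOpen_closedDomain : IsOpen (closedDomain p Kx Kv) := by
  refine IsOpen.inter ?_ ?_
  · exact (isOpen_regularSet p).preimage (continuous_fst.comp continuous_snd)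
  · change IsOpen {x : Ref n × Full ν | ∀ i, thrust p Kx Kv x.2.1 i ⨯₃ x.1.1 i ≠ 0}
    rw [Set.ofPred_forall]
    refine isOpen_iInter_of_finite fun i => ?_
    have h : ContDiff ℝ 0 fun x : Ref n × Full ν => thrust p Kx Kv x.2.1 i ⨯₃ x.1.1 i :=
      ContDiff.cross ((contDiff_thrust i).comp (contDiff_fst.comp contDiff_snd)) (by fun_prop)
    exact isOpen_ne_fun h.continuous continuous_const

/-! ### Smoothness of the closed-loop vector field. -/

section

variable {k : WithTop ℕ∞} {x : Ref n × Full ν}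

theorem contDiffAt_thrust (i : Fin n) :
    ContDiffAt ℝ k (fun y : Ref n × Full ν => thrust p Kx Kv y.2.1 i) x :=
  ((contDiff_thrust i).comp (contDiff_fst.comp contDiff_snd)).contDiffAt

theorem contDiffAt_cmdAtt (hx : x ∈ closedDomain p Kx Kv) (i : Fin n) :
    ContDiffAt ℝ k (fun y : Ref n × Full ν => cmdAtt p Kx Kv y.1.1 y.2.1 i) x :=
  contDiffAt_desiredAttitude (contDiffAt_thrust i) (by fun_prop) (hx.2 i)

theorem contDiffAt_thrustDev (hx : x ∈ closedDomain p Kx Kv) :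
    ContDiffAt ℝ k (fun y : Ref n × Full ν => thrustDev p Kx Kv y.1.1 y.2) x := by
  rw [contDiffAt_pi]
  intro i
  have h1 := contDiffAt_cmdAtt (k := k) hx i
  have h2 := contDiffAt_thrust (p := p) (Kx := Kx) (Kv := Kv) (k := k) (x := x) i
  have h3 : ContDiffAt ℝ k (fun y : Ref n × Full ν => thrustDir p Kx Kv y.1.1 y.2 i) x :=
    ContDiffAt.mulVec (ContDiffAt.matMul h1 (by fun_prop)) (by fun_prop)
  exact ((ContDiffAt.dotV3 h2 h3).smul h3).sub h2

theorem contDiffAt_outerClosed (hx : x ∈ closedDomain p Kx Kv) :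
    ContDiffAt ℝ k (outerClosed p Kx Kv) x := by
  have h1 : ContDiffAt ℝ k (fun y : Ref n × Full ν =>
      (y.2.1, feedback Kx Kv y.2.1 + thrustDev p Kx Kv y.1.1 y.2)) x :=
    ContDiffAt.prodMk (by fun_prop)
      (ContDiffAt.add (by fun_prop) (contDiffAt_thrustDev hx))
  exact ContDiffAt.comp x (contDiffAt_outerField (w := (x.2.1, _)) hx.1) h1

theorem contDiffAt_cmdAttDeriv (hx : x ∈ closedDomain p Kx Kv) (i : Fin n) :
    ContDiffAt ℝ k (fun y => cmdAttDeriv p Kx Kv y i) x := by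
  have h1 : ContDiffAt ℝ k (fun y : Ref n × Full ν =>
      fderiv ℝ desiredAttitudeFun (thrust p Kx Kv y.2.1 i, y.1.1 i)) x := by
    have h : ContDiffAt ℝ k (fderiv ℝ desiredAttitudeFun)
        (thrust p Kx Kv x.2.1 i, x.1.1 i) :=
      (contDiffAt_desiredAttitudeFun (k := k + 1) (hx.2 i)).fderiv_right le_rfl
    exact ContDiffAt.comp x h (ContDiffAt.prodMk (contDiffAt_thrust i) (by fun_prop))
  have h2 : ContDiffAt ℝ k (fun y : Ref n × Full ν =>
      (feedback Kx Kv (outerClosed p Kx Kv y) i, y.1.2 i)) x := by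
    have h3 := contDiffAt_outerClosed (k := k) hx
    have h4 : ContDiff ℝ k fun z : Outer ν => feedback Kx Kv z i := by fun_prop
    exact ContDiffAt.prodMk (h4.contDiffAt.comp x h3) (by fun_prop)
  exact h1.clm_apply h2

theorem contDiffAt_cmdAngVel (hx : x ∈ closedDomain p Kx Kv) (i : Fin n) :
    ContDiffAt ℝ k (fun y => cmdAngVel p Kx Kv y i) x :=
  ContDiffAt.vee (ContDiffAt.matMul (ContDiffAt.matTranspose (contDiffAt_cmdAtt hx i))
    (contDiffAt_cmdAttDeriv hx i))

theorem contDiffAt_closedField {kR kΩ : ℝ} (hx : x ∈ closedDomain p Kx Kv) :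
    ContDiffAt ℝ k (closedField p Kx Kv kR kΩ) x := by
  have h1 := contDiffAt_outerClosed (k := k) hx
  have h2 := fun i => contDiffAt_cmdAngVel (k := k) hx i
  refine h1.prodMk (ContDiffAt.prodMk ?_ ?_)
  · rw [contDiffAt_pi]
    intro i
    fun_prop
  · rw [contDiffAt_pi]
    intro i
    unfold attRhs
    have h3 : ContDiff ℝ k fun y : Ref n × Full ν => attErr 1 (y.2.2.1 i) := by fun_prop
    have h3 := h3.contDiffAt (x := x)
    have h4 := h2 i
    fun_prop

end

/-! ### Reference directions -/

/-- The values admitted for `b₁` and its derivative. -/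
def refSet (n : ℕ) (B δ : ℝ) : Set (Ref n) :=
  {θ | ∀ i, vnorm (θ.1 i) = 1 ∧ vnorm (θ.2 i) ≤ B ∧ δ ≤ vnorm (e3 ⨯₃ θ.1 i)}

theorem continuous_vnorm : Continuous vnorm := by
  unfold vnorm
  exact (ContDiff.dotV3 (k := 0) contDiff_id contDiff_id).continuous.sqrt

theorem isCompact_refSet (B δ : ℝ) : IsCompact (refSet n B δ) := by
  refine Metric.isCompact_of_isClosed_isBounded ?_ ?_
  · simp only [refSet, Set.ofPred_forall]
    refine isClosed_iInter fun i => ?_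
    have h : Continuous fun θ : Ref n => e3 ⨯₃ θ.1 i :=
      (ContDiff.cross (k := 0) contDiff_const (by fun_prop)).continuous
    refine (isClosed_eq (continuous_vnorm.comp (by fun_prop)) continuous_const).inter
      ((isClosed_le (continuous_vnorm.comp (by fun_prop)) continuous_const).inter
      (isClosed_le continuous_const (continuous_vnorm.comp h)))
  · refine (Metric.isBounded_closedBall (x := (0 : Ref n)) (r := max 1 B)).subset fun θ hθ => ?_
    have h0 : (0 : ℝ) ≤ max 1 B := zero_le_one.trans (le_max_left _ _)
    rw [mem_closedBall_zero_iff]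
    refine max_le ?_ ?_
    · exact (pi_norm_le_iff_of_nonneg h0).mpr fun i =>
        (norm_le_vnorm _).trans ((hθ i).1.le.trans (le_max_left _ _))
    · exact (pi_norm_le_iff_of_nonneg h0).mpr fun i =>
        (norm_le_vnorm _).trans ((hθ i).2.1.trans (le_max_right _ _))

theorem thrustEq_cross_ne_zero {p : Params n ν} {i : Fin n} {b : V3} (h : e3 ⨯₃ b ≠ 0) :
    thrustEq p i ⨯₃ b ≠ 0 := by
  have h1 : 0 < (p.MiT i + p.m0 / n) * p.g := by
    have : 0 < p.MiT i :=
      add_pos_of_nonneg_of_pos (Finset.sum_nonneg fun j _ => (p.mL_pos i j).le) (p.m_pos i)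
    have := p.m0_pos
    have := p.g_pos
    positivity
  rw [thrustEq, map_smul, LinearMap.smul_apply]
  exact smul_ne_zero (neg_ne_zero.mpr h1.ne') h

/-- At the equilibrium the ideal thrust is a nonzero multiple of `e3`, so the closed loop is defined
there for every reference in `refSet`. By compactness and the tube lemma one radius works for all of
them, which makes the later constants uniform in time. -/
theorem exists_closedBall_subset_closedDomain (hM : IsUnit (linM p).det) (B : ℝ) {δ : ℝ}
    (hδ : 0 < δ) : ∃ r > 0, refSet n B δ ×ˢ Metric.closedBall (fullEq ν) r ⊆
      closedDomain p Kx Kv := by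
  have hsub : refSet n B δ ×ˢ {fullEq ν} ⊆ closedDomain p Kx Kv := by
    rintro ⟨θ, Z⟩ ⟨hθ, hZ⟩
    obtain rfl : Z = fullEq ν := hZ
    refine ⟨outerEq_mem_regularSet hM, fun i => ?_⟩
    have h0 : thrust p Kx Kv (fullEq ν).1 i = thrustEq p i := by
      simp [thrust, fullEq, feedback_outerEq]
    rw [h0]
    refine thrustEq_cross_ne_zero fun h => ?_
    have := (hθ i).2.2
    simp only [h, vnorm, dotProduct_zero, Real.sqrt_zero] at this
    linarith
  obtain ⟨u, v, -, hv, hu, hvZ, huv⟩ := generalized_tube_lemma (isCompact_refSet B δ)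
    (isCompact_singleton (x := fullEq ν)) (isOpen_closedDomain (p := p) (Kx := Kx) (Kv := Kv)) hsub
  obtain ⟨r, hr, hrv⟩ := Metric.nhds_basis_closedBall.mem_iff.mp
    (hv.mem_nhds (hvZ (Set.mem_singleton _)))
  exact ⟨r, hr, (Set.prod_mono hu hrv).trans huv⟩

/-! ### The deviation of the thrusts -/

theorem SO3.dot_mulVec {R : Mat3} (hR : R ∈ SO3) (v : V3) : (R *ᵥ v) ⬝ᵥ (R *ᵥ v) = v ⬝ᵥ v := by
  rw [Matrix.dotProduct_mulVec, ← Matrix.mulVec_transpose, Matrix.mulVec_mulVec,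
    SO3.transpose_mul hR, Matrix.one_mulVec]

theorem norm_le_one_of_dot_self {v : V3} (h : v ⬝ᵥ v = 1) : ‖v‖ ≤ 1 := by
  have := norm_sq_le_dotProduct v
  rw [h] at this
  exact (sq_le_one_iff₀ (norm_nonneg _)).mp this

theorem e3_dot_e3 : e3 ⬝ᵥ e3 = 1 := by simp [e3, dotProduct, Fin.sum_univ_three]

/-- The ideal thrust is `A = (A·s) s` with `s = R_c e3`, the actual one is `(A·r) r` with `r = R
e3`. Their difference is `(A·(r - s)) r + (A·s) (r - s)`, and `r - s = R_c (Q - 1) e3`. The two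
terms contribute 27 each. -/
theorem norm_thrustDev_le {b : Fin n → V3} {Z : Full ν} {i : Fin n}
    (h : thrust p Kx Kv Z.1 i ⨯₃ b i ≠ 0) (hQ : Z.2.1 i ∈ SO3) :
    ‖thrustDev p Kx Kv b Z i‖ ≤ 54 * ‖thrust p Kx Kv Z.1 i‖ * ‖Z.2.1 i - 1‖ := by
  set A := thrust p Kx Kv Z.1 i with hA
  set r := thrustDir p Kx Kv b Z i with hr
  set s := cmdAtt p Kx Kv b Z.1 i *ᵥ e3 with hs
  have hR : cmdAtt p Kx Kv b Z.1 i ∈ SO3 := desiredAttitude_mem_SO3 h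
  have hA0 := (cross_ne_zero_iff.mp h).1
  have hs' : s = axis3 A := desiredAttitude_mulVec_e3 _ _
  have hAs : A = (A ⬝ᵥ s) • s := by
    have h1 := eq_neg_vnorm_smul_axis3 hA0
    rw [← hs'] at h1
    have h2 : A ⬝ᵥ s = -vnorm A := by
      conv_lhs => rw [h1]
      rw [smul_dotProduct, hs', axis3_dot_axis3 hA0, smul_eq_mul, mul_one]
    rw [h2]
    exact h1
  have hs1 : ‖s‖ ≤ 1 := norm_le_one_of_dot_self (by rw [hs', axis3_dot_axis3 hA0])
  have hr1 : ‖r‖ ≤ 1 := norm_le_one_of_dot_self (by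
    rw [hr, thrustDir, SO3.dot_mulVec (SO3.mul_mem hR hQ), e3_dot_e3])
  have he1 : ‖e3‖ ≤ 1 := norm_le_one_of_dot_self e3_dot_e3
  have hrs : ‖r - s‖ ≤ 9 * ‖Z.2.1 i - 1‖ := by
    have h1 : r - s = cmdAtt p Kx Kv b Z.1 i *ᵥ ((Z.2.1 i - 1) *ᵥ e3) := by
      rw [Matrix.sub_mulVec, Matrix.one_mulVec, Matrix.mulVec_sub, Matrix.mulVec_mulVec, hr, hs,
        thrustDir]
    rw [h1]
    have h2 := norm_mulVec_le (cmdAtt p Kx Kv b Z.1 i) ((Z.2.1 i - 1) *ᵥ e3)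
    have h3 := norm_mulVec_le (Z.2.1 i - 1) e3
    have h4 : ‖cmdAtt p Kx Kv b Z.1 i‖ ≤ 1 := SO3.norm_le hR
    calc _ ≤ 3 * ‖cmdAtt p Kx Kv b Z.1 i‖ * ‖(Z.2.1 i - 1) *ᵥ e3‖ := h2
      _ ≤ 3 * 1 * (3 * ‖Z.2.1 i - 1‖ * 1) := by gcongr; exact h3.trans (by gcongr)
      _ = _ := by ring
  have h1 : thrustDev p Kx Kv b Z i = (A ⬝ᵥ (r - s)) • r + (A ⬝ᵥ s) • (r - s) := by
    have h2 : thrustDev p Kx Kv b Z i = (A ⬝ᵥ r) • r - (A ⬝ᵥ s) • s := by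
      rw [← hAs]; rfl
    rw [h2, dotProduct_sub]
    module
  have h5 : |A ⬝ᵥ (r - s)| ≤ 3 * ‖A‖ * (9 * ‖Z.2.1 i - 1‖) :=
    (abs_dotProduct_le _ _).trans (by gcongr)
  have h6 : |A ⬝ᵥ s| ≤ 3 * ‖A‖ * 1 := (abs_dotProduct_le _ _).trans (by gcongr)
  rw [h1]
  refine (norm_add_le _ _).trans ?_
  rw [norm_smul, norm_smul, Real.norm_eq_abs, Real.norm_eq_abs]
  have h7 := mul_le_mul h5 hr1 (norm_nonneg _) (by positivity)
  have h8 := mul_le_mul h6 hrs (norm_nonneg _) (by positivity)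
  linarith

/-! ## The Lyapunov function of the closed loop -/

/-- The constraints on the state of the closed loop. -/
structure FullAdm (Z : Full ν) : Prop where
  outer : OuterAdm Z.1
  Q_mem : ∀ i, Z.2.1 i ∈ SO3

/-- The squared size of the attitude errors of the quadrotors. -/
def attSq (Z : Full ν) : ℝ := ∑ i, (‖Z.2.2 i‖ ^ 2 + ‖Z.2.1 i - 1‖ ^ 2)

theorem attSq_nonneg (Z : Full ν) : 0 ≤ attSq Z := Finset.sum_nonneg fun i _ => by positivity

theorem norm_outer_sub_le (Z : Full ν) : ‖Z.1 - outerEq ν‖ ≤ ‖Z - fullEq ν‖ :=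
  norm_fst_le (Z - fullEq ν)

theorem norm_rot_sub_le (Z : Full ν) (i : Fin n) : ‖Z.2.1 i - 1‖ ≤ ‖Z - fullEq ν‖ :=
  (norm_le_pi_norm (Z - fullEq ν).2.1 i).trans
    ((norm_fst_le (Z - fullEq ν).2).trans (norm_snd_le (Z - fullEq ν)))

theorem norm_angVel_le (Z : Full ν) (i : Fin n) : ‖Z.2.2 i‖ ≤ ‖Z - fullEq ν‖ := by
  have := (norm_le_pi_norm (Z - fullEq ν).2.2 i).trans
    ((norm_snd_le (Z - fullEq ν).2).trans (norm_snd_le (Z - fullEq ν)))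
  simpa [fullEq] using this

theorem norm_sub_fullEq_le {Z : Full ν} {c : ℝ} (hc : 0 ≤ c) (h1 : ‖Z.1 - outerEq ν‖ ≤ c)
    (h2 : ∀ i, ‖Z.2.1 i - 1‖ ≤ c) (h3 : ∀ i, ‖Z.2.2 i‖ ≤ c) : ‖Z - fullEq ν‖ ≤ c := by
  refine max_le h1 (max_le ?_ ?_)
  · exact (pi_norm_le_iff_of_nonneg hc).mpr h2
  · exact (pi_norm_le_iff_of_nonneg hc).mpr fun i => by simpa [fullEq] using h3 i

theorem norm_sq_sub_fullEq_le (Z : Full ν) :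
    ‖Z - fullEq ν‖ ^ 2 ≤ ‖Z.1 - outerEq ν‖ ^ 2 + attSq Z := by
  have h0 := attSq_nonneg Z
  have hi : ∀ i, ‖Z.2.2 i‖ ^ 2 + ‖Z.2.1 i - 1‖ ^ 2 ≤ attSq Z := fun i =>
    Finset.single_le_sum (f := fun i => ‖Z.2.2 i‖ ^ 2 + ‖Z.2.1 i - 1‖ ^ 2)
      (fun i _ => by positivity) (Finset.mem_univ i)
  have h : ‖Z - fullEq ν‖ ≤ √(‖Z.1 - outerEq ν‖ ^ 2 + attSq Z) := by
    refine norm_sub_fullEq_le (Real.sqrt_nonneg _) ?_ (fun i => ?_) fun i => ?_ <;>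
      apply Real.le_sqrt_of_sq_le
    · linarith
    · linarith [hi i, sq_nonneg ‖Z.2.2 i‖, sq_nonneg ‖Z.1 - outerEq ν‖]
    · linarith [hi i, sq_nonneg ‖Z.2.1 i - 1‖, sq_nonneg ‖Z.1 - outerEq ν‖]
  exact (pow_le_pow_left₀ (norm_nonneg _) h 2).trans_eq (Real.sq_sqrt (by positivity))

theorem attSq_le (Z : Full ν) : attSq Z ≤ 2 * n * ‖Z - fullEq ν‖ ^ 2 := by
  have h : attSq Z ≤ ∑ _i : Fin n, 2 * ‖Z - fullEq ν‖ ^ 2 := Finset.sum_le_sum fun i _ => by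
    have h1 := pow_le_pow_left₀ (norm_nonneg _) (norm_rot_sub_le Z i) 2
    have h2 := pow_le_pow_left₀ (norm_nonneg _) (norm_angVel_le Z i) 2
    linarith
  refine h.trans_eq ?_
  rw [Finset.sum_const, Finset.card_univ, Fintype.card_fin, nsmul_eq_mul]
  ring

theorem mul_mul_le_of_pos {a : ℝ} (ha : 0 < a) (K X W : ℝ) :
    K * X * W ≤ a / 2 * X ^ 2 + K ^ 2 / (2 * a) * W ^ 2 := by
  have h : 0 ≤ (a * X - K * W) ^ 2 / (2 * a) := by positivity
  have e : (a * X - K * W) ^ 2 / (2 * a) =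
      a / 2 * X ^ 2 - K * X * W + K ^ 2 / (2 * a) * W ^ 2 := by
    field_simp
    ring
  linarith

section Prod

variable {F G : Type*} [NormedAddCommGroup F] [NormedSpace ℝ F] [NormedAddCommGroup G]
  [NormedSpace ℝ G] {f : ℝ → F × G} {f' : F × G} {I : Set ℝ} {t : ℝ}

theorem hasDerivWithinAt_fst (h : HasDerivWithinAt f f' I t) :
    HasDerivWithinAt (fun τ => (f τ).1) f'.1 I t :=
  (ContinuousLinearMap.fst ℝ F G).hasFDerivAt.comp_hasDerivWithinAt t h

theorem hasDerivWithinAt_snd (h : HasDerivWithinAt f f' I t) :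
    HasDerivWithinAt (fun τ => (f τ).2) f'.2 I t :=
  (ContinuousLinearMap.snd ℝ F G).hasFDerivAt.comp_hasDerivWithinAt t h

end Prod

/-- The attitude Lyapunov functions of all quadrotors, with common constants. -/
theorem exists_attLyap_family (hn : 0 < n) (p : Params n ν) {kR kΩ : ℝ} (hkR : 0 < kR)
    (hkΩ : 0 < kΩ) (B : ℝ) (hB : 0 ≤ B) :
    ∃ (ε : Fin n → ℝ), ∃ c₁ > 0, ∃ c₂ > 0, ∃ β > 0, ∀ i, ∀ Q ∈ SO3, attPsi 1 Q < 1 → ∀ e : V3,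
      c₁ * (‖e‖ ^ 2 + ‖Q - 1‖ ^ 2) ≤ attLyap kR (ε i) (p.J i) Q e ∧
      attLyap kR (ε i) (p.J i) Q e ≤ c₂ * (‖e‖ ^ 2 + ‖Q - 1‖ ^ 2) ∧
      ∀ w : V3, ‖w‖ ≤ B → ‖e‖ ≤ 1 →
        attLyapDeriv kR (ε i) (p.J i) Q e (attRhs kR kΩ (p.J i) Q w e) ≤
          -β * (‖e‖ ^ 2 + ‖Q - 1‖ ^ 2) := by
  have : Nonempty (Fin n) := ⟨⟨0, hn⟩⟩
  choose ε _ c₁ hc₁ c₂ hc₂ β hβ h using fun i => exists_attLyap hkR hkΩ (p.J_pos i) B hB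
  obtain ⟨i₁, h₁⟩ := Finite.exists_min c₁
  obtain ⟨i₂, h₂⟩ := Finite.exists_max c₂
  obtain ⟨i₃, h₃⟩ := Finite.exists_min β
  refine ⟨ε, c₁ i₁, hc₁ i₁, c₂ i₂, hc₂ i₂, β i₃, hβ i₃, fun i Q hQ hΨ e => ?_⟩
  obtain ⟨g₁, g₂, g₃⟩ := h i Q hQ hΨ e
  have hs : 0 ≤ ‖e‖ ^ 2 + ‖Q - 1‖ ^ 2 := by positivity
  refine ⟨(mul_le_mul_of_nonneg_right (h₁ i) hs).trans g₁,
    g₂.trans (mul_le_mul_of_nonneg_right (h₂ i) hs), fun w hw he => (g₃ w hw he).trans ?_⟩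
  exact mul_le_mul_of_nonneg_right (neg_le_neg (h₃ i)) hs

/-- The first bound expresses the disturbance by attitude errors alone, for absorption in the
Lyapunov derivative. The second keeps it within the range where the outer estimate is valid. -/
theorem exists_thrustDev_bound (p : Params n ν) (Kx Kv : Matrix (Fin n × Fin 3) (LinIdx ν) ℝ)
    {s : Set (Ref n)} {r : ℝ} (h : s ×ˢ Metric.closedBall (fullEq ν) r ⊆ closedDomain p Kx Kv) :
    ∃ C : ℝ, 0 ≤ C ∧ ∀ θ ∈ s, ∀ Z : Full ν, FullAdm Z → ‖Z - fullEq ν‖ ≤ r →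
      ‖thrustDev p Kx Kv θ.1 Z‖ ≤ C * √(attSq Z) ∧
      ‖thrustDev p Kx Kv θ.1 Z‖ ≤ C * ‖Z - fullEq ν‖ := by
  have hcont : Continuous fun Z : Full ν => thrust p Kx Kv Z.1 :=
    continuous_pi fun i => ((contDiff_thrust (k := 0) i).continuous).comp continuous_fst
  obtain ⟨C, hC⟩ := (isCompact_closedBall (fullEq ν) r).exists_bound_of_continuousOn
    hcont.continuousOn
  refine ⟨54 * |C|, by positivity, fun θ hθ Z hZ hr => ?_⟩
  have hmem : Z ∈ Metric.closedBall (fullEq ν) r := by rwa [mem_closedBall_iff_norm]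
  have hi : ∀ i, ‖thrustDev p Kx Kv θ.1 Z i‖ ≤ 54 * |C| * ‖Z.2.1 i - 1‖ := fun i => by
    refine (norm_thrustDev_le ((h (Set.mk_mem_prod hθ hmem)).2 i) (hZ.Q_mem i)).trans ?_
    have := ((norm_le_pi_norm (thrust p Kx Kv Z.1) i).trans (hC Z hmem)).trans (le_abs_self C)
    gcongr
  constructor
  · refine (pi_norm_le_iff_of_nonneg (by positivity)).mpr fun i => (hi i).trans ?_
    gcongr
    apply Real.le_sqrt_of_sq_le
    have := Finset.single_le_sum (f := fun i => ‖Z.2.2 i‖ ^ 2 + ‖Z.2.1 i - 1‖ ^ 2)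
      (fun i _ => by positivity) (Finset.mem_univ i)
    exact (le_add_of_nonneg_left (sq_nonneg _)).trans this
  · refine (pi_norm_le_iff_of_nonneg (by positivity)).mpr fun i => (hi i).trans ?_
    gcongr
    exact norm_rot_sub_le Z i

/-- Continuity on a compact set supplies the bound on the desired angular velocity required by
`exists_attLyap`, uniformly in the reference. -/
theorem exists_cmdAngVel_bound (p : Params n ν) (Kx Kv : Matrix (Fin n × Fin 3) (LinIdx ν) ℝ)
    {s : Set (Ref n)} (hs : IsCompact s) {r : ℝ}
    (h : s ×ˢ Metric.closedBall (fullEq ν) r ⊆ closedDomain p Kx Kv) :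
    ∃ C : ℝ, 0 ≤ C ∧ ∀ θ ∈ s, ∀ Z : Full ν, FullAdm Z → ‖Z - fullEq ν‖ ≤ r → ∀ i,
      ‖(Z.2.1 i)ᵀ *ᵥ cmdAngVel p Kx Kv (θ, Z) i‖ ≤ C := by
  have hcont : ContinuousOn (fun x => cmdAngVel p Kx Kv x)
      (s ×ˢ Metric.closedBall (fullEq ν) r) := by
    intro x hx
    have h1 : ContDiffAt ℝ 0 (fun x => cmdAngVel p Kx Kv x) x :=
      contDiffAt_pi.mpr fun i => contDiffAt_cmdAngVel (h hx) i
    exact h1.continuousAt.continuousWithinAt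
  obtain ⟨C, hC⟩ := (hs.prod (isCompact_closedBall (fullEq ν) r)).exists_bound_of_continuousOn hcont
  refine ⟨3 * 1 * |C|, by positivity, fun θ hθ Z hZ hr i => (norm_mulVec_le _ _).trans ?_⟩
  have hmem : Z ∈ Metric.closedBall (fullEq ν) r := by rwa [mem_closedBall_iff_norm]
  have h1 := SO3.norm_le (SO3.transpose_mem (hZ.Q_mem i))
  have h2 := ((norm_le_pi_norm (cmdAngVel p Kx Kv (θ, Z)) i).trans
    (hC _ (Set.mk_mem_prod hθ hmem))).trans (le_abs_self C)
  gcongr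

theorem exists_norm_linearMap_bounds {ι E : Type*} [Fintype ι] [NormedAddCommGroup E]
    [NormedSpace ℝ E] (S : (ι → ℝ) →ₗ[ℝ] E) (hS : Function.Injective S) :
    ∃ a > 0, ∃ b > 0, ∀ v, a * ‖v‖ ≤ ‖S v‖ ∧ ‖S v‖ ≤ b * ‖v‖ := by
  obtain ⟨K, hK, hK'⟩ := S.exists_antilipschitzWith (LinearMap.ker_eq_bot.mpr hS)
  obtain ⟨b, hb, hb'⟩ := SemilinearMapClass.bound_of_continuous S
    S.continuous_of_finiteDimensional
  have hK0 : (0 : ℝ) < K := hK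
  refine ⟨(K : ℝ)⁻¹, inv_pos.mpr hK0, b, hb, fun v => ⟨?_, hb' v⟩⟩
  have := hK'.le_mul_dist v 0
  rw [map_zero, dist_zero_right, dist_zero_right] at this
  rw [inv_mul_le_iff₀ hK0]
  exact this

theorem PosDef.mulVec_inv_mulVec {J : Mat3} (hJ : J.PosDef) (v : V3) : J *ᵥ (J⁻¹ *ᵥ v) = v := by
  rw [Matrix.mulVec_mulVec, Matrix.mul_nonsing_inv _ hJ.det_pos.ne'.isUnit, Matrix.one_mulVec]

theorem PosDef.transpose_eq {J : Mat3} (hJ : J.PosDef) : Jᵀ = J := by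
  have := hJ.isHermitian
  rwa [Matrix.IsHermitian, Matrix.conjTranspose_eq_transpose_of_trivial] at this

/-- The Lyapunov function of the outer loop. -/
theorem exists_outer_lyapunov (hn : 0 < n) {p : Params n ν}
    (hρ : (∑ i, p.ρ i) 0 = 0 ∧ (∑ i, p.ρ i) 1 = 0)
    {Kx Kv : Matrix (Fin n × Fin 3) (LinIdx ν) ℝ} (hK : IsHurwitz (linClosedLoop p Kx Kv)) :
    ∃ (V : Outer ν → ℝ), ∃ a > 0, ∃ b > 0, ∃ c > 0, ∃ K ≥ 0, ∃ η > 0,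
      ∀ z : Outer ν, OuterAdm z → ‖z - outerEq ν‖ < η →
        a * ‖z - outerEq ν‖ ^ 2 ≤ V z ∧ V z ≤ b * ‖z - outerEq ν‖ ^ 2 ∧
        ∀ δ : Fin n → V3, ‖δ‖ < η → ∀ (y : ℝ → Outer ν) (I : Set ℝ) (t : ℝ), y t = z →
          HasDerivWithinAt y (outerField p z (feedback Kx Kv z + δ)) I t →
          ∃ V', HasDerivWithinAt (fun τ => V (y τ)) V' I t ∧
            V' ≤ -c * ‖z - outerEq ν‖ ^ 2 + K * ‖z - outerEq ν‖ * ‖δ‖ := by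
  have hM := isUnit_linM_of_isHurwitz hK
  obtain ⟨E, _, _, S, α, hα, hS, hdis⟩ := hK.exists_dissipative
  obtain ⟨s₁, hs₁, s₂, hs₂, hSb⟩ := exists_norm_linearMap_bounds S hS
  obtain ⟨C, hC, hest⟩ := exists_outerField_estimate hn hρ hM Kx Kv
  obtain ⟨L, hL, hcoord⟩ := exists_norm_coords_le ν
  set σ := s₁ / 4 with hσ
  have hσ0 : 0 < σ := by positivity
  set τ := s₂ * L + 1 with hτ
  have hτ0 : 0 < τ := by positivity
  -- Here `σ` and `τ` compare `‖S (coords ν z)‖` with the distance to equilibrium from below and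
  -- above; the 4 in `σ` comes from `OuterAdm.norm_sub_le_coords`. With this `ε` the second-order
  -- remainder costs half of the decay `2ασ²`.
  have hε0 : 0 < min 1 (α * σ ^ 2 / (2 * τ * s₂)) := by positivity
  obtain ⟨η, hη, hball⟩ := Metric.eventually_nhds_iff.mp (hest _ hε0 (min_le_left _ _))
  set ε := min 1 (α * σ ^ 2 / (2 * τ * s₂)) with hε
  have hε' : 2 * τ * s₂ * ε ≤ α * σ ^ 2 := by
    rw [← le_div_iff₀' (by positivity)]
    exact min_le_right _ _
  refine ⟨fun z => ‖S (coords ν z)‖ ^ 2, σ ^ 2, by positivity, τ ^ 2, by positivity, α * σ ^ 2,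
    by positivity, 2 * τ * s₂ * C, by positivity, min η (1 / 2), by positivity,
    fun z hz hzη => ?_⟩
  set X := ‖z - outerEq ν‖ with hX
  have hX0 : 0 ≤ X := norm_nonneg _
  have hlow : σ * X ≤ ‖S (coords ν z)‖ := by
    have h1 := hz.norm_sub_le_coords (hzη.le.trans (min_le_right _ _))
    have h2 := (hSb (coords ν z)).1
    rw [hσ]
    nlinarith
  have hupp : ‖S (coords ν z)‖ ≤ τ * X := by
    have h1 := mul_le_mul_of_nonneg_left (hcoord z) hs₂.le
    have h2 := (hSb (coords ν z)).2
    rw [hτ]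
    nlinarith
  refine ⟨?_, ?_, fun δ hδ y I t hyt hy => ?_⟩
  · rw [← mul_pow]
    exact pow_le_pow_left₀ (by positivity) hlow 2
  · rw [← mul_pow]
    exact pow_le_pow_left₀ (norm_nonneg _) hupp 2
  · have hd : HasDerivWithinAt (fun τ => S (coords ν (y τ)))
        (S (coords ν (outerField p z (feedback Kx Kv z + δ)))) I t :=
      (LinearMap.toContinuousLinearMap S).hasFDerivAt.comp_hasDerivWithinAt t
        ((coords ν).hasFDerivAt.comp_hasDerivWithinAt t hy)
    refine ⟨_, hd.norm_sq, ?_⟩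
    rw [hyt]
    have h1 := hball (y := (z, δ)) (by
      rw [dist_eq_norm, Prod.norm_def, Prod.mk_sub_mk, sub_zero]
      exact max_lt (hzη.trans_le (min_le_left _ _)) (hδ.trans_le (min_le_left _ _))) hz.R0_mem
    simp only at h1
    set y' := coords ν (outerField p z (feedback Kx Kv z + δ)) with hy'
    set w := linClosedLoop p Kx Kv *ᵥ coords ν z with hw
    have h2 : inner ℝ (S (coords ν z)) (S y') ≤ -α * ‖S (coords ν z)‖ ^ 2 +
        ‖S (coords ν z)‖ * (s₂ * (ε * X + C * ‖δ‖)) := by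
      have h3 : S y' = S w + S (y' - w) := by rw [← map_add, add_sub_cancel]
      rw [h3, inner_add_right]
      refine add_le_add (hdis _) ((real_inner_le_norm _ _).trans ?_)
      exact mul_le_mul_of_nonneg_left (((hSb _).2).trans (mul_le_mul_of_nonneg_left h1 hs₂.le))
        (norm_nonneg _)
    have h4 : α * (σ * X) ^ 2 ≤ α * ‖S (coords ν z)‖ ^ 2 := by gcongr
    have h5 : ‖S (coords ν z)‖ * (s₂ * (ε * X + C * ‖δ‖)) ≤ τ * X * (s₂ * (ε * X + C * ‖δ‖)) := by
      gcongr
    have h6 := mul_le_mul_of_nonneg_right hε' (sq_nonneg X)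
    have e1 : τ * X * (s₂ * (ε * X + C * ‖δ‖)) =
        2 * τ * s₂ * ε * X ^ 2 / 2 + 2 * τ * s₂ * C * X * ‖δ‖ / 2 := by ring
    rw [mul_pow] at h4
    linarith

/-- A Lyapunov function of the closed loop. -/
theorem exists_lyapunov (hn : 0 < n) {p : Params n ν}
    (hρ : (∑ i, p.ρ i) 0 = 0 ∧ (∑ i, p.ρ i) 1 = 0)
    {Kx Kv : Matrix (Fin n × Fin 3) (LinIdx ν) ℝ} (hK : IsHurwitz (linClosedLoop p Kx Kv))
    {kR kΩ : ℝ} (hkR : 0 < kR) (hkΩ : 0 < kΩ) (B : ℝ) {δ : ℝ} (hδ : 0 < δ) :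
    ∃ (V : Full ν → ℝ), ∃ r > 0, ∃ c₁ > 0, ∃ c₂ > 0, ∃ γ > 0, r ≤ 1 / 2 ∧
      refSet n B δ ×ˢ Metric.closedBall (fullEq ν) r ⊆ closedDomain p Kx Kv ∧
      ∀ Z : Full ν, FullAdm Z → ‖Z - fullEq ν‖ ≤ r →
        c₁ * ‖Z - fullEq ν‖ ^ 2 ≤ V Z ∧ V Z ≤ c₂ * ‖Z - fullEq ν‖ ^ 2 ∧
        ∀ θ ∈ refSet n B δ, ∀ (y : ℝ → Full ν) (I : Set ℝ) (t : ℝ), y t = Z →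
          HasDerivWithinAt y (closedField p Kx Kv kR kΩ (θ, Z)) I t →
          ∃ V', HasDerivWithinAt (fun τ => V (y τ)) V' I t ∧ V' ≤ -(2 * γ) * V Z := by
  have hM := isUnit_linM_of_isHurwitz hK
  obtain ⟨V₀, a, ha, b, hb, c, hc, K, hK0, η, hη, hV₀⟩ := exists_outer_lyapunov hn hρ hK
  obtain ⟨r₀, hr₀, hsub⟩ := exists_closedBall_subset_closedDomain (p := p) (Kx := Kx) (Kv := Kv)
    hM B hδ
  obtain ⟨C, hC, hdev⟩ := exists_thrustDev_bound p Kx Kv hsub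
  obtain ⟨W, hW, hang⟩ := exists_cmdAngVel_bound p Kx Kv (isCompact_refSet B δ) hsub
  obtain ⟨ε, d₁, hd₁, d₂, hd₂, β, hβ, hatt⟩ := exists_attLyap_family hn p hkR hkΩ W hW
  -- The attitude functions get so large a weight that their decay `μβ` covers the coupling
  -- `(KC)²/(2c)` left by Young's inequality, with a surplus of 1.
  set μ := ((K * C) ^ 2 / (2 * c) + 1) / β with hμ
  have hμ0 : 0 < μ := by positivity
  have hμβ : μ * β = (K * C) ^ 2 / (2 * c) + 1 := div_mul_cancel₀ _ hβ.ne'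
  -- Within `r` the controller is defined (`r₀`), `Ψ < 1` holds (`1/2`), and both the state and the
  -- disturbance, at most `C r`, lie in the range `η` of the outer estimate.
  set r := min (min r₀ (1 / 2)) (min (η / 2) (η / (2 * (C + 1)))) with hr
  have hr0 : 0 < r := by positivity
  have hrr₀ : r ≤ r₀ := (min_le_left _ _).trans (min_le_left _ _)
  have hr2 : r ≤ 1 / 2 := (min_le_left _ _).trans (min_le_right _ _)
  have hrη : r < η := ((min_le_right _ _).trans (min_le_left _ _)).trans_lt (by linarith)
  have hCr : C * r < η := by
    have h1 : r ≤ η / (2 * (C + 1)) := (min_le_right _ _).trans (min_le_right _ _)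
    rw [le_div_iff₀ (by positivity)] at h1
    nlinarith
  set b' := b + μ * d₂ with hb'
  have hb0 : 0 < b' := by positivity
  set a' := min a (μ * d₁) with ha'
  have ha0 : 0 < a' := by positivity
  set c' := min (c / 2) 1 with hc'
  have hc0 : 0 < c' := by positivity
  refine ⟨fun Z => V₀ Z.1 + μ * ∑ i, attLyap kR (ε i) (p.J i) (Z.2.1 i) (Z.2.2 i), r, hr0, a', ha0,
    b' * (1 + 2 * n), by positivity, c' / b' / 2, by positivity, hr2,
    (Set.prod_mono le_rfl (Metric.closedBall_subset_closedBall hrr₀)).trans hsub,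
    fun Z hZ hZr => ?_⟩
  set X := ‖Z.1 - outerEq ν‖ with hX
  have hXr : X ≤ r := (norm_outer_sub_le Z).trans hZr
  obtain ⟨hlow, hupp, hder⟩ := hV₀ Z.1 hZ.outer (hXr.trans_lt hrη)
  have hΨ : ∀ i, attPsi 1 (Z.2.1 i) < 1 := fun i =>
    SO3.attPsi_lt_one (hZ.Q_mem i) ((norm_rot_sub_le Z i).trans (hZr.trans hr2))
  have hat1 := fun i => hatt i _ (hZ.Q_mem i) (hΨ i) (Z.2.2 i)
  have hs₁ : d₁ * attSq Z ≤ ∑ i, attLyap kR (ε i) (p.J i) (Z.2.1 i) (Z.2.2 i) := by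
    rw [attSq, Finset.mul_sum]
    exact Finset.sum_le_sum fun i _ => (hat1 i).1
  have hs₂ : ∑ i, attLyap kR (ε i) (p.J i) (Z.2.1 i) (Z.2.2 i) ≤ d₂ * attSq Z := by
    rw [attSq, Finset.mul_sum]
    exact Finset.sum_le_sum fun i _ => (hat1 i).2.1
  have hsq0 := attSq_nonneg Z
  have hX2 : 0 ≤ X ^ 2 := sq_nonneg X
  have hVu : V₀ Z.1 + μ * ∑ i, attLyap kR (ε i) (p.J i) (Z.2.1 i) (Z.2.2 i) ≤
      b' * (X ^ 2 + attSq Z) := by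
    have h1 := mul_le_mul_of_nonneg_left hs₂ hμ0.le
    have h2 : 0 ≤ μ * d₂ * X ^ 2 := by positivity
    have h3 : 0 ≤ b * attSq Z := by positivity
    rw [hb']
    linarith
  refine ⟨?_, hVu.trans ?_, fun θ hθ y I t hyt hy => ?_⟩
  · have h1 := mul_le_mul_of_nonneg_left (norm_sq_sub_fullEq_le Z) ha0.le
    have h2 := mul_le_mul_of_nonneg_right (min_le_left a (μ * d₁)) hX2
    have h3 := mul_le_mul_of_nonneg_right (min_le_right a (μ * d₁)) hsq0
    have h4 := mul_le_mul_of_nonneg_left hs₁ hμ0.le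
    linarith
  · rw [mul_assoc]
    refine mul_le_mul_of_nonneg_left ?_ hb0.le
    have h1 := attSq_le Z
    have h2 := pow_le_pow_left₀ (norm_nonneg _) (norm_outer_sub_le Z) 2
    linarith
  · obtain ⟨hdev1, hdev2⟩ := hdev θ hθ Z hZ (hZr.trans hrr₀)
    have hy1 : HasDerivWithinAt (fun τ => (y τ).1) (outerClosed p Kx Kv (θ, Z)) I t :=
      hasDerivWithinAt_fst hy
    have hy2 : HasDerivWithinAt (fun τ => (y τ).2) (closedField p Kx Kv kR kΩ (θ, Z)).2 I t :=
      hasDerivWithinAt_snd hy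
    have hy3 : HasDerivWithinAt (fun τ => (y τ).2.1) (closedField p Kx Kv kR kΩ (θ, Z)).2.1 I t :=
      hasDerivWithinAt_fst hy2
    have hy4 : HasDerivWithinAt (fun τ => (y τ).2.2) (closedField p Kx Kv kR kΩ (θ, Z)).2.2 I t :=
      hasDerivWithinAt_snd hy2
    have hQ := hasDerivWithinAt_pi.mp hy3
    have he := hasDerivWithinAt_pi.mp hy4
    obtain ⟨V', hV', hle⟩ := hder (thrustDev p Kx Kv θ.1 Z)
      ((hdev2.trans (mul_le_mul_of_nonneg_left hZr hC)).trans_lt hCr) _ I t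
      (congrArg Prod.fst hyt) hy1
    set w : Fin n → V3 := fun i => (Z.2.1 i)ᵀ *ᵥ cmdAngVel p Kx Kv (θ, Z) i with hw
    have hL : ∀ i, HasDerivWithinAt (fun τ => attLyap kR (ε i) (p.J i) ((y τ).2.1 i) ((y τ).2.2 i))
        (attLyapDeriv kR (ε i) (p.J i) (Z.2.1 i) (Z.2.2 i)
          (attRhs kR kΩ (p.J i) (Z.2.1 i) (w i) (Z.2.2 i))) I t := fun i => by
      have hQi := hQ i
      have := hasDerivWithinAt_attLyap (kR := kR) (ε := ε i) (PosDef.transpose_eq (p.J_pos i))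
        (Q := fun τ => (y τ).2.1 i) (e := fun τ => (y τ).2.2 i)
        (by simp only [hyt]; exact hQ i) (he i) (PosDef.mulVec_inv_mulVec (p.J_pos i) _)
      simp only [hyt] at this
      exact this
    refine ⟨_, hV'.fun_add ((HasDerivWithinAt.fun_sum fun i _ => hL i).const_mul μ), ?_⟩
    have h1 : ∑ i, attLyapDeriv kR (ε i) (p.J i) (Z.2.1 i) (Z.2.2 i)
        (attRhs kR kΩ (p.J i) (Z.2.1 i) (w i) (Z.2.2 i)) ≤ -β * attSq Z := by
      rw [attSq, Finset.mul_sum]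
      refine Finset.sum_le_sum fun i _ => (hat1 i).2.2 _ (hang θ hθ Z hZ (hZr.trans hrr₀) i) ?_
      exact (norm_angVel_le Z i).trans (hZr.trans (hr2.trans (by norm_num)))
    have h2 := mul_le_mul_of_nonneg_left h1 hμ0.le
    have h3 : K * X * ‖thrustDev p Kx Kv θ.1 Z‖ ≤ K * C * X * √(attSq Z) := by
      have := mul_le_mul_of_nonneg_left hdev1 (mul_nonneg hK0 (norm_nonneg (Z.1 - outerEq ν)))
      rw [← hX] at this
      linarith
    have h4 := mul_mul_le_of_pos hc (K * C) X (√(attSq Z))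
    rw [Real.sq_sqrt hsq0] at h4
    have h5 : μ * (-β * attSq Z) = -((K * C) ^ 2 / (2 * c) * attSq Z) - attSq Z := by
      linear_combination -attSq Z * hμβ
    have h6 := mul_le_mul_of_nonneg_right (min_le_left (c / 2) 1) hX2
    have h7 := mul_le_mul_of_nonneg_right (min_le_right (c / 2) 1) hsq0
    have h8 := mul_le_mul_of_nonneg_left hVu (show 0 ≤ c' / b' by positivity)
    rw [← mul_assoc, div_mul_cancel₀ _ hb0.ne'] at h8
    have e1 : -(2 * (c' / b' / 2)) = -(c' / b') := by ring
    rw [e1]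
    linarith

/-! ## Motions of the closed loop as solutions of the differential equation -/

theorem hat_transpose (w : V3) : (hat w)ᵀ = -hat w := by
  ext a b
  fin_cases a <;> fin_cases b <;> simp [hat]

theorem hat_sub (v w : V3) : hat (v - w) = hat v - hat w := by
  ext a b
  fin_cases a <;> fin_cases b <;> simp [hat] <;> ring

theorem hat_add (v w : V3) : hat (v + w) = hat v + hat w := by
  ext a b
  fin_cases a <;> fin_cases b <;> simp [hat] <;> ring

theorem SO3.hat_mul {Q : Mat3} (hQ : Q ∈ SO3) (w : V3) : hat w * Q = Q * hat (Qᵀ *ᵥ w) := by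
  rw [← SO3.hat_mulVec_mul hQ, Matrix.mulVec_mulVec, SO3.mul_transpose hQ, Matrix.one_mulVec]

section

variable {I : Set ℝ} {t : ℝ}

/-- Moving the hat of `w` through the rotation `R_cᵀ R` conjugates its argument. The result is `Q̇ =
Q ê` with `e` the angular velocity error. -/
theorem hasDerivWithinAt_relAtt {Rc R : ℝ → Mat3} {w W : V3}
    (hRc : HasDerivWithinAt Rc (Rc t * hat w) I t) (hR : HasDerivWithinAt R (R t * hat W) I t)
    (hRc' : Rc t ∈ SO3) (hR' : R t ∈ SO3) :
    HasDerivWithinAt (fun τ => (Rc τ)ᵀ * R τ)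
      ((Rc t)ᵀ * R t * hat (W - ((R t)ᵀ * Rc t) *ᵥ w)) I t := by
  refine (HasDerivWithinAt.matMul (HasDerivWithinAt.matTranspose hRc) hR).congr_deriv ?_
  have h := SO3.hat_mul (SO3.mul_mem (SO3.transpose_mem hRc') hR') w
  rw [Matrix.transpose_mul, Matrix.transpose_transpose] at h
  rw [Matrix.transpose_mul, hat_transpose, hat_sub, mul_sub, ← h, neg_mul, neg_mul]
  simp only [Matrix.mul_assoc]
  abel

theorem hasDerivWithinAt_transpose_mulVec {Q : ℝ → Mat3} {w : ℝ → V3} {e dw : V3}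
    (hQ : HasDerivWithinAt Q (Q t * hat e) I t) (hw : HasDerivWithinAt w dw I t) :
    HasDerivWithinAt (fun τ => (Q τ)ᵀ *ᵥ w τ)
      (-(e ⨯₃ ((Q t)ᵀ *ᵥ w t)) + (Q t)ᵀ *ᵥ dw) I t := by
  refine (HasDerivWithinAt.mulVec (HasDerivWithinAt.matTranspose hQ) hw).congr_deriv ?_
  rw [Matrix.transpose_mul, hat_transpose, ← Matrix.mulVec_mulVec, Matrix.neg_mulVec, hat_mulVec]

end

/-- The vector subtracted from `dΩ` is the derivative of `Qᵀ Ω_c`, as in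
`hasDerivWithinAt_transpose_mulVec`. After substituting `Ω = e + Qᵀ Ω_c`, the feedforward terms of
the moment cancel. -/
theorem moment_iff {kR kΩ : ℝ} {J Rc R : Mat3} {w dw Ω dΩ : V3} :
    J *ᵥ dΩ + Ω ⨯₃ (J *ᵥ Ω) = moment kR kΩ J Rc R w dw Ω ↔
      J *ᵥ (dΩ - (-(angVelErr Rc R w Ω ⨯₃ ((Rcᵀ * R)ᵀ *ᵥ w)) + (Rcᵀ * R)ᵀ *ᵥ dw)) =
        attRhs kR kΩ J (Rcᵀ * R) ((Rcᵀ * R)ᵀ *ᵥ w) (angVelErr Rc R w Ω) := by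
  have hT : (Rcᵀ * R)ᵀ = Rᵀ * Rc := by rw [Matrix.transpose_mul, Matrix.transpose_transpose]
  rw [hT, moment, attRhs, attErr_eq Rc R]
  set e := angVelErr Rc R w Ω with he
  set v := (Rᵀ * Rc) *ᵥ w with hv
  have hΩ : Ω = e + v := by rw [he, angVelErr, sub_add_cancel]
  rw [hΩ]
  simp only [Matrix.mulVec_add, Matrix.mulVec_sub, Matrix.mulVec_neg, map_add,
    LinearMap.add_apply]
  constructor
  · intro h
    linear_combination (norm := module) h
  · intro h
    linear_combination (norm := module) h

/-! ### The state of the closed loop -/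

/-- The state of payload and links. -/
def ofState (xd : V3) (s : State n ν) : Outer ν := (s.x0 - xd, s.v0, s.R0, s.Ω0, s.q, s.ω)

theorem linPos_eq (xd : V3) (s : State n ν) : linPos xd s = posCoord (ofState xd s) := by
  funext x
  rcases x with c | c | ⟨i, j, c⟩ <;> rfl

theorem linVel_eq (xd : V3) (s : State n ν) : linVel s = velCoord (ofState xd s) := by
  funext x
  rcases x with c | c | ⟨i, j, c⟩ <;> rfl

variable {p : Params n ν} {Kx Kv : Matrix (Fin n × Fin 3) (LinIdx ν) ℝ} {xd : V3}

theorem idealThrust_eq (s : State n ν) (i : Fin n) :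
    idealThrust p Kx Kv xd s i = thrust p Kx Kv (ofState xd s) i := by
  funext a
  simp only [idealThrust, thrust, thrustEq, linPos_eq xd, linVel_eq xd, feedback_apply,
    Pi.add_apply, Pi.sub_apply]
  ring

theorem cmdAttitude_eq (b1 : Fin n → ℝ → V3) (t : ℝ) (s : State n ν) (i : Fin n) :
    cmdAttitude p Kx Kv xd b1 t s i = cmdAtt p Kx Kv (fun i => b1 i t) (ofState xd s) i := by
  rw [cmdAttitude, idealThrust_eq]
  rfl

variable (p Kx Kv xd) in
/-- The state of the closed loop, with angular velocity errors `e`. -/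
def fullOf (b : Fin n → V3) (s : State n ν) (e : Fin n → V3) : Full ν :=
  (ofState xd s, fun i => (cmdAtt p Kx Kv b (ofState xd s) i)ᵀ * s.R i, e)

/-- The Euclidean size of the tracking errors. -/
def fullErr (Z : Full ν) : ℝ :=
  √(vnorm Z.1.1 ^ 2 + vnorm Z.1.2.1 ^ 2 + vnorm (attErr 1 Z.1.2.2.1) ^ 2 + vnorm Z.1.2.2.2.1 ^ 2
    + (∑ i, ∑ j, (vnorm (Z.1.2.2.2.2.1 i j - e3) ^ 2 + vnorm (Z.1.2.2.2.2.2 i j) ^ 2))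
    + ∑ i, (vnorm (attErr 1 (Z.2.1 i)) ^ 2 + vnorm (Z.2.2 i) ^ 2))

theorem trackErr_eq (b1 : Fin n → ℝ → V3) (t : ℝ) (s : State n ν) (e : Fin n → V3) :
    trackErr xd s (fun i => cmdAttitude p Kx Kv xd b1 t s i) e =
      fullErr (fullOf p Kx Kv xd (fun i => b1 i t) s e) := by
  rw [trackErr, fullErr]
  simp only [cmdAttitude_eq, attErr_eq (cmdAtt _ _ _ _ _ _)]
  rfl

theorem inDomain_iff (b1 : Fin n → ℝ → V3) (t : ℝ) (s : State n ν) (e : Fin n → V3) :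
    InDomain s (fun i => cmdAttitude p Kx Kv xd b1 t s i) ↔
      attPsi 1 (fullOf p Kx Kv xd (fun i => b1 i t) s e).1.2.2.1 < 1 ∧
      ∀ i, attPsi 1 ((fullOf p Kx Kv xd (fun i => b1 i t) s e).2.1 i) < 1 := by
  rw [InDomain]
  simp only [cmdAttitude_eq, attPsi_eq (cmdAtt _ _ _ _ _ _)]
  rfl

theorem vnorm_sq_le (v : V3) : vnorm v ^ 2 ≤ 3 * ‖v‖ ^ 2 := by
  rw [sq_vnorm]
  exact dotProduct_self_le v

theorem sqrt_le_sqrt_mul {a c x : ℝ} (hc : 0 ≤ c) (hx : 0 ≤ x) (h : a ≤ c * x ^ 2) :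
    √a ≤ √c * x := by
  rw [← Real.sqrt_sq hx, ← Real.sqrt_mul hc]
  exact Real.sqrt_le_sqrt h

theorem exists_fullErr_le (ν : Fin n → ℕ) :
    ∃ C > 0, ∀ Z : Full ν, fullErr Z ≤ C * ‖Z - fullEq ν‖ := by
  -- Each squared Euclidean norm costs a factor 3: four vectors of the payload, two for every link
  -- and two for every quadrotor.
  refine ⟨√(12 + (∑ i : Fin n, ∑ _j : Fin (ν i), 6) + ∑ _i : Fin n, 6), ?_, fun Z => ?_⟩
  · apply Real.sqrt_pos_of_pos
    positivity
  have hc : (0 : ℝ) ≤ 12 + (∑ i : Fin n, ∑ _j : Fin (ν i), 6) + ∑ _i : Fin n, 6 := by positivity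
  set X := ‖Z - fullEq ν‖ with hX
  have hv : ∀ v : V3, ‖v‖ ≤ X → vnorm v ^ 2 ≤ 3 * X ^ 2 := fun v h =>
    (vnorm_sq_le v).trans (by gcongr)
  have hv0 : ∀ v : V3, ‖v - 0‖ ≤ X → vnorm v ^ 2 ≤ 3 * X ^ 2 := fun v h =>
    hv v (by rwa [sub_zero] at h)
  have h0 : ‖Z.1 - outerEq ν‖ ≤ X := norm_outer_sub_le Z
  have h2 : ‖(Z.1 - outerEq ν).2‖ ≤ X := (norm_snd_le _).trans h0
  have h3 : ‖(Z.1 - outerEq ν).2.2‖ ≤ X := (norm_snd_le _).trans h2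
  have h4 : ‖(Z.1 - outerEq ν).2.2.2‖ ≤ X := (norm_snd_le _).trans h3
  have h5 : ‖(Z.1 - outerEq ν).2.2.2.2‖ ≤ X := (norm_snd_le _).trans h4
  have a1 := hv0 Z.1.1 ((norm_fst_le (Z.1 - outerEq ν)).trans h0)
  have a2 := hv0 Z.1.2.1 ((norm_fst_le (Z.1 - outerEq ν).2).trans h2)
  have a3 := hv (attErr 1 Z.1.2.2.1)
    ((norm_attErr_one_le_sub_one _).trans ((norm_fst_le (Z.1 - outerEq ν).2.2).trans h3))
  have a4 := hv0 Z.1.2.2.2.1 ((norm_fst_le (Z.1 - outerEq ν).2.2.2).trans h4)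
  have a5 : ∀ i j, vnorm (Z.1.2.2.2.2.1 i j - e3) ^ 2 ≤ 3 * X ^ 2 := fun i j => hv _
    ((norm_le_pi_norm ((Z.1 - outerEq ν).2.2.2.2.1 i) j).trans
      ((norm_le_pi_norm (Z.1 - outerEq ν).2.2.2.2.1 i).trans ((norm_fst_le _).trans h5)))
  have a6 : ∀ i j, vnorm (Z.1.2.2.2.2.2 i j) ^ 2 ≤ 3 * X ^ 2 := fun i j => hv0 _
    ((norm_le_pi_norm ((Z.1 - outerEq ν).2.2.2.2.2 i) j).trans
      ((norm_le_pi_norm (Z.1 - outerEq ν).2.2.2.2.2 i).trans ((norm_snd_le _).trans h5)))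
  have a7 : ∀ i, vnorm (attErr 1 (Z.2.1 i)) ^ 2 ≤ 3 * X ^ 2 := fun i => hv _
    ((norm_attErr_one_le_sub_one _).trans (norm_rot_sub_le Z i))
  have a8 : ∀ i, vnorm (Z.2.2 i) ^ 2 ≤ 3 * X ^ 2 := fun i => hv _ (norm_angVel_le Z i)
  have b1 : ∑ i, ∑ j, (vnorm (Z.1.2.2.2.2.1 i j - e3) ^ 2 + vnorm (Z.1.2.2.2.2.2 i j) ^ 2) ≤
      (∑ i : Fin n, ∑ _j : Fin (ν i), 6) * X ^ 2 := by
    simp only [Finset.sum_mul]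
    exact Finset.sum_le_sum fun i _ => Finset.sum_le_sum fun j _ => by
      linarith [a5 i j, a6 i j]
  have b2 : ∑ i, (vnorm (attErr 1 (Z.2.1 i)) ^ 2 + vnorm (Z.2.2 i) ^ 2) ≤
      (∑ _i : Fin n, 6) * X ^ 2 := by
    simp only [Finset.sum_mul]
    exact Finset.sum_le_sum fun i _ => by linarith [a7 i, a8 i]
  have hX0 : 0 ≤ X := norm_nonneg _
  refine sqrt_le_sqrt_mul hc hX0 ?_
  rw [add_mul, add_mul]
  refine add_le_add (add_le_add ?_ b1) b2
  linarith

theorem norm_le_of_sq_le {v : V3} {s : ℝ} (h : vnorm v ^ 2 ≤ s) : ‖v‖ ≤ √s :=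
  Real.le_sqrt_of_sq_le ((pow_le_pow_left₀ (norm_nonneg _) (norm_le_vnorm v) 2).trans h)

theorem norm_sub_zero_le_of_sq_le {v : V3} {s : ℝ} (h : vnorm v ^ 2 ≤ s) : ‖v - 0‖ ≤ √s := by
  rw [sub_zero]
  exact norm_le_of_sq_le h

/-- The tracking error contains `e_R` instead of `R0 - 1`. As `e_R` also vanishes at rotations by
`π`, the condition `Ψ < 1` is needed, and `SO3.norm_sub_one_le_attErr` produces the factor 4. -/
theorem OuterAdm.norm_sub_le_fullErr {Z : Full ν} (hZ : OuterAdm Z.1)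
    (hΨ : attPsi 1 Z.1.2.2.1 < 1) : ‖Z.1 - outerEq ν‖ ≤ 4 * fullErr Z := by
  have hE0 : 0 ≤ fullErr Z := Real.sqrt_nonneg _
  have hS : 0 ≤ ∑ i, ∑ j, (vnorm (Z.1.2.2.2.2.1 i j - e3) ^ 2 + vnorm (Z.1.2.2.2.2.2 i j) ^ 2) :=
    Finset.sum_nonneg fun i _ => Finset.sum_nonneg fun j _ => by positivity
  have hS' : 0 ≤ ∑ i, (vnorm (attErr 1 (Z.2.1 i)) ^ 2 + vnorm (Z.2.2 i) ^ 2) :=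
    Finset.sum_nonneg fun i _ => by positivity
  have hij : ∀ i j, vnorm (Z.1.2.2.2.2.1 i j - e3) ^ 2 + vnorm (Z.1.2.2.2.2.2 i j) ^ 2 ≤
      ∑ i, ∑ j, (vnorm (Z.1.2.2.2.2.1 i j - e3) ^ 2 + vnorm (Z.1.2.2.2.2.2 i j) ^ 2) :=
    fun i j => (Finset.single_le_sum (f := fun j => vnorm (Z.1.2.2.2.2.1 i j - e3) ^ 2 +
      vnorm (Z.1.2.2.2.2.2 i j) ^ 2) (fun j _ => by positivity) (Finset.mem_univ j)).trans
      (Finset.single_le_sum (f := fun i => ∑ j, (vnorm (Z.1.2.2.2.2.1 i j - e3) ^ 2 +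
      vnorm (Z.1.2.2.2.2.2 i j) ^ 2)) (fun i _ => Finset.sum_nonneg fun j _ => by positivity)
      (Finset.mem_univ i))
  have s1 := sq_nonneg (vnorm Z.1.1)
  have s2 := sq_nonneg (vnorm Z.1.2.1)
  have s3 := sq_nonneg (vnorm (attErr 1 Z.1.2.2.1))
  have s4 := sq_nonneg (vnorm Z.1.2.2.2.1)
  have h4 : ∀ {x : ℝ}, x ≤ fullErr Z → x ≤ 4 * fullErr Z := fun h => by linarith
  have hnn : 0 ≤ 4 * fullErr Z := by positivity
  refine max_le (h4 ?_) (max_le (h4 ?_) (max_le ?_ (max_le (h4 ?_) (max_le ?_ ?_))))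
  · exact norm_sub_zero_le_of_sq_le (v := Z.1.1) (by linarith)
  · exact norm_sub_zero_le_of_sq_le (v := Z.1.2.1) (by linarith)
  · refine (SO3.norm_sub_one_le_attErr hZ.R0_mem hΨ).trans ?_
    exact mul_le_mul_of_nonneg_left (norm_le_of_sq_le (by linarith)) (by norm_num)
  · exact norm_sub_zero_le_of_sq_le (v := Z.1.2.2.2.1) (by linarith)
  · refine (pi_norm_le_iff_of_nonneg hnn).mpr fun i =>
      (pi_norm_le_iff_of_nonneg hnn).mpr fun j => h4 (norm_le_of_sq_le ?_)
    have := hij i j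
    have := sq_nonneg (vnorm (Z.1.2.2.2.2.2 i j))
    change vnorm (Z.1.2.2.2.2.1 i j - e3) ^ 2 ≤ _
    linarith
  · refine (pi_norm_le_iff_of_nonneg hnn).mpr fun i =>
      (pi_norm_le_iff_of_nonneg hnn).mpr fun j => h4 (norm_le_of_sq_le ?_)
    have := hij i j
    have := sq_nonneg (vnorm (Z.1.2.2.2.2.1 i j - e3))
    change vnorm (Z.1.2.2.2.2.2 i j - 0) ^ 2 ≤ _
    rw [sub_zero]
    linarith

theorem FullAdm.norm_sub_le_fullErr {Z : Full ν} (hZ : FullAdm Z) (hΨ : attPsi 1 Z.1.2.2.1 < 1)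
    (hΨ' : ∀ i, attPsi 1 (Z.2.1 i) < 1) : ‖Z - fullEq ν‖ ≤ 4 * fullErr Z := by
  have hE0 : 0 ≤ fullErr Z := Real.sqrt_nonneg _
  have hS : 0 ≤ ∑ i, ∑ j, (vnorm (Z.1.2.2.2.2.1 i j - e3) ^ 2 + vnorm (Z.1.2.2.2.2.2 i j) ^ 2) :=
    Finset.sum_nonneg fun i _ => Finset.sum_nonneg fun j _ => by positivity
  have hi : ∀ i, vnorm (attErr 1 (Z.2.1 i)) ^ 2 + vnorm (Z.2.2 i) ^ 2 ≤
      ∑ i, (vnorm (attErr 1 (Z.2.1 i)) ^ 2 + vnorm (Z.2.2 i) ^ 2) :=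
    fun i => Finset.single_le_sum (f := fun i => vnorm (attErr 1 (Z.2.1 i)) ^ 2 +
      vnorm (Z.2.2 i) ^ 2) (fun i _ => by positivity) (Finset.mem_univ i)
  have s1 := sq_nonneg (vnorm Z.1.1)
  have s2 := sq_nonneg (vnorm Z.1.2.1)
  have s3 := sq_nonneg (vnorm (attErr 1 Z.1.2.2.1))
  have s4 := sq_nonneg (vnorm Z.1.2.2.2.1)
  refine norm_sub_fullEq_le (by positivity) (hZ.outer.norm_sub_le_fullErr hΨ) (fun i => ?_)
    fun i => ?_
  · refine (SO3.norm_sub_one_le_attErr (hZ.Q_mem i) (hΨ' i)).trans ?_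
    refine mul_le_mul_of_nonneg_left (norm_le_of_sq_le ?_) (by norm_num)
    linarith [hi i, sq_nonneg (vnorm (Z.2.2 i))]
  · have h : ‖Z.2.2 i‖ ≤ fullErr Z :=
      norm_le_of_sq_le (by linarith [hi i, sq_nonneg (vnorm (attErr 1 (Z.2.1 i)))])
    linarith

/-! ### From motions to solutions -/

section Motion

variable {kR kΩ : ℝ} {b1 : Fin n → ℝ → V3} {I : Set ℝ} {s : ℝ → State n ν}
  {Ω Ωc : ℝ → Fin n → V3} {t : ℝ}

variable (b1) in
/-- The values of `b₁` and its derivative at time `t`. -/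
def refAt (t : ℝ) : Ref n := (fun i => b1 i t, fun i => deriv (b1 i) t)

theorem State.Admissible.outerAdm {s : State n ν} (h : s.Admissible) :
    OuterAdm (ofState xd s) := ⟨h.R0_mem, h.q_unit, h.q_ω⟩

theorem State.Admissible.fullAdm {s : State n ν} (h : s.Admissible) {b : Fin n → V3}
    (hb : ∀ i, thrust p Kx Kv (ofState xd s) i ⨯₃ b i ≠ 0) (e : Fin n → V3) :
    FullAdm (fullOf p Kx Kv xd b s e) :=
  ⟨h.outerAdm, fun i => SO3.mul_mem (SO3.transpose_mem (desiredAttitude_mem_SO3 (hb i)))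
    (h.R_mem i)⟩

theorem IsMotion.cross_ne_zero (h : IsMotion p Kx Kv kR kΩ xd b1 I s Ω Ωc) (ht : t ∈ I)
    (i : Fin n) : thrust p Kx Kv (ofState xd (s t)) i ⨯₃ b1 i t ≠ 0 := by
  have h1 := h.thrust_ne_zero t ht i
  have h2 := h.axes_ne_zero t ht i
  rw [idealThrust_eq] at h1 h2
  exact cross_ne_zero_iff.mpr ⟨h1, h2⟩

variable (p Kx Kv xd b1 s Ω Ωc) in
/-- The state of the closed loop along a motion. -/
def fullPath (τ : ℝ) : Full ν :=
  fullOf p Kx Kv xd (fun i => b1 i τ) (s τ) fun i =>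
    angVelErr (cmdAttitude p Kx Kv xd b1 τ (s τ) i) ((s τ).R i) (Ωc τ i) (Ω τ i)

theorem IsMotion.fullAdm (h : IsMotion p Kx Kv kR kΩ xd b1 I s Ω Ωc) (ht : t ∈ I) :
    FullAdm (fullPath p Kx Kv xd b1 s Ω Ωc t) :=
  (h.admissible t ht).fullAdm (h.cross_ne_zero ht) _

/-- No regularity of the inertia operator is needed, so this applies along the whole motion and
provides the continuity of the path before the motion is known to stay near the equilibrium. -/
theorem IsMotion.exists_hasDerivWithinAt (h : IsMotion p Kx Kv kR kΩ xd b1 I s Ω Ωc)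
    (ht : t ∈ I) : ∃ (a : Accel n ν) (e' : Fin n → V3),
      HasDerivWithinAt (fullPath p Kx Kv xd b1 s Ω Ωc)
        (((s t).v0, a.v0, (s t).R0 * hat (s t).Ω0, a.Ω0,
          fun i j => (s t).ω i j ⨯₃ (s t).q i j, a.ω),
          fun i => (fullPath p Kx Kv xd b1 s Ω Ωc t).2.1 i *
            hat ((fullPath p Kx Kv xd b1 s Ω Ωc t).2.2 i), e') I t ∧
      Motion p (s t) (fun i => -(idealThrust p Kx Kv xd (s t) i ⬝ᵥ ((s t).R i *ᵥ e3))) a ∧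
      ∀ i, p.J i *ᵥ e' i = attRhs kR kΩ (p.J i) ((fullPath p Kx Kv xd b1 s Ω Ωc t).2.1 i)
        (((fullPath p Kx Kv xd b1 s Ω Ωc t).2.1 i)ᵀ *ᵥ Ωc t i)
        ((fullPath p Kx Kv xd b1 s Ω Ωc t).2.2 i) := by
  obtain ⟨a, ha1, ha2, ha3, hm⟩ := h.dynamics t ht
  choose dΩ dΩc hΩ hΩc hmom using h.attitude_dynamics t ht
  set Rc : Fin n → ℝ → Mat3 := fun i τ => cmdAttitude p Kx Kv xd b1 τ (s τ) i with hRcdef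
  have hRc : ∀ i, HasDerivWithinAt (Rc i) (Rc i t * hat (Ωc t i)) I t := fun i =>
    hasDerivWithinAt_mat.mpr (h.deriv_Rc t ht i)
  have hR : ∀ i, HasDerivWithinAt (fun τ => (s τ).R i) ((s t).R i * hat (Ω t i)) I t := fun i =>
    hasDerivWithinAt_mat.mpr (h.deriv_R t ht i)
  have hRcm : ∀ i, Rc i t ∈ SO3 := fun i => by
    simp only [hRcdef, cmdAttitude_eq]
    exact desiredAttitude_mem_SO3 (h.cross_ne_zero ht i)
  have hQ := fun i => hasDerivWithinAt_relAtt (hRc i) (hR i) (hRcm i)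
    ((h.admissible t ht).R_mem i)
  have hT : ∀ i τ, ((Rc i τ)ᵀ * (s τ).R i)ᵀ = ((s τ).R i)ᵀ * Rc i τ := fun i τ => by
    rw [Matrix.transpose_mul, Matrix.transpose_transpose]
  have hw := fun i => hasDerivWithinAt_transpose_mulVec (hQ i) (hΩc i)
  have hE : fullPath p Kx Kv xd b1 s Ω Ωc = fun τ => (ofState xd (s τ),
      fun i => (Rc i τ)ᵀ * (s τ).R i,
      fun i => Ω τ i - ((Rc i τ)ᵀ * (s τ).R i)ᵀ *ᵥ Ωc τ i) := by
    funext τ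
    simp only [fullPath, fullOf, hRcdef, cmdAttitude_eq, angVelErr, Matrix.transpose_mul,
      Matrix.transpose_transpose]
  refine ⟨a, fun i => dΩ i - (-(angVelErr (Rc i t) ((s t).R i) (Ωc t i) (Ω t i) ⨯₃
    (((Rc i t)ᵀ * (s t).R i)ᵀ *ᵥ Ωc t i)) + ((Rc i t)ᵀ * (s t).R i)ᵀ *ᵥ dΩc i), ?_, hm, ?_⟩
  · rw [hE]
    refine HasDerivWithinAt.prodMk ?_ (HasDerivWithinAt.prodMk ?_ ?_)
    · refine HasDerivWithinAt.prodMk ((h.deriv_x0 t ht).sub_const xd) (HasDerivWithinAt.prodMk ha1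
        (HasDerivWithinAt.prodMk (hasDerivWithinAt_mat.mpr (h.deriv_R0 t ht))
        (HasDerivWithinAt.prodMk ha2 (HasDerivWithinAt.prodMk ?_ ?_))))
      · exact hasDerivWithinAt_pi.mpr fun i => hasDerivWithinAt_pi.mpr fun j => h.deriv_q t ht i j
      · exact hasDerivWithinAt_pi.mpr fun i => hasDerivWithinAt_pi.mpr fun j => ha3 i j
    · refine hasDerivWithinAt_pi.mpr fun i => ?_
      simp only [hT]
      exact hQ i
    · exact hasDerivWithinAt_pi.mpr fun i => (hΩ i).fun_sub (hw i)
  · intro i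
    have := moment_iff.mp (hmom i)
    simp only [hE, Matrix.transpose_mul, Matrix.transpose_transpose] at this ⊢
    exact this

theorem IsMotion.hasDerivWithinAt (h : IsMotion p Kx Kv kR kΩ xd b1 I s Ω Ωc)
    (hI : UniqueDiffOn ℝ I) (hb : ∀ i, Differentiable ℝ (b1 i)) (ht : t ∈ I)
    (hreg : ofState xd (s t) ∈ regularSet p) :
    HasDerivWithinAt (fullPath p Kx Kv xd b1 s Ω Ωc)
      (closedField p Kx Kv kR kΩ (refAt b1 t, fullPath p Kx Kv xd b1 s Ω Ωc t)) I t := by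
  obtain ⟨a, e', hd, hm, he'⟩ := h.exists_hasDerivWithinAt ht
  have hadm := h.admissible t ht
  have hcross := h.cross_ne_zero ht
  have hRc : ∀ i, cmdAtt p Kx Kv (fun i => b1 i t) (ofState xd (s t)) i ∈ SO3 := fun i =>
    desiredAttitude_mem_SO3 (hcross i)
  -- Differentiating the constraint `q · ω = 0`, where `(ω × q) · ω = 0`.
  have hqω : ∀ i j, (s t).q i j ⬝ᵥ a.ω i j = 0 := fun i j => by
    have h1 := hasDerivWithinAt_snd (hasDerivWithinAt_snd (hasDerivWithinAt_snd
      (hasDerivWithinAt_snd (hasDerivWithinAt_fst hd))))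
    have h2 := hasDerivWithinAt_pi.mp (hasDerivWithinAt_pi.mp (hasDerivWithinAt_fst h1) i) j
    have h3 := hasDerivWithinAt_pi.mp (hasDerivWithinAt_pi.mp (hasDerivWithinAt_snd h1) i) j
    have h4 := HasDerivWithinAt.dotV3 h2 h3
    have h5 : HasDerivWithinAt (fun τ => (fullPath p Kx Kv xd b1 s Ω Ωc τ).1.2.2.2.2.1 i j ⬝ᵥ
        (fullPath p Kx Kv xd b1 s Ω Ωc τ).1.2.2.2.2.2 i j) 0 I t :=
      (hasDerivWithinAt_const t I (0 : ℝ)).congr (fun τ hτ => (h.admissible τ hτ).q_ω i j)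
        ((h.admissible t ht).q_ω i j)
    have h6 := (hI t ht).eq_deriv _ h4 h5
    simp only [dotProduct_comm ((s t).ω i j ⨯₃ (s t).q i j)] at h6
    change (s t).ω i j ⬝ᵥ ((s t).ω i j ⨯₃ (s t).q i j) + (s t).q i j ⬝ᵥ a.ω i j = 0 at h6
    rwa [dot_self_cross, zero_add] at h6
  -- The offset `thrustDev` is the actual minus the ideal thrust, so equilibrium thrust, feedback
  -- and offset add up to `-fᵢ Rᵢ e3`.
  have hacc : acc p (ofState xd (s t)) (feedback Kx Kv (ofState xd (s t)) +
      thrustDev p Kx Kv (fun i => b1 i t) (fullPath p Kx Kv xd b1 s Ω Ωc t)) =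
      (a.v0, a.Ω0, a.ω) := by
    rw [acc_eq_iff hreg]
    have h1 := (motion_iff hadm.q_unit hqω).mp hm
    refine h1.trans ?_
    change forcing p (s t).R0 (s t).Ω0 (s t).q (s t).ω _ = forcing p (s t).R0 (s t).Ω0 (s t).q
      (s t).ω _
    congr 1
    funext i
    have h2 : thrustDir p Kx Kv (fun i => b1 i t) (fullPath p Kx Kv xd b1 s Ω Ωc t) i =
        (s t).R i *ᵥ e3 := by
      change (cmdAtt p Kx Kv (fun i => b1 i t) (ofState xd (s t)) i *
        ((cmdAtt p Kx Kv (fun i => b1 i t) (ofState xd (s t)) i)ᵀ * (s t).R i)) *ᵥ e3 = _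
      rw [← Matrix.mul_assoc, SO3.mul_transpose (hRc i), Matrix.one_mul]
    rw [Pi.add_apply, ← add_assoc, idealThrust_eq, thrustDev, h2, neg_neg]
    change _ = thrust p Kx Kv (ofState xd (s t)) i +
      (_ - thrust p Kx Kv (ofState xd (s t)) i)
    rw [add_sub_cancel]
    rfl
  have hout : outerClosed p Kx Kv (refAt b1 t, fullPath p Kx Kv xd b1 s Ω Ωc t) =
      ((s t).v0, a.v0, (s t).R0 * hat (s t).Ω0, a.Ω0,
          fun i j => (s t).ω i j ⨯₃ (s t).q i j, a.ω) := by
    change outerField p (ofState xd (s t)) (feedback Kx Kv (ofState xd (s t)) +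
      thrustDev p Kx Kv (fun i => b1 i t) (fullPath p Kx Kv xd b1 s Ω Ωc t)) = _
    rw [outerField, hacc]
    rfl
  -- The chain rule and the definition of a motion both give the derivative of the desired attitude.
  -- Uniqueness of derivatives identifies `Ωc`.
  have hΩc : ∀ i, cmdAngVel p Kx Kv (refAt b1 t, fullPath p Kx Kv xd b1 s Ω Ωc t) i = Ωc t i := by
    intro i
    have h1 : HasDerivWithinAt (fun τ => thrust p Kx Kv (ofState xd (s τ)) i)
        (feedback Kx Kv (outerClosed p Kx Kv
          (refAt b1 t, fullPath p Kx Kv xd b1 s Ω Ωc t)) i) I t := by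
      rw [hout]
      have h2 := (feedback Kx Kv).hasFDerivAt.comp_hasDerivWithinAt t (hasDerivWithinAt_fst hd)
      exact (hasDerivWithinAt_pi.mp h2 i).const_add (thrustEq p i)
    have h2 : HasDerivWithinAt (fun τ => (thrust p Kx Kv (ofState xd (s τ)) i, b1 i τ)) _ I t :=
      h1.prodMk (hb i t).hasDerivAt.hasDerivWithinAt
    have h3 := ((contDiffAt_desiredAttitudeFun (k := 1)
      (w := (thrust p Kx Kv (ofState xd (s t)) i, b1 i t)) (hcross i)).differentiableAt
      one_ne_zero).hasFDerivAt.comp_hasDerivWithinAt t h2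
    have h4 : HasDerivWithinAt (fun τ => cmdAttitude p Kx Kv xd b1 τ (s τ) i)
        (cmdAttDeriv p Kx Kv (refAt b1 t, fullPath p Kx Kv xd b1 s Ω Ωc t) i) I t := by
      simp only [cmdAttitude_eq]
      exact h3
    have h5 := (hI t ht).eq_deriv _ h4 (hasDerivWithinAt_mat.mpr (h.deriv_Rc t ht i))
    rw [cmdAngVel, h5, cmdAttitude_eq]
    change vee ((cmdAtt p Kx Kv (fun i => b1 i t) (ofState xd (s t)) i)ᵀ *
      (cmdAtt p Kx Kv (fun i => b1 i t) (ofState xd (s t)) i * _)) = _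
    rw [← Matrix.mul_assoc, SO3.transpose_mul (hRc i), Matrix.one_mul, vee_hat]
  refine hd.congr_deriv ?_
  refine Prod.ext hout.symm (Prod.ext rfl (funext fun i => ?_))
  have hJ : e' i = (p.J i)⁻¹ *ᵥ (p.J i *ᵥ e' i) := by
    rw [Matrix.mulVec_mulVec, Matrix.nonsing_inv_mul _ (p.J_pos i).det_pos.ne'.isUnit,
      Matrix.one_mulVec]
  change e' i = (p.J i)⁻¹ *ᵥ attRhs kR kΩ (p.J i) ((fullPath p Kx Kv xd b1 s Ω Ωc t).2.1 i)
    (((fullPath p Kx Kv xd b1 s Ω Ωc t).2.1 i)ᵀ *ᵥ cmdAngVel p Kx Kv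
      (refAt b1 t, fullPath p Kx Kv xd b1 s Ω Ωc t) i) ((fullPath p Kx Kv xd b1 s Ω Ωc t).2.2 i)
  rw [hΩc, ← he' i]
  exact hJ

end Motion

/-! ## Existence of motions -/

theorem eq_of_hasDerivWithinAt_zero {F : Type*} [NormedAddCommGroup F] [NormedSpace ℝ F]
    {f : ℝ → F} {t₀ t : ℝ} (h : ∀ t ∈ Set.Ici t₀, HasDerivWithinAt f 0 (Set.Ici t₀) t)
    (ht : t ∈ Set.Ici t₀) : f t = f t₀ :=
  constant_of_has_deriv_right_zero (a := t₀) (b := t)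
    (fun τ hτ => (h τ hτ.1).continuousWithinAt.mono Set.Icc_subset_Ici_self)
    (fun τ hτ => (h τ hτ.1).mono (Set.Ici_subset_Ici.mpr hτ.1)) t ⟨ht, le_rfl⟩

theorem hat_smul (c : ℝ) (w : V3) : hat (c • w) = c • hat w := by
  ext a b
  fin_cases a <;> fin_cases b <;> simp [hat]

/-- `Q Qᵀ` has zero derivative since the hat matrix is skew. The determinant is continuous with
square 1 on a connected set, so it keeps its initial sign. -/
theorem SO3.mem_of_hasDerivWithinAt {Q : ℝ → Mat3} {w : ℝ → V3} {t₀ t : ℝ}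
    (h : ∀ t ∈ Set.Ici t₀, HasDerivWithinAt Q (Q t * hat (w t)) (Set.Ici t₀) t) (h₀ : Q t₀ ∈ SO3)
    (ht : t ∈ Set.Ici t₀) : Q t ∈ SO3 := by
  have horth : ∀ t ∈ Set.Ici t₀, Q t * (Q t)ᵀ = 1 := fun t ht => by
    rw [← SO3.mul_transpose h₀]
    refine eq_of_hasDerivWithinAt_zero (f := fun τ => Q τ * (Q τ)ᵀ) (fun τ hτ => ?_) ht
    refine (HasDerivWithinAt.matMul (h τ hτ)
      (HasDerivWithinAt.matTranspose (h τ hτ))).congr_deriv ?_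
    rw [Matrix.transpose_mul, hat_transpose, Matrix.mul_assoc, Matrix.neg_mul, Matrix.mul_neg,
      add_neg_cancel]
  have hcont : ContinuousOn (fun τ => (Q τ).det) (Set.Ici t₀) := fun τ hτ => by
    have hd := hasDerivWithinAt_mat.mp (h τ hτ)
    have hc : ContinuousWithinAt Q (Set.Ici t₀) τ := (h τ hτ).continuousWithinAt
    exact (Continuous.matrix_det continuous_id).continuousAt.comp_continuousWithinAt hc
  have hsq : Set.EqOn ((fun τ => (Q τ).det) ^ 2) (1 ^ 2) (Set.Ici t₀) := fun τ hτ => by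
    have := congrArg Matrix.det (horth τ hτ)
    rw [Matrix.det_mul, Matrix.det_transpose, Matrix.det_one] at this
    simpa [sq] using this
  refine SO3.mk (horth t ht) ?_
  rcases isPreconnected_Ici.eq_or_eq_neg_of_sq_eq hcont continuousOn_const hsq
    (fun _ => one_ne_zero) with h1 | h1
  · exact h1 ht
  · have h2 : (Q t₀).det = -1 := h1 (Set.self_mem_Ici (a := t₀))
    rw [SO3.det_eq h₀] at h2
    norm_num at h2

variable {p : Params n ν} {Kx Kv : Matrix (Fin n × Fin 3) (LinIdx ν) ℝ} {kR kΩ : ℝ}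

theorem outerClosed_dot_eq_zero {x : Ref n × Full ν} (hx : x ∈ closedDomain p Kx Kv)
    (hq : ∀ i j, x.2.1.2.2.2.2.1 i j ⬝ᵥ x.2.1.2.2.2.2.1 i j = 1) (i : Fin n) (j : Fin (ν i)) :
    x.2.1.2.2.2.2.1 i j ⬝ᵥ (outerClosed p Kx Kv x).2.2.2.2.2 i j = 0 :=
  dot_eq_zero_of_massOp_eq_forcing hq ((acc_eq_iff hx.1).mp rfl) i j

/-- The constraints are invariant, also when the vector field is multiplied by a function. -/
theorem fullAdm_of_hasDerivWithinAt {y : ℝ → Full ν} {c : ℝ → ℝ} {θ : ℝ → Ref n} {t₀ t : ℝ}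
    (h : ∀ t ∈ Set.Ici t₀, HasDerivWithinAt y (c t • closedField p Kx Kv kR kΩ (θ t, y t))
      (Set.Ici t₀) t) (hc : ∀ t, c t ≠ 0 → (θ t, y t) ∈ closedDomain p Kx Kv)
    (h₀ : FullAdm (y t₀)) (ht : t ∈ Set.Ici t₀) : FullAdm (y t) := by
  have d1 := fun t ht => hasDerivWithinAt_snd (hasDerivWithinAt_snd (hasDerivWithinAt_fst (h t ht)))
  have d2 := fun t ht => hasDerivWithinAt_snd (hasDerivWithinAt_snd (d1 t ht))
  have hq' : ∀ t ∈ Set.Ici t₀, ∀ i j, HasDerivWithinAt (fun τ => (y τ).1.2.2.2.2.1 i j)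
      (c t • ((y t).1.2.2.2.2.2 i j ⨯₃ (y t).1.2.2.2.2.1 i j)) (Set.Ici t₀) t := fun t ht i j =>
    hasDerivWithinAt_pi.mp (hasDerivWithinAt_pi.mp (hasDerivWithinAt_fst (d2 t ht)) i) j
  have hω' : ∀ t ∈ Set.Ici t₀, ∀ i j, HasDerivWithinAt (fun τ => (y τ).1.2.2.2.2.2 i j)
      (c t • (outerClosed p Kx Kv (θ t, y t)).2.2.2.2.2 i j) (Set.Ici t₀) t := fun t ht i j =>
    hasDerivWithinAt_pi.mp (hasDerivWithinAt_pi.mp (hasDerivWithinAt_snd (d2 t ht)) i) j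
  have hunit : ∀ t ∈ Set.Ici t₀, ∀ i j,
      (y t).1.2.2.2.2.1 i j ⬝ᵥ (y t).1.2.2.2.2.1 i j = 1 := fun t ht i j => by
    rw [← h₀.outer.q_unit i j]
    refine eq_of_hasDerivWithinAt_zero (f := fun τ => (y τ).1.2.2.2.2.1 i j ⬝ᵥ
      (y τ).1.2.2.2.2.1 i j) (fun τ hτ => ?_) ht
    refine (HasDerivWithinAt.dotV3 (hq' τ hτ i j) (hq' τ hτ i j)).congr_deriv ?_
    rw [dotProduct_comm, dotProduct_smul, dot_cross_self, smul_zero, add_zero]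
  refine ⟨⟨?_, hunit t ht, fun i j => ?_⟩, fun i => ?_⟩
  · refine SO3.mem_of_hasDerivWithinAt (Q := fun τ => (y τ).1.2.2.1)
      (w := fun τ => c τ • (y τ).1.2.2.2.1) (fun τ hτ => ?_) h₀.outer.R0_mem ht
    rw [hat_smul, Matrix.mul_smul]
    exact hasDerivWithinAt_fst (d1 τ hτ)
  · rw [← h₀.outer.q_ω i j]
    refine eq_of_hasDerivWithinAt_zero (f := fun τ => (y τ).1.2.2.2.2.1 i j ⬝ᵥ
      (y τ).1.2.2.2.2.2 i j) (fun τ hτ => ?_) ht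
    refine (HasDerivWithinAt.dotV3 (hq' τ hτ i j) (hω' τ hτ i j)).congr_deriv ?_
    rw [smul_dotProduct, dotProduct_comm (_ ⨯₃ _), dot_self_cross, smul_zero, zero_add,
      dotProduct_smul]
    -- Where the factor vanishes the state does not move; elsewhere the vector field is defined and
    -- its accelerations respect `q · ω̇ = 0`.
    by_cases hcτ : c τ = 0
    · rw [hcτ, zero_smul]
    · have := outerClosed_dot_eq_zero (hc τ hcτ) (hunit τ hτ) i j
      rw [this, smul_zero]
  · refine SO3.mem_of_hasDerivWithinAt (Q := fun τ => (y τ).2.1 i)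
      (w := fun τ => c τ • (y τ).2.2 i) (fun τ hτ => ?_) (h₀.Q_mem i) ht
    rw [hat_smul, Matrix.mul_smul]
    exact hasDerivWithinAt_pi.mp (hasDerivWithinAt_fst (hasDerivWithinAt_snd (h τ hτ))) i

theorem continuous_refAt {b1 : Fin n → ℝ → V3} (hb : ∀ i, ContDiff ℝ (⊤ : ℕ∞) (b1 i)) :
    Continuous (refAt b1) :=
  (continuous_pi fun i => (hb i).continuous).prodMk
    (continuous_pi fun i => (hb i).continuous_deriv (by exact_mod_cast le_top))

/-- Solutions of the closed loop, cut off outside a neighbourhood of the equilibrium. -/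
theorem exists_cutoff_solution {b1 : Fin n → ℝ → V3} (hb : ∀ i, ContDiff ℝ (⊤ : ℕ∞) (b1 i))
    {s : Set (Ref n)} (hs : IsCompact s) {r : ℝ}
    (h : s ×ˢ Metric.closedBall (fullEq ν) r ⊆ closedDomain p Kx Kv) (t₀ : ℝ) (Z₀ : Full ν) :
    ∃ (y : ℝ → Full ν) (c : ℝ → ℝ), y t₀ = Z₀ ∧
      (∀ t ∈ Set.Ici t₀, HasDerivWithinAt y
        (c t • closedField p Kx Kv kR kΩ (refAt b1 t, y t)) (Set.Ici t₀) t) ∧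
      (∀ t, c t ≠ 0 → (refAt b1 t, y t) ∈ closedDomain p Kx Kv) ∧
      ∀ t, refAt b1 t ∈ s → ‖y t - fullEq ν‖ ≤ r → c t = 1 := by
  -- The cutoff acts jointly on reference and state. Compact support then gives Lipschitz and size
  -- bounds uniform in time, although `b₁` is controlled only for `t ≥ 0`.
  obtain ⟨χ, h1, h2, h3, h4⟩ := exists_cutoff (hs.prod (isCompact_closedBall (fullEq ν) r))
    (isOpen_closedDomain (p := p) (Kx := Kx) (Kv := Kv)) h
    (f := closedField p Kx Kv kR kΩ)
    (fun x hx => (contDiffAt_closedField hx).contDiffWithinAt)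
  obtain ⟨C, hC⟩ := ContDiff.lipschitzWith_of_hasCompactSupport h4 h3 one_ne_zero
  obtain ⟨L, hL⟩ := HasCompactSupport.exists_bound_of_continuous h4 h3.continuous
  obtain ⟨y, hy₀, hy⟩ := exists_global_solution (K := C) (L := L.toNNReal)
    (f := fun t Z => χ (refAt b1 t, Z) • closedField p Kx Kv kR kΩ (refAt b1 t, Z))
    (fun t => by
      have := hC.comp (LipschitzWith.prodMk_left (refAt b1 t))
      rw [mul_one] at this
      exact this)
    (fun Z => h3.continuous.comp ((continuous_refAt hb).prodMk continuous_const))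
    (fun t Z => (hL (refAt b1 t, Z)).trans (Real.le_coe_toNNReal L)) t₀ Z₀
  refine ⟨y, fun t => χ (refAt b1 t, y t), hy₀, hy, fun t => h2 _, fun t hts htr => h1 _ ?_⟩
  exact Set.mk_mem_prod hts (by rwa [mem_closedBall_iff_norm])

/-! ### From solutions to motions -/

variable {xd : V3} {b1 : Fin n → ℝ → V3}

theorem cmdAtt_mem_SO3 {b : Fin n → V3} {z : Outer ν} {i : Fin n}
    (h : thrust p Kx Kv z i ⨯₃ b i ≠ 0) : cmdAtt p Kx Kv b z i ∈ SO3 :=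
  desiredAttitude_mem_SO3 h

variable (p Kx Kv xd) in
/-- The state of the system. -/
def stateOf (b : Fin n → V3) (Z : Full ν) : State n ν where
  x0 := xd + Z.1.1
  v0 := Z.1.2.1
  R0 := Z.1.2.2.1
  Ω0 := Z.1.2.2.2.1
  q := Z.1.2.2.2.2.1
  ω := Z.1.2.2.2.2.2
  R := fun i => cmdAtt p Kx Kv b Z.1 i * Z.2.1 i

theorem ofState_stateOf (b : Fin n → V3) (Z : Full ν) :
    ofState xd (stateOf p Kx Kv xd b Z) = Z.1 := by
  rw [ofState, stateOf]
  simp only [add_sub_cancel_left]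

theorem stateOf_fullOf {b : Fin n → V3} {s : State n ν} {e : Fin n → V3}
    (hb : ∀ i, thrust p Kx Kv (ofState xd s) i ⨯₃ b i ≠ 0) :
    stateOf p Kx Kv xd b (fullOf p Kx Kv xd b s e) = s := by
  have hR : ∀ i, cmdAtt p Kx Kv b (ofState xd s) i *
      ((cmdAtt p Kx Kv b (ofState xd s) i)ᵀ * s.R i) = s.R i := fun i => by
    rw [← Matrix.mul_assoc, SO3.mul_transpose (cmdAtt_mem_SO3 (hb i)), Matrix.one_mul]
  rw [stateOf, fullOf]
  simp only [hR]
  simp only [ofState, add_sub_cancel]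

theorem cmdAttitude_stateOf (t : ℝ) (Z : Full ν) (i : Fin n) :
    cmdAttitude p Kx Kv xd b1 t (stateOf p Kx Kv xd (fun i => b1 i t) Z) i =
      cmdAtt p Kx Kv (fun i => b1 i t) Z.1 i := by
  rw [cmdAttitude_eq, ofState_stateOf]

theorem hat_vee {S : Mat3} (h : Sᵀ = -S) : hat (vee S) = S := by
  have h' : ∀ a b, S b a = -S a b := fun a b => congrFun (congrFun h a) b
  have h0 : ∀ a, S a a = 0 := fun a => by linarith [h' a a]
  ext a b
  fin_cases a <;> fin_cases b <;> simp [hat, vee, h0, h' 1 0, h' 0 2, h' 2 1]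

/-- The derivative of a curve of rotations. -/
theorem SO3.eq_mul_hat_vee {R : ℝ → Mat3} {D : Mat3} {I : Set ℝ} {t : ℝ} (ht : t ∈ I)
    (hI : UniqueDiffWithinAt ℝ I t) (hR : HasDerivWithinAt R D I t) (hmem : ∀ τ ∈ I, R τ ∈ SO3) :
    D = R t * hat (vee ((R t)ᵀ * D)) := by
  have h1 := HasDerivWithinAt.matMul (HasDerivWithinAt.matTranspose hR) hR
  have h2 : HasDerivWithinAt (fun τ => (R τ)ᵀ * R τ) 0 I t :=
    (hasDerivWithinAt_const t I (1 : Mat3)).congr (fun τ hτ => SO3.transpose_mul (hmem τ hτ))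
      (SO3.transpose_mul (hmem t ht))
  have h3 := hI.eq_deriv _ h1 h2
  have h4 : ((R t)ᵀ * D)ᵀ = -((R t)ᵀ * D) := by
    rw [Matrix.transpose_mul, Matrix.transpose_transpose]
    exact eq_neg_of_add_eq_zero_left h3
  rw [hat_vee h4, ← Matrix.mul_assoc, SO3.mul_transpose (hmem t ht), Matrix.one_mul]

variable (p Kx Kv b1) in
/-- The angular velocities of the quadrotors along a solution. -/
def angVelOf (y : ℝ → Full ν) (τ : ℝ) (i : Fin n) : V3 :=
  (y τ).2.2 i + ((y τ).2.1 i)ᵀ *ᵥ cmdAngVel p Kx Kv (refAt b1 τ, y τ) i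

theorem transpose_mul_cmdAtt {x : Ref n × Full ν} (hx : x ∈ closedDomain p Kx Kv) (i : Fin n) :
    (cmdAtt p Kx Kv x.1.1 x.2.1 i)ᵀ * (cmdAtt p Kx Kv x.1.1 x.2.1 i * x.2.2.1 i) = x.2.2.1 i := by
  rw [← Matrix.mul_assoc, SO3.transpose_mul (cmdAtt_mem_SO3 (hx.2 i)), Matrix.one_mul]

theorem transpose_mul_cmdAtt' {x : Ref n × Full ν} (hx : x ∈ closedDomain p Kx Kv) (i : Fin n) :
    (cmdAtt p Kx Kv x.1.1 x.2.1 i * x.2.2.1 i)ᵀ * cmdAtt p Kx Kv x.1.1 x.2.1 i = (x.2.2.1 i)ᵀ := by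
  rw [Matrix.transpose_mul, Matrix.mul_assoc,
    SO3.transpose_mul (cmdAtt_mem_SO3 (hx.2 i)), Matrix.mul_one]

theorem angVelErr_angVelOf {y : ℝ → Full ν} {t : ℝ}
    (h : (refAt b1 t, y t) ∈ closedDomain p Kx Kv) (i : Fin n) :
    angVelErr (cmdAttitude p Kx Kv xd b1 t (stateOf p Kx Kv xd (fun i => b1 i t) (y t)) i)
      ((stateOf p Kx Kv xd (fun i => b1 i t) (y t)).R i)
      (cmdAngVel p Kx Kv (refAt b1 t, y t) i) (angVelOf p Kx Kv b1 y t i) = (y t).2.2 i := by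
  rw [cmdAttitude_stateOf, angVelErr, angVelOf]
  have := transpose_mul_cmdAtt' h i
  change ((stateOf p Kx Kv xd (fun i => b1 i t) (y t)).R i)ᵀ *
    cmdAtt p Kx Kv (fun i => b1 i t) (y t).1 i = ((y t).2.1 i)ᵀ at this
  rw [this, add_sub_cancel_right]

/-- The physical variables are recovered as `R = R_c Q` and `Ω = e + Qᵀ Ω_c`. The desired angular
velocity is differentiable since it is a smooth function of the state and of `(b₁, ḃ₁)`. -/
theorem isMotion_of_solution (hb : ∀ i, ContDiff ℝ (⊤ : ℕ∞) (b1 i)) {y : ℝ → Full ν} {I : Set ℝ}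
    (hI : UniqueDiffOn ℝ I)
    (hy : ∀ t ∈ I, HasDerivWithinAt y (closedField p Kx Kv kR kΩ (refAt b1 t, y t)) I t)
    (hadm : ∀ t ∈ I, FullAdm (y t)) (hdom : ∀ t ∈ I, (refAt b1 t, y t) ∈ closedDomain p Kx Kv) :
    IsMotion p Kx Kv kR kΩ xd b1 I (fun τ => stateOf p Kx Kv xd (fun i => b1 i τ) (y τ))
      (angVelOf p Kx Kv b1 y) (fun τ i => cmdAngVel p Kx Kv (refAt b1 τ, y τ) i) := by
  have hcross : ∀ t ∈ I, ∀ i, thrust p Kx Kv (y t).1 i ≠ 0 ∧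
      axis3 (thrust p Kx Kv (y t).1 i) ⨯₃ b1 i t ≠ 0 := fun t ht i =>
    cross_ne_zero_iff.mp ((hdom t ht).2 i)
  have hRcm : ∀ t ∈ I, ∀ i, cmdAtt p Kx Kv (fun i => b1 i t) (y t).1 i ∈ SO3 := fun t ht i =>
    cmdAtt_mem_SO3 ((hdom t ht).2 i)
  have hb1 : ∀ i, Differentiable ℝ (b1 i) := fun i => (hb i).differentiable (by simp)
  have hb2 : ∀ i, Differentiable ℝ (deriv (b1 i)) := fun i =>
    (contDiff_infty_iff_deriv.mp (hb i)).2.differentiable (by simp)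
  have hout : ∀ t ∈ I, HasDerivWithinAt (fun τ => (y τ).1)
      (outerClosed p Kx Kv (refAt b1 t, y t)) I t := fun t ht => hasDerivWithinAt_fst (hy t ht)
  have hQ : ∀ t ∈ I, ∀ i, HasDerivWithinAt (fun τ => (y τ).2.1 i)
      ((y t).2.1 i * hat ((y t).2.2 i)) I t := fun t ht =>
    hasDerivWithinAt_pi.mp (hasDerivWithinAt_fst (hasDerivWithinAt_snd (hy t ht)))
  have hRc : ∀ t ∈ I, ∀ i, HasDerivWithinAt
      (fun τ => cmdAtt p Kx Kv (fun i => b1 i τ) (y τ).1 i)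
      (cmdAtt p Kx Kv (fun i => b1 i t) (y t).1 i *
        hat (cmdAngVel p Kx Kv (refAt b1 t, y t) i)) I t := fun t ht i => by
    have h1 : HasDerivWithinAt (fun τ => thrust p Kx Kv (y τ).1 i)
        (feedback Kx Kv (outerClosed p Kx Kv (refAt b1 t, y t)) i) I t := by
      have h2 := (feedback Kx Kv).hasFDerivAt.comp_hasDerivWithinAt t (hout t ht)
      exact (hasDerivWithinAt_pi.mp h2 i).const_add (thrustEq p i)
    have h2 : HasDerivWithinAt (fun τ => (thrust p Kx Kv (y τ).1 i, b1 i τ)) _ I t :=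
      h1.prodMk (hb1 i t).hasDerivAt.hasDerivWithinAt
    have h3 := ((contDiffAt_desiredAttitudeFun (k := 1)
      (w := (thrust p Kx Kv (y t).1 i, b1 i t)) ((hdom t ht).2 i)).differentiableAt
      one_ne_zero).hasFDerivAt.comp_hasDerivWithinAt t h2
    have h4 : HasDerivWithinAt (fun τ => cmdAtt p Kx Kv (fun i => b1 i τ) (y τ).1 i)
        (cmdAttDeriv p Kx Kv (refAt b1 t, y t) i) I t := h3
    exact h4.congr_deriv (SO3.eq_mul_hat_vee ht (hI t ht) h4 fun τ hτ => hRcm τ hτ i)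
  refine ⟨fun t ht => ⟨(hadm t ht).outer.R0_mem, fun i => SO3.mul_mem (hRcm t ht i)
    ((hadm t ht).Q_mem i), (hadm t ht).outer.q_unit, (hadm t ht).outer.q_ω⟩, fun t ht i => ?_,
    fun t ht i => ?_, fun t ht => ?_, fun t ht => ?_, fun t ht i j => ?_, fun t ht i => ?_,
    fun t ht => ?_, fun t ht i => ?_, fun t ht i => ?_⟩
  · rw [idealThrust_eq, ofState_stateOf]
    exact (hcross t ht i).1
  · rw [idealThrust_eq, ofState_stateOf]
    exact (hcross t ht i).2
  · exact (hasDerivWithinAt_fst (hout t ht)).const_add xd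
  · exact hasDerivWithinAt_mat.mp (hasDerivWithinAt_fst (hasDerivWithinAt_snd
      (hasDerivWithinAt_snd (hout t ht))))
  · exact hasDerivWithinAt_pi.mp (hasDerivWithinAt_pi.mp (hasDerivWithinAt_fst
      (hasDerivWithinAt_snd (hasDerivWithinAt_snd (hasDerivWithinAt_snd
      (hasDerivWithinAt_snd (hout t ht)))))) i) j
  · refine hasDerivWithinAt_mat.mp ((HasDerivWithinAt.matMul (hRc t ht i)
      (hQ t ht i)).congr_deriv ?_)
    change _ = cmdAtt p Kx Kv (fun i => b1 i t) (y t).1 i * (y t).2.1 i *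
      hat ((y t).2.2 i + ((y t).2.1 i)ᵀ *ᵥ cmdAngVel p Kx Kv (refAt b1 t, y t) i)
    rw [hat_add, Matrix.mul_assoc, SO3.hat_mul ((hadm t ht).Q_mem i), Matrix.mul_assoc,
      Matrix.mul_add, Matrix.mul_add, add_comm]
  · have hd : HasDerivWithinAt (fun τ => (y τ).1.2.2.2)
        (outerClosed p Kx Kv (refAt b1 t, y t)).2.2.2 I t :=
      hasDerivWithinAt_snd (hasDerivWithinAt_snd (hasDerivWithinAt_snd (hout t ht)))
    refine ⟨⟨(outerClosed p Kx Kv (refAt b1 t, y t)).2.1,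
      (outerClosed p Kx Kv (refAt b1 t, y t)).2.2.2.1,
      (outerClosed p Kx Kv (refAt b1 t, y t)).2.2.2.2.2⟩,
      hasDerivWithinAt_fst (hasDerivWithinAt_snd (hout t ht)), hasDerivWithinAt_fst hd,
      fun i j => hasDerivWithinAt_pi.mp (hasDerivWithinAt_pi.mp (hasDerivWithinAt_snd
        (hasDerivWithinAt_snd hd)) i) j, ?_⟩
    rw [motion_iff (hadm t ht).outer.q_unit
      (outerClosed_dot_eq_zero (hdom t ht) (hadm t ht).outer.q_unit)]
    refine ((acc_eq_iff (hdom t ht).1 (d := feedback Kx Kv (y t).1 +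
      thrustDev p Kx Kv (fun i => b1 i t) (y t))).mp rfl).trans ?_
    change forcing p (y t).1.2.2.1 (y t).1.2.2.2.1 (y t).1.2.2.2.2.1 (y t).1.2.2.2.2.2 _ =
      forcing p (y t).1.2.2.1 (y t).1.2.2.2.1 (y t).1.2.2.2.2.1 (y t).1.2.2.2.2.2 _
    congr 1
    funext i
    rw [Pi.add_apply, ← add_assoc, idealThrust_eq, ofState_stateOf, neg_neg, thrustDev]
    change thrust p Kx Kv (y t).1 i + (_ - thrust p Kx Kv (y t).1 i) = _
    rw [add_sub_cancel]
    rfl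
  · simp only [cmdAttitude_stateOf]
    exact hasDerivWithinAt_mat.mp (hRc t ht i)
  -- The second derivative of `b₁` appears only in `Ω̇_c`, which the feedforward cancels, so no
  -- bound on it is needed.
  · have hθ : HasDerivWithinAt (fun τ => (refAt b1 τ, y τ))
        (((fun i => deriv (b1 i) t), fun i => deriv (deriv (b1 i)) t),
          closedField p Kx Kv kR kΩ (refAt b1 t, y t)) I t :=
      HasDerivWithinAt.prodMk (HasDerivWithinAt.prodMk
        (hasDerivWithinAt_pi.mpr fun i => (hb1 i t).hasDerivAt.hasDerivWithinAt)
        (hasDerivWithinAt_pi.mpr fun i => (hb2 i t).hasDerivAt.hasDerivWithinAt)) (hy t ht)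
    have hΩc := ((contDiffAt_cmdAngVel (k := 1) (hdom t ht) i).differentiableAt
      one_ne_zero).hasFDerivAt.comp_hasDerivWithinAt t hθ
    have he := hasDerivWithinAt_pi.mp (hasDerivWithinAt_snd (hasDerivWithinAt_snd (hy t ht))) i
    have hw := hasDerivWithinAt_transpose_mulVec (hQ t ht i) hΩc
    refine ⟨_, _, he.fun_add hw, hΩc, moment_iff.mpr ?_⟩
    have hQe : (cmdAttitude p Kx Kv xd b1 t (stateOf p Kx Kv xd (fun i => b1 i t) (y t)) i)ᵀ *
        (stateOf p Kx Kv xd (fun i => b1 i t) (y t)).R i = (y t).2.1 i := by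
      rw [cmdAttitude_stateOf]
      exact transpose_mul_cmdAtt (hdom t ht) i
    rw [angVelErr_angVelOf (hdom t ht), hQe]
    simp only [Function.comp, add_sub_cancel_right]
    exact PosDef.mulVec_inv_mulVec (p.J_pos i) _

/-! ## Exponential stability -/

theorem refAt_mem_refSet {b1 : Fin n → ℝ → V3} (hb1_unit : ∀ i, ∀ t : ℝ, 0 ≤ t → vnorm (b1 i t) = 1)
    {B δ : ℝ} (hB : ∀ i, ∀ t : ℝ, 0 ≤ t → vnorm (deriv (b1 i) t) ≤ B)
    (hδ : ∀ i, ∀ t : ℝ, 0 ≤ t → δ ≤ vnorm (e3 ⨯₃ b1 i t)) {t : ℝ} (ht : 0 ≤ t) :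
    refAt b1 t ∈ refSet n B δ := fun i => ⟨hb1_unit i t ht, hB i t ht, hδ i t ht⟩

/-- Solutions that start near the equilibrium stay near it and converge exponentially. -/
theorem exists_exp_decay (hn : 0 < n) {p : Params n ν}
    (hρ : (∑ i, p.ρ i) 0 = 0 ∧ (∑ i, p.ρ i) 1 = 0)
    {Kx Kv : Matrix (Fin n × Fin 3) (LinIdx ν) ℝ} (hK : IsHurwitz (linClosedLoop p Kx Kv))
    {kR kΩ : ℝ} (hkR : 0 < kR) (hkΩ : 0 < kΩ) (B : ℝ) {δ : ℝ} (hδ : 0 < δ) :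
    ∃ r > 0, ∃ r₀ > 0, ∃ κ > 0, ∃ γ > 0, r ≤ 1 / 2 ∧ r₀ < r ∧
      refSet n B δ ×ˢ Metric.closedBall (fullEq ν) r ⊆ closedDomain p Kx Kv ∧
      ∀ (t₀ T : ℝ) (θ : ℝ → Ref n) (y : ℝ → Full ν), (∀ t ∈ Set.Ico t₀ T, θ t ∈ refSet n B δ) →
        ContinuousOn y (Set.Ico t₀ T) → (∀ t ∈ Set.Ico t₀ T, FullAdm (y t)) →
        (∀ t ∈ Set.Ico t₀ T, ‖y t - fullEq ν‖ < r →
          HasDerivWithinAt y (closedField p Kx Kv kR kΩ (θ t, y t)) (Set.Ico t₀ T) t) →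
        ‖y t₀ - fullEq ν‖ < r₀ → ∀ t ∈ Set.Ico t₀ T, ‖y t - fullEq ν‖ < r ∧
          ‖y t - fullEq ν‖ ≤ κ * Real.exp (-γ * (t - t₀)) * ‖y t₀ - fullEq ν‖ := by
  obtain ⟨V, r, hr, c₁, hc₁, c₂, hc₂, γ, hγ, hr2, hsub, hV⟩ :=
    exists_lyapunov hn hρ hK hkR hkΩ B hδ
  -- Starting below `r₀ = r c₁/(c₁ + c₂)` gives `c₂ ‖y t₀‖² < c₁ r²`, with `y` measured from
  -- equilibrium, because `c₁ c₂ < (c₁ + c₂)²`.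
  have hr₀ : r * (c₁ / (c₁ + c₂)) < r :=
    mul_lt_of_lt_one_right hr ((div_lt_one (by positivity)).mpr (by linarith))
  refine ⟨r, hr, r * (c₁ / (c₁ + c₂)), by positivity, √(c₂ / c₁),
    Real.sqrt_pos_of_pos (by positivity), γ, hγ, hr2, hr₀, hsub,
    fun t₀ T θ y hθ hcont hadm hy h₀ => ?_⟩
  refine exp_decay_of_local_lyapunov (e := fun t => ‖y t - fullEq ν‖) (V := fun t => V (y t)) hc₁
    hγ hr (hcont.sub continuousOn_const).norm (fun _ => norm_nonneg _) (fun t ht hlt => ?_)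
    (h₀.trans hr₀) ?_
  · obtain ⟨h1, h2, h3⟩ := hV (y t) (hadm t ht) hlt.le
    exact ⟨h1, h2, h3 _ (hθ t ht) y _ t rfl (hy t ht hlt)⟩
  · have h1 : ‖y t₀ - fullEq ν‖ ^ 2 ≤ (r * (c₁ / (c₁ + c₂))) ^ 2 :=
      pow_le_pow_left₀ (norm_nonneg _) h₀.le 2
    refine (mul_le_mul_of_nonneg_left h1 hc₂.le).trans_lt ?_
    have e1 : c₂ * (r * (c₁ / (c₁ + c₂))) ^ 2 = c₁ * r ^ 2 * (c₁ * c₂ / (c₁ + c₂) ^ 2) := by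
      field_simp
    rw [e1]
    refine mul_lt_of_lt_one_right (by positivity) ((div_lt_one (by positivity)).mpr ?_)
    nlinarith [mul_pos hc₁ hc₂, sq_nonneg c₁, sq_pos_of_pos hc₂]

theorem errorsExpStable (hn : 0 < n) (p : Params n ν)
    (hρ : (∑ i, p.ρ i) 0 = 0 ∧ (∑ i, p.ρ i) 1 = 0)
    (Kx Kv : Matrix (Fin n × Fin 3) (LinIdx ν) ℝ) (hK : IsHurwitz (linClosedLoop p Kx Kv))
    (kR kΩ : ℝ) (hkR : 0 < kR) (hkΩ : 0 < kΩ) (xd : V3)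
    (b1 : Fin n → ℝ → V3) (hb1_smooth : ∀ i, ContDiff ℝ (⊤ : ℕ∞) (b1 i))
    (hb1_unit : ∀ i, ∀ t : ℝ, 0 ≤ t → vnorm (b1 i t) = 1)
    (hb1_deriv : ∃ B : ℝ, ∀ i, ∀ t : ℝ, 0 ≤ t → vnorm (deriv (b1 i) t) ≤ B)
    (hb1_axis : ∃ δ : ℝ, 0 < δ ∧ ∀ i, ∀ t : ℝ, 0 ≤ t → δ ≤ vnorm (e3 ⨯₃ b1 i t)) :
    ErrorsExpStable p Kx Kv kR kΩ xd b1 := by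
  obtain ⟨B, hB⟩ := hb1_deriv
  obtain ⟨δ, hδ, hax⟩ := hb1_axis
  have hθ : ∀ t : ℝ, 0 ≤ t → refAt b1 t ∈ refSet n B δ := fun t ht =>
    refAt_mem_refSet hb1_unit hB hax ht
  obtain ⟨r, hr, r₀, hr₀, κ, hκ, γ, hγ, hr2, hrr, hsub, hdecay⟩ :=
    exists_exp_decay hn hρ hK hkR hkΩ B hδ
  obtain ⟨C, hC, hErr⟩ := exists_fullErr_le ν
  have hb1 : ∀ i, Differentiable ℝ (b1 i) := fun i => (hb1_smooth i).differentiable (by simp)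
  unfold ErrorsExpStable
  intro Rc eΩ
  -- In the domain `D` the distance to equilibrium is at most four times the tracking error, and the
  -- tracking error is at most `C` times the distance.
  refine ⟨r₀ / 4, by positivity, C * κ * 4, by positivity, γ, hγ, fun t₀ ht₀ => ⟨?_, ?_⟩⟩
  · intro sI eI hadmI hdomI hE
    have hdomI' := (inDomain_iff (p := p) (Kx := Kx) (Kv := Kv) (xd := xd) b1 t₀ sI eI).mp hdomI
    have hE' : fullErr (fullOf p Kx Kv xd (fun i => b1 i t₀) sI eI) < r₀ / 4 := by
      rwa [← trackErr_eq]
    set Z₀ := fullOf p Kx Kv xd (fun i => b1 i t₀) sI eI with hZ₀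
    have hout : ‖(ofState xd sI) - outerEq ν‖ ≤ r := by
      have h1 : ‖Z₀.1 - outerEq ν‖ ≤ 4 * fullErr Z₀ :=
        OuterAdm.norm_sub_le_fullErr hadmI.outerAdm hdomI'.1
      exact h1.trans (by linarith)
    -- The desired attitude is only known to be a rotation once this cross product is nonzero. That
    -- depends on `z` and `b₁` alone, so it is tested at the point with the given `z` and zero
    -- attitude errors, which already lies in the ball.
    have hcross : ∀ i, thrust p Kx Kv (ofState xd sI) i ⨯₃ b1 i t₀ ≠ 0 := by
      have h1 : ((ofState xd sI, fun _ => 1, 0) : Full ν) ∈ Metric.closedBall (fullEq ν) r := by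
        rw [mem_closedBall_iff_norm]
        exact norm_sub_fullEq_le hr.le hout (fun i => by simp [hr.le]) (fun i => by simp [hr.le])
      exact (hsub (Set.mk_mem_prod (hθ t₀ ht₀) h1)).2
    have hadm₀ : FullAdm Z₀ := hadmI.fullAdm hcross eI
    have hZ₀r : ‖Z₀ - fullEq ν‖ < r₀ :=
      (hadm₀.norm_sub_le_fullErr hdomI'.1 hdomI'.2).trans_lt (by linarith)
    obtain ⟨y, c, hy₀, hy, hcdom, hc1⟩ := exists_cutoff_solution (kR := kR) (kΩ := kΩ) hb1_smooth
      (isCompact_refSet B δ) hsub t₀ Z₀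
    have hadm : ∀ t ∈ Set.Ici t₀, FullAdm (y t) := fun t ht =>
      fullAdm_of_hasDerivWithinAt hy hcdom (by rwa [hy₀]) ht
    have hpos : ∀ t ∈ Set.Ici t₀, 0 ≤ t := fun t ht => ht₀.trans ht
    have hyc : ∀ t ∈ Set.Ici t₀, ‖y t - fullEq ν‖ < r →
        HasDerivWithinAt y (closedField p Kx Kv kR kΩ (refAt b1 t, y t)) (Set.Ici t₀) t :=
      fun t ht hlt => by
        have := hy t ht
        rwa [hc1 t (hθ t (hpos t ht)) hlt.le, one_smul] at this
    -- The decay estimate needs the differential equation only inside the ball, where the cutoff is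
    -- one. It thus shows that the cut-off solution never leaves the ball and solves the original
    -- equation.
    have hball : ∀ t ∈ Set.Ici t₀, ‖y t - fullEq ν‖ < r := fun t ht => by
      have hmem : t ∈ Set.Ico t₀ (t + 1) := ⟨ht, by linarith⟩
      refine (hdecay t₀ (t + 1) (refAt b1) y (fun τ hτ => hθ τ (hpos τ hτ.1)) ?_
        (fun τ hτ => hadm τ hτ.1)
        (fun τ hτ hlt => (hyc τ hτ.1 hlt).mono Set.Ico_subset_Ici_self) (by rwa [hy₀]) t hmem).1
      exact fun τ hτ => (hy τ hτ.1).continuousWithinAt.mono Set.Ico_subset_Ici_self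
    have hdom : ∀ t ∈ Set.Ici t₀, (refAt b1 t, y t) ∈ closedDomain p Kx Kv := fun t ht =>
      hsub (Set.mk_mem_prod (hθ t (hpos t ht))
        (by rw [mem_closedBall_iff_norm]; exact (hball t ht).le))
    refine ⟨_, _, _, isMotion_of_solution hb1_smooth (uniqueDiffOn_Ici t₀)
      (fun t ht => hyc t ht (hball t ht)) hadm hdom, ?_, ?_⟩
    · simp only [hy₀]
      exact stateOf_fullOf hcross
    · funext i
      refine (angVelErr_angVelOf (hdom t₀ Set.self_mem_Ici) i).trans ?_
      rw [hy₀]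
      rfl
  · intro T s Ω Ωc hT hmot hdomI hE t ht
    have hmem₀ : t₀ ∈ Set.Ico t₀ T := ⟨le_rfl, hT⟩
    have herr : ∀ τ, trackErr xd (s τ) (Rc τ (s τ)) (eΩ τ (s τ) (Ωc τ) (Ω τ)) =
        fullErr (fullPath p Kx Kv xd b1 s Ω Ωc τ) := fun τ => trackErr_eq b1 τ (s τ) _
    rw [herr] at hE
    rw [herr, herr]
    have hdomI' : attPsi 1 (fullPath p Kx Kv xd b1 s Ω Ωc t₀).1.2.2.1 < 1 ∧
      ∀ i, attPsi 1 ((fullPath p Kx Kv xd b1 s Ω Ωc t₀).2.1 i) < 1 :=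
        (inDomain_iff b1 t₀ (s t₀) _).mp hdomI
    have hle₀ := (hmot.fullAdm hmem₀).norm_sub_le_fullErr hdomI'.1 hdomI'.2
    -- Continuity is required on the whole interval, so that the path cannot jump out of the ball;
    -- the differential equation is used only inside it.
    have hcont : ContinuousOn (fullPath p Kx Kv xd b1 s Ω Ωc) (Set.Ico t₀ T) := fun τ hτ => by
      obtain ⟨a, e', hd, -⟩ := hmot.exists_hasDerivWithinAt hτ
      exact hd.continuousWithinAt
    have hderiv : ∀ τ ∈ Set.Ico t₀ T, ‖fullPath p Kx Kv xd b1 s Ω Ωc τ - fullEq ν‖ < r →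
        HasDerivWithinAt (fullPath p Kx Kv xd b1 s Ω Ωc)
          (closedField p Kx Kv kR kΩ (refAt b1 τ, fullPath p Kx Kv xd b1 s Ω Ωc τ))
          (Set.Ico t₀ T) τ := fun τ hτ hlt => by
      have hd : (refAt b1 τ, fullPath p Kx Kv xd b1 s Ω Ωc τ) ∈ closedDomain p Kx Kv :=
        hsub (Set.mk_mem_prod (hθ τ (ht₀.trans hτ.1)) (mem_closedBall_iff_norm.mpr hlt.le))
      exact hmot.hasDerivWithinAt (uniqueDiffOn_Ico t₀ T) hb1 hτ hd.1
    have hstart : ‖fullPath p Kx Kv xd b1 s Ω Ωc t₀ - fullEq ν‖ < r₀ :=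
      hle₀.trans_lt (by linarith)
    obtain ⟨hlt, hexp⟩ := hdecay t₀ T (refAt b1) (fullPath p Kx Kv xd b1 s Ω Ωc)
      (fun τ hτ => hθ τ (ht₀.trans hτ.1)) hcont (fun τ hτ => hmot.fullAdm hτ) hderiv hstart t ht
    have hadm := hmot.fullAdm ht
    refine ⟨(inDomain_iff b1 t (s t) (eΩ t (s t) (Ωc t) (Ω t))).mpr ⟨?_, fun i => ?_⟩, ?_⟩
    · refine SO3.attPsi_lt_one hadm.outer.R0_mem (le_trans ?_ (hlt.le.trans hr2))
      exact (norm_fst_le ((fullPath p Kx Kv xd b1 s Ω Ωc t).1 - outerEq ν).2.2).trans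
        ((norm_snd_le _).trans ((norm_snd_le _).trans (norm_outer_sub_le _)))
    · exact SO3.attPsi_lt_one (hadm.Q_mem i) ((norm_rot_sub_le _ i).trans (hlt.le.trans hr2))
    · refine (hErr _).trans ((mul_le_mul_of_nonneg_left hexp hC.le).trans ?_)
      have h1 : 0 ≤ C * (κ * Real.exp (-γ * (t - t₀))) := by positivity
      have := mul_le_mul_of_nonneg_left hle₀ h1
      linarith

end QuadPayload

end

theorem mainTheorem1 {n : ℕ} (hn : 0 < n) {ν : Fin n → ℕ} (p : Params n ν)
    (hρ : (∑ i, p.ρ i) 0 = 0 ∧ (∑ i, p.ρ i) 1 = 0)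
    (Kx Kv : Matrix (Fin n × Fin 3) (LinIdx ν) ℝ) (hK : IsHurwitz (linClosedLoop p Kx Kv))
    (kR kΩ : ℝ) (hkR : 0 < kR) (hkΩ : 0 < kΩ) (xd : V3)
    (b1 : Fin n → ℝ → V3) (hb1_smooth : ∀ i, ContDiff ℝ (⊤ : ℕ∞) (b1 i))
    (hb1_unit : ∀ i, ∀ t : ℝ, 0 ≤ t → vnorm (b1 i t) = 1)
    (hb1_deriv : ∃ B : ℝ, ∀ i, ∀ t : ℝ, 0 ≤ t → vnorm (deriv (b1 i) t) ≤ B)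
    (hb1_axis : ∃ δ : ℝ, 0 < δ ∧ ∀ i, ∀ t : ℝ, 0 ≤ t → δ ≤ vnorm (e3 ⨯₃ b1 i t)) :
    ErrorsExpStable p Kx Kv kR kΩ xd b1 := by
  exact errorsExpStable hn p hρ Kx Kv hK kR kΩ hkR hkΩ xd b1 hb1_smooth hb1_unit hb1_deriv hb1_axis
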